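/- **Definitions.** For a finite graph $G=(V,E)$ with $n=|V|$, a labeling is a bijection $f:V\to\{1,\dots,n\}$; $B(f)=\max_{uv\in E}|f(u)-f(v)|$, and the bandwidth is $B(G)=\min_f B(f)$. $G$ is $\delta$-dense if its minimum degree is at least $\delta n$. **Algorithm 2** (with an integer constant $c$; the input is the adjacency matrix of $G$). 1. Choose $k=c\,(\lfloor\log_2\lfloor\log_2 n\rfloor\rfloor+1)$ roots independently and uniformly at random from $V$; they form the set $R'$. 2. By breadth-first search from each root, find the vertices at distance $0,1,2,3$ from it. 3. Search, by binary search, for a box size $\beta$ between the minimum degree of $G$ and $\lceil n/2\rceil$ (only the minimum degree is tried if it is the larger one). To test $\beta$, take $b=\lceil n/\beta\rceil$ boxes in a row and go through all the placements of the roots into the boxes. For each placement: * for each vertex $v$ let $I_v=\{i,\dots,j\}$ be the interval of all boxes that are, for every root $u$, in the box of $u$ if $v=u$, at most two boxes away from the box of $u$ if $1\le d(u,v)\le 2$, and at most three boxes away from it if $d(u,v)=3$; * build the flow network with a source, a sink, a node for each class $B_{ij}$ ($1\le i,j\le b$) and a node for each box. The edge from the source to $B_{ij}$ has capacity $|\{v: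 I_v=\{i,\dots,j\}\}|$, there are edges of unrestricted capacity from $B_{ij}$ to the boxes $i,\dots,j$, and the edge from each box to the sink has capacity $\beta$; * find a maximum integral flow by augmenting paths. If its value is $n$, place as many vertices of the class $B_{ij}$ into each box as the flow from $B_{ij}$ to that box says, label the vertices $1,\dots,n$ box after box, and accept $\beta$. If no placement is accepted, $\beta$ is rejected. The output is the labeling of the last accepted box size. The algorithm runs on a unit-cost random access machine with arrays, a uniform random draw from $\{0,\dots,m-1\}$, and the operations successor, truncated subtraction and halving (so that all words have $O(\log n)$ bits in polynomial time). **Theorem 2.** Algorithm 2 is a randomized 6-approximation algorithm for the bandwidth of $\delta$-dense graphs with running time $O(n^2\log\log n)$. Precisely, let $0<\delta<1$ and $0<\alpha<1$. There is a $c_0$ such that for every integer $c\ge c_0$ there is a constant $C$ with the following properties. For every $n$ and every $\delta$-dense graph $G$ on $n$ vertices, Algorithm 2 with the constant $c$ * outputs a labeling of $G$, whatever the random choices; * solves, whatever the random choices, only maximum-flow instances with at most $\lceil 1/\delta\rceil^2+\lceil 1/\delta\rceil+2$ nodes, a number that is independent of $n$; * makes, whatever the random choices, at most $C\,n^2\log\log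 n$ steps if $n\ge 3$; * outputs, with probability at least $(1-\alpha)^2$, a labeling $f$ with $B(f)\le 6\,B(G)$. -/

import Mathlib

/-! ### Bandwidth of a graph -/

namespace Bandwidth

/-- A proper labeling: a bijection from the vertices onto `{1, …, |V|}`. -/
def IsLabeling {V : Type*} [Fintype V] (f : V → ℕ) : Prop :=
  Set.BijOn f Set.univ (Set.Icc 1 (Fintype.card V))

/-- `B(f)`: the maximum of `|f u - f v|` over the edges `uv` (zero if there is no edge). -/
def width {V : Type*} [Fintype V] (G : SimpleGraph V) [DecidableRel G.Adj] (f : V → ℕ) : ℕ :=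
  (Finset.univ.filter fun p : V × V => G.Adj p.1 p.2).sup
    fun p => ((f p.1 : ℤ) - (f p.2 : ℤ)).natAbs

/-- The bandwidth `B(G)`: the minimum of `B(f)` over all labelings `f`. -/
noncomputable def bandwidth {V : Type*} [Fintype V] (G : SimpleGraph V) [DecidableRel G.Adj] : ℕ :=
  sInf {B | ∃ f : V → ℕ, IsLabeling f ∧ width G f = B}

/-- `G` is `δ`-dense: the minimum degree is at least `δ |V|`. -/
def IsDense {V : Type*} [Fintype V] (δ : ℝ) (G : SimpleGraph V) [DecidableRel G.Adj] : Prop :=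
  δ * (Fintype.card V : ℝ) ≤ (G.minDegree : ℝ)

end Bandwidth

/-! ### A unit-cost random access machine

Programs act on finitely many registers and finitely many (two-dimensional) arrays of natural
numbers.  Control structures are sequencing, branching and counted loops; a random number can be
drawn.  Every node of an expression or a condition costs one step when it is evaluated, and so does
every assignment, array write, random draw, branching, loop entry and loop iteration.

The only arithmetic that increases a number is the successor, so that numbers never exceed the
largest input number or program constant by more than the number of steps: in time polynomial in
`n` all the words have `O(log n)` bits. -/

namespace RAM

/-- The names of the registers. -/
inductive Reg
  | n | c | i | j | h | v | w | x | y | r | p | t | it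
  | lg | ll | k | deg | mindeg | lo | hi | gap | box | b | num | acc | rest
  | found | done | carry | left | right | nodes | size | flow | count
  deriving DecidableEq

/-- The names of the arrays. -/
inductive Arr
  | adj | root | dist | pos | start | finish | cls | ident | res | par | place | label
  deriving DecidableEq

/-- Arithmetic expressions. -/
inductive Expr
  | num (m : ℕ)
  | reg (z : Reg)
  | get (a : Arr) (i j : Expr)
  | succ (e : Expr)
  | sub (e₁ e₂ : Expr)
  | half (e : Expr)

instance : Coe Reg Expr := ⟨Expr.reg⟩

instance (m : ℕ) : OfNat Expr m := ⟨Expr.num m⟩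

/-- Conditions. -/
inductive Cond
  | lt (e₁ e₂ : Expr)
  | eq (e₁ e₂ : Expr)
  | not (q : Cond)
  | and (q₁ q₂ : Cond)

/-- Programs. -/
inductive Cmd
  | skip
  | assign (z : Reg) (e : Expr)
  | write (a : Arr) (i j e : Expr)
  | rand (z : Reg) (e : Expr)
  | seq (c₁ c₂ : Cmd)
  | ifElse (q : Cond) (c₁ c₂ : Cmd)
  | loop (z : Reg) (e : Expr) (body : Cmd)

infixr:30 " ;; " => Cmd.seq

/-- A branching without an alternative. -/
def Cmd.ifThen (q : Cond) (c : Cmd) : Cmd := Cmd.ifElse q c Cmd.skip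

/-- The memory, together with the number of steps made so far. -/
structure State where
  reg : Reg → ℕ
  arr : Arr → ℕ → ℕ → ℕ
  time : ℕ

/-- Count `t` steps. -/
def State.tick (s : State) (t : ℕ) : State := { s with time := s.time + t }

/-- Overwrite a register. -/
def State.setReg (s : State) (z : Reg) (m : ℕ) : State :=
  { s with reg := Function.update s.reg z m }

/-- Overwrite a cell of an array. -/
def State.setArr (s : State) (a : Arr) (i j m : ℕ) : State :=
  { s with
    arr := Function.update s.arr a fun i' j' => if i' = i ∧ j' = j then m else s.arr a i' j' }

/-- The value of an expression (`sub` is truncated at zero, `half` rounds down). -/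
def Expr.eval (s : State) : Expr → ℕ
  | .num m => m
  | .reg z => s.reg z
  | .get a i j => s.arr a (i.eval s) (j.eval s)
  | .succ e => e.eval s + 1
  | .sub e₁ e₂ => e₁.eval s - e₂.eval s
  | .half e => e.eval s / 2

/-- The number of steps it takes to evaluate an expression. -/
def Expr.cost : Expr → ℕ
  | .num _ => 1
  | .reg _ => 1
  | .get _ i j => i.cost + j.cost + 1
  | .succ e => e.cost + 1
  | .sub e₁ e₂ => e₁.cost + e₂.cost + 1
  | .half e => e.cost + 1

/-- The truth value of a condition. -/
def Cond.eval (s : State) : Cond → Bool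
  | .lt e₁ e₂ => decide (e₁.eval s < e₂.eval s)
  | .eq e₁ e₂ => decide (e₁.eval s = e₂.eval s)
  | .not q => !(q.eval s)
  | .and q₁ q₂ => q₁.eval s && q₂.eval s

/-- The number of steps it takes to evaluate a condition. -/
def Cond.cost : Cond → ℕ
  | .lt e₁ e₂ => e₁.cost + e₂.cost + 1
  | .eq e₁ e₂ => e₁.cost + e₂.cost + 1
  | .not q => q.cost + 1
  | .and q₁ q₂ => q₁.cost + q₂.cost + 1

/-- A uniformly random element of `{0, …, m - 1}` (and `0` if `m = 0`). -/
noncomputable def uniform : ℕ → PMF ℕ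
  | 0 => PMF.pure 0
  | m + 1 => (PMF.uniformOfFintype (Fin (m + 1))).map fun a => (a : ℕ)

/-- Perform `f 0`, …, `f (m - 1)` one after the other. -/
noncomputable def iterate (f : ℕ → State → PMF State) : ℕ → State → PMF State
  | 0, s => PMF.pure s
  | m + 1, s => (iterate f m s).bind (f m)

/-- The distribution of the final state.  `loop z e body` evaluates `e` once, to `m`, and executes
`body` for `z = 0, …, m - 1`. -/
noncomputable def exec : Cmd → State → PMF State
  | .skip, s => PMF.pure s
  | .assign z e, s => PMF.pure ((s.setReg z (e.eval s)).tick (e.cost + 1))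
  | .write a i j e, s =>
      PMF.pure ((s.setArr a (i.eval s) (j.eval s) (e.eval s)).tick (i.cost + j.cost + e.cost + 1))
  | .rand z e, s => (uniform (e.eval s)).map fun m => (s.setReg z m).tick (e.cost + 1)
  | .seq c₁ c₂, s => (exec c₁ s).bind (exec c₂)
  | .ifElse q c₁ c₂, s =>
      if q.eval s then exec c₁ (s.tick (q.cost + 1)) else exec c₂ (s.tick (q.cost + 1))
  | .loop z e body, s =>
      iterate (fun m t => exec body ((t.setReg z m).tick 1)) (e.eval s) (s.tick (e.cost + 1))

end RAM

/-! ### The algorithm -/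

namespace Algorithm2

open RAM Reg Arr Expr Cond Cmd

/-- Compute `lg = ⌊log₂ n⌋`, `ll = ⌊log₂ lg⌋` (for positive arguments) and the number of roots
`k = c (ll + 1)`. -/
def sampleSize : Cmd :=
  assign x n ;; assign lg 0 ;;
  loop i n (ifThen (lt 1 x) (assign x (half x) ;; assign lg (succ lg))) ;;
  assign x lg ;; assign ll 0 ;;
  loop i lg (ifThen (lt 1 x) (assign x (half x) ;; assign ll (succ ll))) ;;
  assign k 0 ;;
  loop i (succ ll) (loop j c (assign k (succ k)))

/-- Choose the roots `root[0], …, root[k - 1]` independently and uniformly at random. -/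
def chooseRoots : Cmd :=
  loop i k (rand x n ;; write root i 0 x)

/-- Breadth-first search from each root, layer by layer, for the first three layers:
`dist[i][v]` is the distance of `v` from the `i`-th root, or `4` if that is more than three. -/
def search : Cmd :=
  loop i k
    (loop v n (write dist i v 4) ;;
     write dist i (get root i 0) 0 ;;
     loop j 3
       (loop v n
         (ifThen (eq (get dist i v) j)
           (loop w n
             (ifThen (and (eq (get adj v w) 1) (eq (get dist i w) 4))
               (write dist i w (succ j)))))))

/-- Compute the minimum degree. -/
def minimumDegree : Cmd :=
  assign mindeg n ;;
  loop v n
    (assign deg 0 ;;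
     loop w n (ifThen (eq (get adj v w) 1) (assign deg (succ deg))) ;;
     ifThen (lt deg mindeg) (assign mindeg deg))

/-- Compute the number `b = ⌈n / box⌉` of boxes, the number `num = b ^ k` of placements of
the roots into the boxes, and the first placement. -/
def prepareBoxes : Cmd :=
  assign b 0 ;; assign rest n ;;
  loop i n (ifThen (lt 0 rest) (assign rest (sub rest box) ;; assign b (succ b))) ;;
  assign num 1 ;;
  loop i k
    (assign acc 0 ;;
     loop j num (loop h b (assign acc (succ acc))) ;;
     assign num acc) ;;
  loop i k (write pos i 0 0)

/-- Replace the placement `pos` of the roots by the next one, in the order of counting in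
base `b`. -/
def nextPlacement : Cmd :=
  assign carry 1 ;;
  loop i k
    (ifThen (eq carry 1)
      (ifElse (lt (succ (get pos i 0)) b)
        (write pos i 0 (succ (get pos i 0)) ;; assign carry 0)
        (write pos i 0 0)))

/-- Compute the interval `I_v = {start[v], …, finish[v]}` of the boxes allowed for each `v`: the
intersection of the windows around the boxes of the roots within distance three.  The window of a
root reaches zero boxes far for the root itself, two boxes far for the vertices within distance
two, and three boxes far for those at distance three. -/
def intervals : Cmd :=
  loop v n
    (write start v 0 0 ;; write finish v 0 (sub b 1) ;;
     loop i k
       (assign left 0 ;; assign right (sub b 1) ;;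
        ifThen (eq (get dist i v) 0)
          (assign left (get pos i 0) ;; assign right (get pos i 0)) ;;
        ifThen (and (lt 0 (get dist i v)) (lt (get dist i v) 3))
          (assign left (sub (get pos i 0) 2) ;; assign right (succ (succ (get pos i 0)))) ;;
        ifThen (eq (get dist i v) 3)
          (assign left (sub (get pos i 0) 3) ;; assign right (succ (succ (succ (get pos i 0))))) ;;
        ifThen (lt (get start v 0) left) (write start v 0 left) ;;
        ifThen (lt right (get finish v 0)) (write finish v 0 right)))

/-- Build the flow network: node `0` is the source, node `1` the sink, node `2 + h` the box `h`, and
node `ident[i][j]` the class `B_ij` of the vertices whose interval is `{i, …, j}`.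
The class `B_ij` has `cls[i][j]` vertices, which is the capacity of the edge from the source to it;
it has an edge to each of the boxes `i, …, j`, with a capacity that exceeds the total supply `n`;
and each box has an edge to the sink whose capacity is the box size.
`res` holds the residual capacities, `nodes` is the number of nodes of the network, and `size` is
the largest number of nodes of a network built so far. -/
def network : Cmd :=
  loop i b (loop j b (write cls i j 0)) ;;
  loop v n
    (write cls (get start v 0) (get finish v 0) (succ (get cls (get start v 0) (get finish v 0)))) ;;
  assign nodes 2 ;;
  loop h b (assign nodes (succ nodes)) ;;
  loop i b (loop j b (write ident i j nodes ;; assign nodes (succ nodes))) ;;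
  ifThen (lt size nodes) (assign size nodes) ;;
  loop x nodes (loop y nodes (write res x y 0)) ;;
  loop i b
    (loop j b
      (write res 0 (get ident i j) (get cls i j) ;;
       loop h b
         (ifThen (and (lt i (succ h)) (lt h (succ j)))
           (write res (get ident i j) (succ (succ h)) (succ n))))) ;;
  loop h b (write res (succ (succ h)) 1 box)

/-- A maximum flow by augmenting paths: search for the nodes that can be reached from the source in
the residual network (`par[x]` is the predecessor of `x`, or `nodes` if `x` has not been reached),
and push one unit along the path to the sink, if there is one; do so `n` times.
The value of the flow is `flow`. -/
def maximumFlow : Cmd :=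
  assign flow 0 ;;
  loop it n
    (loop x nodes (write par x 0 nodes) ;;
     write par 0 0 0 ;;
     loop r nodes
       (loop x nodes
         (ifThen (not (eq (get par x 0) nodes))
           (loop y nodes
             (ifThen (and (eq (get par y 0) nodes) (lt 0 (get res x y)))
               (write par y 0 x))))) ;;
     ifThen (not (eq (get par 1 0) nodes))
       (assign y 1 ;;
        loop r nodes
          (ifThen (lt 0 y)
            (assign x (get par y 0) ;;
             write res x y (sub (get res x y) 1) ;;
             write res y x (succ (get res y x)) ;;
             assign y x)) ;;
        assign flow (succ flow)))

/-- Convert the flow to a layout: the flow from `B_ij` to the box `h` is the residual capacity of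
the reversed edge, and that many vertices of the class `B_ij` are placed into the box `h`.  Then
label the vertices by `1, …, n` box after box. -/
def convert : Cmd :=
  loop v n
    (assign done 0 ;;
     loop h b
       (ifThen (and (eq done 0)
           (lt 0 (get res (succ (succ h)) (get ident (get start v 0) (get finish v 0)))))
         (write place v 0 h ;;
          write res (succ (succ h)) (get ident (get start v 0) (get finish v 0))
            (sub (get res (succ (succ h)) (get ident (get start v 0) (get finish v 0))) 1) ;;
          assign done 1))) ;;
  assign count 0 ;;
  loop h b
    (loop v n
      (ifThen (eq (get place v 0) h)
        (assign count (succ count) ;; write label v 0 count)))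

/-- Test the box size `box`: go through the placements of the roots until one of them admits a flow
of value `n`; that flow is then converted to a layout, and `found` is set to `1`. -/
def testBoxSize : Cmd :=
  prepareBoxes ;;
  assign found 0 ;;
  loop p num
    (ifThen (eq found 0)
      (intervals ;; network ;; maximumFlow ;;
       ifThen (eq flow n) (convert ;; assign found 1)) ;;
     nextPlacement)

/-- Binary search for the box size, from the minimum degree to `⌈n / 2⌉`; the sizes still to be
considered are those in `[lo, hi)`. -/
def binarySearch : Cmd :=
  assign lo mindeg ;; assign hi (sub n (half n)) ;;
  ifThen (lt hi lo) (assign hi lo) ;;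
  assign hi (succ hi) ;;
  loop t (succ (succ lg))
    (ifThen (lt lo hi)
      (assign gap (half (sub hi lo)) ;; assign box lo ;;
       loop i gap (assign box (succ box)) ;;
       testBoxSize ;;
       ifElse (eq found 1) (assign hi box) (assign lo (succ box))))

/-- The whole algorithm. -/
def program : Cmd :=
  sampleSize ;; chooseRoots ;; search ;; minimumDegree ;; binarySearch

/-- The initial state: the number `n` of vertices, the adjacency matrix of `G`, the constant `c` of
the sample size, and zeros elsewhere. -/
def input (c : ℕ) {n : ℕ} (G : SimpleGraph (Fin n)) [DecidableRel G.Adj] : State where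
  reg := fun z => if z = Reg.n then n else if z = Reg.c then c else 0
  arr := fun a u v =>
    if a = Arr.adj ∧ ∃ (hu : u < n) (hv : v < n), G.Adj ⟨u, hu⟩ ⟨v, hv⟩ then 1 else 0
  time := 0

/-- The distribution of the final state of the algorithm on the graph `G`. -/
noncomputable def run (c : ℕ) {n : ℕ} (G : SimpleGraph (Fin n)) [DecidableRel G.Adj] : PMF State :=
  exec program (input c G)

/-- The labeling that the algorithm leaves in memory. -/
def output {n : ℕ} (s : State) : Fin n → ℕ := fun v => s.arr Arr.label v 0

end Algorithm2

set_option linter.constructorNameAsVariable false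

/-! Soundness. Suppose every vertex is within distance two of a root. For an edge `xy` choose such a
root for `x`; then `y` is within distance three of it, so the windows put `x` at most two and `y` at
most three boxes away from the box of the root. The boxes of `x` and `y` differ by at most five, and
only the vertices of six boxes can lie between them in the labeling, so the labels differ by at most
`6 * β` (`IsLayout.near`, `IsLayout.card_before_le`).

Completeness. Cut an optimal labeling into blocks of `β` consecutive labels. If `β` is at least the
bandwidth, adjacent vertices fall into equal or neighbouring blocks, so a vertex at distance `d ≤ 3`
from a root is at most `d` blocks away from it; with at most two blocks this holds trivially. Hence
some placement of the roots admits a layout (`exists_layout`). By the cut argument of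
`IsNetwork.le_value` the flow then reaches the value `n`, and an integral flow of value `n` is a
layout. So all sizes from `min B(G) (max μ ⌈n/2⌉)` on are accepted, `μ` being the minimum degree.
The search ends with an accepted size that is not larger, whatever happens at smaller sizes. It
loses nothing by starting at `μ`, because `μ ≤ B(G)` (`le_bandwidth`).

Probability. Greedy choice gives a set `D` of `O(log n)` vertices such that every vertex has a
neighbour in `D` (`exists_dominating`). If each `d ∈ D` has a root among its neighbours, every
vertex is within distance two of a root. A fixed `d` fails with probability at most `(1 - δ) ^ k`,
and a union bound over `D`, not over all vertices, is what makes `k` of order `log log n` sufficient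
(`chooseRoots_not_covered_le`, `exists_sample_constant`). The failure probability is at most `α`,
which is even better than required.

Time. Box sizes are at least `μ ≥ δ n`, so there are at most `⌈1/δ⌉` boxes and the networks have
bounded size. The placements number `b ^ k`, a power of `log n`, and each costs `O(n k)`; with the
`O(log n)` rounds of the search this stays below `n ^ 2`. The search from `k` roots dominates with
`O(n ^ 2 k)` steps.

All statements about the program are proved with loop invariants for `Ensures`, with a syntactic
frame rule and, for the time, a syntactic cost bound. -/

namespace RAM

/-! ### Reasoning about programs -/

/-- Every possible final state of `c`, started in `s`, satisfies `Q`. -/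
def Ensures (c : Cmd) (s : State) (Q : State → Prop) : Prop := ∀ t ∈ (exec c s).support, Q t

section Simp
variable (s : State) (m t : ℕ) (z : Reg) (a : Arr)

@[simp] theorem State.tick_reg : (s.tick t).reg = s.reg := rfl
@[simp] theorem State.tick_arr : (s.tick t).arr = s.arr := rfl
@[simp] theorem State.tick_time : (s.tick t).time = s.time + t := rfl
@[simp] theorem State.setReg_reg : (s.setReg z m).reg = Function.update s.reg z m := rfl
@[simp] theorem State.setReg_arr : (s.setReg z m).arr = s.arr := rfl
@[simp] theorem State.setReg_time : (s.setReg z m).time = s.time := rfl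
@[simp] theorem State.setArr_reg (i j : ℕ) : (s.setArr a i j m).reg = s.reg := rfl
@[simp] theorem State.setArr_time (i j : ℕ) : (s.setArr a i j m).time = s.time := rfl
theorem State.setArr_arr (i j : ℕ) : (s.setArr a i j m).arr =
    Function.update s.arr a fun i' j' => if i' = i ∧ j' = j then m else s.arr a i' j' := rfl
@[simp] theorem State.setArr_arr_apply (i j : ℕ) (a' : Arr) (i' j' : ℕ) :
    (s.setArr a i j m).arr a' i' j' =
      if a' = a ∧ i' = i ∧ j' = j then m else s.arr a' i' j' := by
  by_cases h : a' = a
  · subst h; simp [State.setArr_arr]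
  · simp [State.setArr_arr, h]

@[simp] theorem State.setArr_arr_of_ne {a a' : Arr} (h : a' ≠ a) (i j : ℕ) :
    (s.setArr a i j m).arr a' = s.arr a' := by
  simp [State.setArr_arr, h]

@[simp] theorem Expr.eval_num : Expr.eval s (.num m) = m := rfl
@[simp] theorem Expr.eval_zero : Expr.eval s 0 = 0 := rfl
@[simp] theorem Expr.eval_one : Expr.eval s 1 = 1 := rfl
@[simp] theorem Expr.eval_two : Expr.eval s 2 = 2 := rfl
@[simp] theorem Expr.eval_three : Expr.eval s 3 = 3 := rfl
@[simp] theorem Expr.eval_four : Expr.eval s 4 = 4 := rfl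
@[simp] theorem Expr.eval_reg : Expr.eval s (.reg z) = s.reg z := rfl
@[simp] theorem Expr.eval_get (i j : Expr) :
    Expr.eval s (.get a i j) = s.arr a (i.eval s) (j.eval s) := rfl
@[simp] theorem Expr.eval_succ (e : Expr) : Expr.eval s (.succ e) = e.eval s + 1 := rfl
@[simp] theorem Expr.eval_sub (e f : Expr) : Expr.eval s (.sub e f) = e.eval s - f.eval s := rfl
@[simp] theorem Expr.eval_half (e : Expr) : Expr.eval s (.half e) = e.eval s / 2 := rfl
@[simp] theorem Cond.eval_lt (e f : Expr) :
    Cond.eval s (.lt e f) = decide (e.eval s < f.eval s) := rfl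
@[simp] theorem Cond.eval_eq (e f : Expr) :
    Cond.eval s (.eq e f) = decide (e.eval s = f.eval s) := rfl
@[simp] theorem Cond.eval_not (q : Cond) : Cond.eval s (.not q) = !(q.eval s) := rfl
@[simp] theorem Cond.eval_and (q r : Cond) : Cond.eval s (.and q r) = (q.eval s && r.eval s) := rfl

end Simp

section Rules
variable {c c₁ c₂ : Cmd} {s : State} {Q Q' : State → Prop} {z : Reg} {e : Expr}

theorem Ensures.mono (h : Ensures c s Q) (hQ : ∀ t, Q t → Q' t) : Ensures c s Q' :=
  fun t ht => hQ t (h t ht)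

theorem Ensures.and (h : Ensures c s Q) (h' : Ensures c s Q') :
    Ensures c s fun t => Q t ∧ Q' t :=
  fun t ht => ⟨h t ht, h' t ht⟩

@[simp] theorem ensures_skip : Ensures .skip s Q ↔ Q s := by
  simp [Ensures, exec]

@[simp] theorem ensures_assign :
    Ensures (.assign z e) s Q ↔ Q ((s.setReg z (e.eval s)).tick (e.cost + 1)) := by
  simp [Ensures, exec]

@[simp] theorem ensures_write {a : Arr} {i j : Expr} :
    Ensures (.write a i j e) s Q ↔ Q ((s.setArr a (i.eval s) (j.eval s) (e.eval s)).tick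
      (i.cost + j.cost + e.cost + 1)) := by
  simp [Ensures, exec]

@[simp] theorem ensures_seq :
    Ensures (c₁ ;; c₂) s Q ↔ Ensures c₁ s fun t => Ensures c₂ t Q := by
  simp only [Ensures, exec, PMF.mem_support_bind_iff]
  exact ⟨fun h t ht u hu => h u ⟨t, ht, hu⟩, fun h u ⟨t, ht, hu⟩ => h t ht u hu⟩

theorem ensures_ifElse {q : Cond} :
    Ensures (.ifElse q c₁ c₂) s Q ↔
      if q.eval s then Ensures c₁ (s.tick (q.cost + 1)) Q
      else Ensures c₂ (s.tick (q.cost + 1)) Q := by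
  simp only [Ensures, exec]
  split_ifs <;> rfl

@[simp] theorem ensures_ifElse' {q : Cond} :
    Ensures (.ifElse q c₁ c₂) s Q ↔
      (q.eval s = true → Ensures c₁ (s.tick (q.cost + 1)) Q) ∧
      (q.eval s = false → Ensures c₂ (s.tick (q.cost + 1)) Q) := by
  rw [ensures_ifElse]
  cases q.eval s <;> simp

@[simp] theorem ensures_ifThen {q : Cond} :
    Ensures (.ifThen q c) s Q ↔
      (q.eval s = true → Ensures c (s.tick (q.cost + 1)) Q) ∧
      (q.eval s = false → Q (s.tick (q.cost + 1))) := by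
  rw [Cmd.ifThen, ensures_ifElse', ensures_skip]

/-- In the definition of `uniform` the cast to `ℕ` is absorbed into the distribution, and the mapped
function is the identity of `ℕ`; `PMF.map_id` removes it. -/
theorem uniform_succ (m : ℕ) : uniform (m + 1) =
    (PMF.uniformOfFintype (Fin (m + 1))).map fun a : Fin (m + 1) => (a : ℕ) :=
  PMF.map_id _

theorem mem_support_uniform {m a : ℕ} (h : a ∈ (uniform m).support) : a < m ∨ m = 0 ∧ a = 0 := by
  cases m with
  | zero => simp_all [uniform]
  | succ m =>
    simp only [uniform_succ, PMF.mem_support_map_iff] at h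
    obtain ⟨b, -, rfl⟩ := h
    exact .inl b.is_lt

theorem ensures_rand
    (h : ∀ m, m < e.eval s ∨ e.eval s = 0 ∧ m = 0 → Q ((s.setReg z m).tick (e.cost + 1))) :
    Ensures (.rand z e) s Q := by
  intro t ht
  simp only [exec, PMF.mem_support_map_iff] at ht
  obtain ⟨m, hm, rfl⟩ := ht
  exact h m (mem_support_uniform hm)

theorem mem_support_iterate {f : ℕ → State → PMF State} (I : ℕ → State → Prop) (m : ℕ)
    (h0 : I 0 s) (hs : ∀ i < m, ∀ t, I i t → ∀ u ∈ (f i t).support, I (i + 1) u) :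
    ∀ t ∈ (iterate f m s).support, I m t := by
  induction m with
  | zero => simpa [iterate] using h0
  | succ m ih =>
    intro u hu
    simp only [iterate, PMF.mem_support_bind_iff] at hu
    obtain ⟨t, ht, hu⟩ := hu
    exact hs m (by omega) t (ih (fun i hi => hs i (by omega)) t ht) u hu

theorem ensures_loop {body : Cmd} (I : ℕ → State → Prop)
    (h0 : I 0 (s.tick (e.cost + 1)))
    (hs : ∀ m < e.eval s, ∀ t, I m t → Ensures body ((t.setReg z m).tick 1) (I (m + 1)))
    (hQ : ∀ t, I (e.eval s) t → Q t) : Ensures (.loop z e body) s Q := by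
  intro t ht
  rw [exec] at ht
  exact hQ t (mem_support_iterate I _ h0 hs t ht)

end Rules

/-! ### Frames -/

/-- The registers that a program may change. -/
def Cmd.mods : Cmd → List Reg
  | .skip => []
  | .assign z _ => [z]
  | .write _ _ _ _ => []
  | .rand z _ => [z]
  | .seq c₁ c₂ => c₁.mods ++ c₂.mods
  | .ifElse _ c₁ c₂ => c₁.mods ++ c₂.mods
  | .loop z _ body => z :: body.mods

/-- The arrays that a program may change. -/
def Cmd.modsA : Cmd → List Arr
  | .skip => []
  | .assign _ _ => []
  | .write a _ _ _ => [a]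
  | .rand _ _ => []
  | .seq c₁ c₂ => c₁.modsA ++ c₂.modsA
  | .ifElse _ c₁ c₂ => c₁.modsA ++ c₂.modsA
  | .loop _ _ body => body.modsA

/-- `s` and `t` agree on everything that `c` does not change. -/
structure Frame (c : Cmd) (s t : State) : Prop where
  reg : ∀ z, z ∉ c.mods → t.reg z = s.reg z
  arr : ∀ a, a ∉ c.modsA → t.arr a = s.arr a

/-- The lists `mods` and `modsA` are computed from the syntax, so that `decide` settles in every
later use that a register or an array is untouched. -/
theorem ensures_frame (c : Cmd) (s : State) : Ensures c s (Frame c s) := by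
  induction c generalizing s with
  | skip => simpa using ⟨fun _ _ => rfl, fun _ _ => rfl⟩
  | assign z e =>
    rw [ensures_assign]
    exact ⟨fun y hy => by simp_all [Cmd.mods], fun _ _ => rfl⟩
  | write a i j e =>
    rw [ensures_write]
    exact ⟨fun _ _ => rfl, fun a' ha => by
      simp_all [Cmd.modsA, State.setArr_arr, Function.update]⟩
  | rand z e =>
    exact ensures_rand fun m _ => ⟨fun y hy => by simp_all [Cmd.mods], fun _ _ => rfl⟩
  | seq c₁ c₂ h₁ h₂ =>
    rw [ensures_seq]
    refine (h₁ s).mono fun t ht => (h₂ t).mono fun u hu => ⟨fun z hz => ?_, fun a ha => ?_⟩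
    · simp only [Cmd.mods, List.mem_append, not_or] at hz
      rw [hu.reg z hz.2, ht.reg z hz.1]
    · simp only [Cmd.modsA, List.mem_append, not_or] at ha
      rw [hu.arr a ha.2, ht.arr a ha.1]
  | ifElse q c₁ c₂ h₁ h₂ =>
    rw [ensures_ifElse']
    refine ⟨fun _ => (h₁ _).mono fun u hu => ⟨fun z hz => ?_, fun a ha => ?_⟩,
      fun _ => (h₂ _).mono fun u hu => ⟨fun z hz => ?_, fun a ha => ?_⟩⟩ <;>
    simp only [Cmd.mods, Cmd.modsA, List.mem_append, not_or] at *
    · exact hu.reg z hz.1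
    · exact hu.arr a ha.1
    · exact hu.reg z hz.2
    · exact hu.arr a ha.2
  | loop z e body h =>
    refine ensures_loop (fun _ => Frame (.loop z e body) s) ⟨fun _ _ => rfl, fun _ _ => rfl⟩
      (fun m _ t ht => (h _).mono fun u hu => ⟨fun y hy => ?_, fun a ha => ?_⟩) fun _ h => h
    · have := ht.reg y hy
      simp only [Cmd.mods, List.mem_cons, not_or] at hy
      rw [hu.reg y hy.2]
      simpa [hy.1] using this
    · rw [hu.arr a ha]
      exact ht.arr a ha

/-- The invariant rule for loops, with the frame of the loop at hand. -/
theorem Ensures.loop {z : Reg} {e : Expr} {body : Cmd} {s : State} {Q : State → Prop}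
    (I : ℕ → State → Prop) (h0 : I 0 (s.tick (e.cost + 1)))
    (hs : ∀ m < e.eval s, ∀ t, Frame (.loop z e body) s t → I m t →
      Ensures body ((t.setReg z m).tick 1) (I (m + 1)))
    (hQ : ∀ t, Frame (.loop z e body) s t → I (e.eval s) t → Q t) :
    Ensures (.loop z e body) s Q := by
  refine ((ensures_frame (.loop z e body) s).and <|
    ensures_loop (fun m t => Frame (.loop z e body) s t ∧ I m t)
    ⟨⟨fun _ _ => rfl, fun _ _ => rfl⟩, h0⟩ (fun m hm t ht => ?_) fun _ h => h.2).mono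
    fun t ht => hQ t ht.1 ht.2
  refine ((ensures_frame body _).and (hs m hm t ht.1 ht.2)).mono fun u hu =>
    ⟨⟨fun y hy => ?_, fun a ha => ?_⟩, hu.2⟩
  · have := ht.1.reg y hy
    simp only [Cmd.mods, List.mem_cons, not_or] at hy
    rw [hu.1.reg y hy.2]
    simpa [hy.1] using this
  · rw [hu.1.arr a ha]
    exact ht.1.arr a ha

/-- Add the frame to what is known about the final state. -/
theorem Ensures.framed {c : Cmd} {s : State} {Q Q' : State → Prop} (h : Ensures c s Q)
    (hQ : ∀ t, Frame c s t → Q t → Q' t) : Ensures c s Q' :=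
  ((ensures_frame c s).and h).mono fun t ht => hQ t ht.1 ht.2

/-! ### Running times -/

/-- `e` is built from constants and registers outside `M`. -/
def Expr.avoids (M : List Reg) : Expr → Bool
  | .num _ => true
  | .reg z => z ∉ M
  | .get _ _ _ => false
  | .succ e => e.avoids M
  | .sub e₁ e₂ => e₁.avoids M && e₂.avoids M
  | .half e => e.avoids M

theorem Expr.eval_congr {M : List Reg} {s t : State} (h : ∀ z, z ∉ M → t.reg z = s.reg z)
    {e : Expr} (he : e.avoids M) : e.eval t = e.eval s := by
  induction e <;> simp_all [Expr.avoids]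

/-- The numbers of rounds of the loops of `c` are determined by registers outside `M`. -/
def Cmd.bounded (M : List Reg) : Cmd → Bool
  | .skip => true
  | .assign _ _ => true
  | .write _ _ _ _ => true
  | .rand _ _ => true
  | .seq c₁ c₂ => c₁.bounded M && c₂.bounded M
  | .ifElse _ c₁ c₂ => c₁.bounded M && c₂.bounded M
  | .loop _ e body => e.avoids M && body.bounded M

/-- An upper bound for the running time, if the numbers of rounds of the loops do not change. -/
def Cmd.cost (s : State) : Cmd → ℕ
  | .skip => 0
  | .assign _ e => e.cost + 1
  | .write _ i j e => i.cost + j.cost + e.cost + 1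
  | .rand _ e => e.cost + 1
  | .seq c₁ c₂ => c₁.cost s + c₂.cost s
  | .ifElse q c₁ c₂ => q.cost + 1 + (c₁.cost s + c₂.cost s)
  | .loop _ e body => e.cost + 1 + e.eval s * (body.cost s + 1)

/-- The cost is evaluated in a fixed reference state `s₀`, while `s` need only agree with it outside
`M`. This lets the induction pass through sequences and loops, whose later parts start in changed
states. -/
theorem ensures_time_aux (c : Cmd) {M : List Reg} (hc : c.bounded M) (hM : ∀ z ∈ c.mods, z ∈ M)
    (s₀ s : State) (h : ∀ z, z ∉ M → s.reg z = s₀.reg z) :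
    Ensures c s fun t => t.time ≤ s.time + c.cost s₀ := by
  induction c generalizing s with
  | skip => simp
  | assign z e => simp [Cmd.cost]
  | write a i j e => simp [Cmd.cost]
  | rand z e => exact ensures_rand fun m _ => by simp [Cmd.cost]
  | seq c₁ c₂ h₁ h₂ =>
    simp only [Cmd.bounded, Bool.and_eq_true, Cmd.mods, List.mem_append] at hc hM
    rw [ensures_seq]
    refine (h₁ hc.1 (fun z hz => hM z (.inl hz)) s h).framed fun t hf ht =>
      (h₂ hc.2 (fun z hz => hM z (.inr hz)) t fun z hz => ?_).mono fun u hu => ?_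
    · rw [hf.reg z fun h => hz (hM z (.inl h)), h z hz]
    · simp only [Cmd.cost]
      omega
  | ifElse q c₁ c₂ h₁ h₂ =>
    simp only [Cmd.bounded, Bool.and_eq_true, Cmd.mods, List.mem_append] at hc hM
    rw [ensures_ifElse']
    refine ⟨fun _ => (h₁ hc.1 (fun z hz => hM z (.inl hz)) (s.tick _) h).mono fun u hu => ?_,
      fun _ => (h₂ hc.2 (fun z hz => hM z (.inr hz)) (s.tick _) h).mono fun u hu => ?_⟩ <;>
    · simp only [Cmd.cost, State.tick_time] at *
      omega
  | loop z e body hb =>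
    simp only [Cmd.bounded, Bool.and_eq_true] at hc
    have hz : z ∈ M := hM z (by simp [Cmd.mods])
    refine Ensures.loop (fun m t => t.time ≤ s.time + (e.cost + 1) + m * (body.cost s₀ + 1))
      (by simp) (fun m _ t hf ht => (hb hc.2 (fun y hy => hM y (by simp [Cmd.mods, hy])) _
        fun y hy => ?_).mono fun u hu => ?_) fun t _ ht => ?_
    · have : y ≠ z := fun h => hy (h ▸ hz)
      simp only [State.tick_reg, State.setReg_reg, Function.update_of_ne this]
      rw [hf.reg y fun h => hy (hM y h), h y hy]
    · simp only [State.tick_time, State.setReg_time] at hu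
      rw [Nat.add_mul]
      omega
    · rw [Expr.eval_congr h hc.1] at ht
      simp only [Cmd.cost]
      omega

theorem ensures_time (c : Cmd) (s : State) (hc : c.bounded c.mods) :
    Ensures c s fun t => t.time ≤ s.time + c.cost s :=
  ensures_time_aux c hc (fun _ h => h) s s fun _ _ => rfl

end RAM

namespace Algorithm2

open RAM

/-! ### The sample size -/

theorem ensures_log (z : Reg) (e : Expr) (s : State) (hzx : z ≠ .x) (hzi : z ≠ .i)
    (he : e.eval s = s.reg .x) (hz : s.reg z = 0) :
    Ensures (.loop .i e (.ifThen (.lt 1 (.reg .x))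
      (.assign .x (.half (.reg .x)) ;; .assign z (.succ (.reg z))))) s
      fun t => t.reg z = Nat.log 2 (s.reg .x) := by
  -- Each halving lowers the logarithm by one and raises `z` by one. The number of rounds is the
  -- initial value of `x`, which exceeds its logarithm unless it is zero, so `x` drops to at most
  -- one in time.
  refine Ensures.loop (fun m t => Nat.log 2 (t.reg .x) + t.reg z = Nat.log 2 (s.reg .x) ∧
    (t.reg .x ≤ 1 ∨ m ≤ t.reg z)) (by simp [hz]) (fun m _ t _ ht => ?_) fun t _ ht => ?_
  · have hxz := hzx.symm
    simp only [ensures_ifThen, ensures_seq, ensures_assign]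
    simp [hzx, hzi, hxz]
    refine ⟨fun h => ?_, fun h => ⟨ht.1, .inl h⟩⟩
    have := Nat.log_pos one_lt_two h
    omega
  · rw [he] at ht
    obtain h | h := ht.2
    · have := Nat.log_of_lt (b := 2) (show t.reg .x < 2 by omega)
      omega
    · by_cases h0 : s.reg .x = 0
      · simp_all
      · have := Nat.log_lt_self 2 h0
        omega

theorem ensures_sampleSize (s : State) :
    Ensures sampleSize s fun t => t.reg .lg = Nat.log 2 (s.reg .n) ∧
      t.reg .ll = Nat.log 2 (Nat.log 2 (s.reg .n)) ∧
      t.reg .k = s.reg .c * (Nat.log 2 (Nat.log 2 (s.reg .n)) + 1) := by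
  simp only [sampleSize, ensures_seq, ensures_assign]
  refine (ensures_log .lg _ _ (by decide) (by decide) (by simp) (by simp)).framed fun t hf ht => ?_
  refine (ensures_log .ll _ _ (by decide) (by decide) (by simp) (by simp)).framed
    fun u hf' hu => ?_
  have h1 : u.reg .c = s.reg .c := by
    rw [hf'.reg .c (by decide)]
    simp [hf.reg .c (by decide)]
  have h2 : u.reg .lg = t.reg .lg := by
    rw [hf'.reg .lg (by decide)]
    simp
  simp at hu ht
  rw [ht] at hu h2
  refine Ensures.loop (fun m v => v.reg .k = m * s.reg .c) (by simp) (fun m _ v hf'' hv => ?_)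
    fun v hf'' hv => ?_
  · refine Ensures.loop (fun m' v => v.reg .k = m * s.reg .c + m') (by simpa using hv)
      (fun m _ w _ hw => by simp [hw, add_assoc]) fun w _ hw => ?_
    have : v.reg .c = s.reg .c := by
      rw [hf''.reg .c (by decide)]
      simp [h1]
    simp [this] at hw
    rw [hw]
    ring
  · rw [hf''.reg .lg (by decide), hf''.reg .ll (by decide), hv]
    simp [hu, h2]
    ring

/-! ### The minimum degree -/

/-- The alternative `mindeg = N` is the initial value, which remains if no count is smaller, in
particular if there are no vertices. -/
theorem ensures_minimumDegree (s : State) {N : ℕ} (hN : s.reg .n = N) (d : ℕ → ℕ)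
    (hd : ∀ v, d v = ((Finset.range N).filter fun w => s.arr .adj v w = 1).card) :
    Ensures minimumDegree s fun t => (∀ v < N, t.reg .mindeg ≤ d v) ∧
      (t.reg .mindeg = N ∨ ∃ v < N, t.reg .mindeg = d v) := by
  simp only [minimumDegree, ensures_seq, ensures_assign]
  refine Ensures.loop (fun m t => (∀ v < m, t.reg .mindeg ≤ d v) ∧
      (t.reg .mindeg = N ∨ ∃ v < N, t.reg .mindeg = d v)) (by simp [hN])
    (fun m hm t hf ht => ?_) fun t hf ht => by simpa [hN] using ht
  simp [hN] at hm
  have hn := hf.reg .n (by decide)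
  have ha := hf.arr .adj (by decide)
  simp [hN] at hn ha
  simp only [ensures_seq, ensures_assign]
  refine Ensures.loop
    (fun m' u => u.reg .deg = ((Finset.range m').filter fun w => s.arr .adj m w = 1).card)
    (by simp) (fun m' hm' u hf' hu => ?_) fun u hf' hu => ?_
  · have ha' := hf'.arr .adj (by decide)
    have hv := hf'.reg .v (by decide)
    simp [ha] at ha' hv
    simp only [ensures_ifThen, ensures_assign]
    simp [ha', hv, hu, Finset.range_add_one, Finset.filter_insert]
    split_ifs with h <;> simp [h]
  · have hmin := hf'.reg .mindeg (by decide)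
    simp [hn] at hmin hu
    rw [← hd] at hu
    simp only [ensures_ifThen, ensures_assign]
    simp [hu, hmin]
    constructor
    · intro h
      refine ⟨fun v hv => ?_, .inr ⟨m, hm, rfl⟩⟩
      obtain hv | rfl : v < m ∨ v = m := by omega
      · exact h.le.trans (ht.1 v hv)
      · rfl
    · intro h
      refine ⟨fun v hv => ?_, ht.2⟩
      obtain hv | rfl : v < m ∨ v = m := by omega
      · exact ht.1 v hv
      · exact h

/-! ### The placements of the roots -/

/-- The ceiling `⌈N / β⌉` is expressed as the least `D` with `N ≤ D * β`. The time is followed by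
hand, since the loop over `num` has a bound that changes from round to round. -/
theorem ensures_prepareBoxes (s : State) {N K β : ℕ} (hN : s.reg .n = N) (hK : s.reg .k = K)
    (hβ : s.reg .box = β) :
    Ensures prepareBoxes s fun t =>
      (∀ D, N ≤ D * β → t.reg .b ≤ D) ∧ (0 < β → N ≤ t.reg .b * β) ∧
      t.reg .num = t.reg .b ^ K ∧ (∀ i < K, t.arr .pos i 0 = 0) ∧
      t.time ≤ s.time + 20 * (N + 1) + K * (20 + (t.reg .b + 1) ^ K * (4 * t.reg .b + 4)) := by
  simp only [prepareBoxes, ensures_seq, ensures_assign]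
  -- As long as something is left, every round has opened a box; hence after `N` rounds all is
  -- covered if `β > 0`. The third clause says that the last box was needed, which gives minimality.
  refine Ensures.loop (fun m t => t.reg .rest = N - t.reg .b * β ∧
    (t.reg .rest = 0 ∨ m ≤ t.reg .b) ∧ (t.reg .b = 0 ∨ (t.reg .b - 1) * β < N) ∧
    t.time ≤ s.time + 6 + m * 16) (by simp [hN, Expr.cost]) (fun m hm t hf ht => ?_) fun t hf ht => ?_
  · have hb := hf.reg .box (by decide)
    simp [hβ] at hb
    simp only [ensures_ifThen, ensures_seq, ensures_assign]
    simp [hb, ht.1, Expr.cost, Cond.cost]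
    obtain ⟨h1, h2, h3, h4⟩ := ht
    rw [h1] at h2
    refine ⟨fun h => ⟨?_, ?_, h, by omega⟩, fun h => ⟨by omega, h3, by omega⟩⟩
    · rw [Nat.sub_sub, Nat.succ_mul]
    · omega
  simp [hN] at ht
  have hb' : ∃ B, t.reg .b = B := ⟨_, rfl⟩
  have hk := hf.reg .k (by decide)
  simp [hK] at hk
  obtain ⟨B, hB⟩ := hb'
  rw [hB] at ht
  obtain ⟨h1, h2, h3, h4⟩ := ht
  refine Ensures.loop (fun m u => u.reg .num = B ^ m ∧
    u.time ≤ s.time + 10 + N * 16 + m * (10 + (B + 1) ^ K * (4 * B + 4))) ?_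
    (fun m hm u hf' hu => ?_) fun u hf' hu => ?_
  · simp [Expr.cost]
    omega
  · have hb1 := hf'.reg .b (by decide)
    simp [hB] at hb1
    simp [hk] at hm
    simp only [ensures_seq, ensures_assign]
    refine Ensures.loop (fun m' w => w.reg .acc = m' * B ∧
      w.time ≤ u.time + 5 + m' * (4 * B + 3)) (by simp [Expr.cost])
      (fun m' hm' w hf'' hw => ?_) fun w hf'' hw => ?_
    · refine Ensures.loop (fun m'' x => x.reg .acc = m' * B + m'' ∧
        x.time ≤ w.time + 3 + m'' * 4) (by simp [hw.1, Expr.cost])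
        (fun m'' _ x _ hx => ?_) fun x _ hx => ?_
      · simp [hx.1, Expr.cost]
        omega
      · have := hf''.reg .b (by decide)
        simp [hb1] at this
        simp [this] at hx
        refine ⟨by rw [hx.1]; ring, ?_⟩
        have := hw.2
        linarith
    · simp [hu.1] at hw
      simp [hw.1, Expr.cost, pow_succ]
      have : B ^ m * (4 * B + 3) ≤ (B + 1) ^ K * (4 * B + 4) :=
        Nat.mul_le_mul ((Nat.pow_le_pow_left (by omega) m).trans
          (Nat.pow_le_pow_right (by omega) hm.le)) (by omega)
      linarith
  · simp [hk] at hu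
    have hb1 := hf'.reg .b (by decide)
    have hk1 := hf'.reg .k (by decide)
    simp [hB, hk] at hb1 hk1
    refine Ensures.loop (fun m w => (∀ i < m, w.arr .pos i 0 = 0) ∧ w.time ≤ u.time + 2 + m * 5)
      (by simp [Expr.cost]) (fun m _ w _ hw => ?_) fun w hf'' hw => ?_
    · simp [Expr.cost]
      exact ⟨fun i hi h => hw.1 i (by omega), by omega⟩
    · simp [hk1] at hw
      rw [hf''.reg .b (by decide), hf''.reg .num (by decide)]
      simp [hb1, hu.1]
      refine ⟨fun D hD => ?_, fun hβ0 => ?_, hw.1, by linarith⟩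
      · obtain rfl | h3 := h3
        · exact Nat.zero_le _
        · by_contra! h
          have := Nat.mul_le_mul_right β (show D ≤ B - 1 by omega)
          omega
      · have := Nat.le_mul_of_pos_right B hβ0
        omega

/-- The placements are gone through in the order of counting in base `b`. -/
theorem ensures_nextPlacement (s : State) {K B p : ℕ} (hK : s.reg .k = K) (hb : s.reg .b = B)
    (hB : 0 < B) (hp : ∀ i < K, s.arr .pos i 0 = p / B ^ i % B) :
    Ensures nextPlacement s fun t => ∀ i < K, t.arr .pos i 0 = (p + 1) / B ^ i % B := by
  simp only [nextPlacement, ensures_seq, ensures_assign]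
  -- The carry into digit `m` is present exactly if `B ^ m` divides `p + 1`, which is also exactly
  -- when the quotient by `B ^ m` grows from `p` to `p + 1`.
  refine Ensures.loop (fun m t => (∀ i < m, t.arr .pos i 0 = (p + 1) / B ^ i % B) ∧
    (∀ i, m ≤ i → i < K → t.arr .pos i 0 = p / B ^ i % B) ∧
    (t.reg .carry = 1 ↔ B ^ m ∣ p + 1)) (by simpa using hp) (fun m hm t hf ht => ?_)
    fun t hf ht => by simpa [hK] using ht.1
  simp [hK] at hm
  have hb' := hf.reg .b (by decide)
  simp [hb] at hb'
  have hpm := ht.2.1 m le_rfl hm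
  have key : (p + 1) / B ^ m = p / B ^ m + if B ^ m ∣ p + 1 then 1 else 0 := Nat.succ_div
  simp only [ensures_ifThen, ensures_ifElse', ensures_seq, ensures_assign, ensures_write]
  simp [hb', hpm]
  rw [ht.2.2]
  have hold : ∀ x, ∀ i < m, (if i = m then x else t.arr .pos i 0) = (p + 1) / B ^ i % B := by
    intro x i hi
    rw [if_neg hi.ne, ht.1 i hi]
  have hnew : ∀ x i, m < i → i < K → (if i = m then x else t.arr .pos i 0) = p / B ^ i % B := by
    intro x i hi hiK
    rw [if_neg hi.ne', ht.2.1 i hi.le hiK]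
  have hdvd : B ^ (m + 1) ∣ p + 1 ↔ B ^ m ∣ p + 1 ∧ (p / B ^ m + 1) % B = 0 := by
    constructor
    · intro h
      have h' : B ^ m ∣ p + 1 := (pow_dvd_pow _ (Nat.le_succ m)).trans h
      rw [if_pos h'] at key
      refine ⟨h', ?_⟩
      obtain ⟨r, hr⟩ := h
      rw [← key, hr, pow_succ, mul_assoc, Nat.mul_div_cancel_left _ (by positivity)]
      simp
    · rintro ⟨⟨r, hr⟩, h⟩
      rw [if_pos ⟨r, hr⟩] at key
      rw [← key, hr, Nat.mul_div_cancel_left _ (by positivity)] at h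
      rw [hr, pow_succ]
      exact Nat.mul_dvd_mul_left _ (Nat.dvd_of_mod_eq_zero h)
  have hmod := Nat.add_mod (p / B ^ m) 1 B
  have hlt := Nat.mod_lt (p / B ^ m) hB
  have hmod' : (p / B ^ m + 1) % B =
      if p / B ^ m % B + 1 < B then p / B ^ m % B + 1 else 0 := by
    rw [← Nat.mod_add_mod]
    split_ifs with h
    · exact Nat.mod_eq_of_lt h
    · rw [show p / B ^ m % B + 1 = B by omega, Nat.mod_self]
  rw [hdvd, hmod']
  have hle : ∀ P : ℕ → Prop, (∀ i < m, P i) → P m → ∀ i ≤ m, P i := by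
    intro P h1 h2 i hi
    obtain hi | rfl := hi.lt_or_eq
    exacts [h1 i hi, h2]
  refine ⟨fun h => ⟨fun h' => ⟨hle _ (hold _) ?_, hnew _, ?_⟩,
    fun h' => ⟨hle _ (hold _) ?_, hnew _, ?_⟩⟩,
    fun h => ⟨hle _ ht.1 ?_, fun i hi => ht.2.1 i hi.le, by tauto⟩⟩
  · rw [key, if_pos h, hmod', if_pos h', if_pos rfl]
  · simp [h']
  · rw [key, if_pos h, hmod', if_neg (not_lt.2 h'), if_pos rfl]
  · rw [if_neg (by omega)]
    simp [h]
  · rw [key, if_neg h, hpm, add_zero]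

/-- Read `q` as the base-`B` digits of a number: the loop over `p` misses no placement. -/
theorem exists_placement (q : ℕ → ℕ) {B : ℕ} (K : ℕ) (hq : ∀ i < K, q i < B) :
    ∃ p < B ^ K, ∀ i < K, p / B ^ i % B = q i := by
  induction K with
  | zero => exact ⟨0, by simp⟩
  | succ K ih =>
    obtain ⟨p, hp, h⟩ := ih fun i hi => hq i (by omega)
    have hB : 0 < B := (Nat.zero_le _).trans_lt (hq K (by omega))
    refine ⟨p + B ^ K * q K, ?_, fun i hi => ?_⟩
    · have := hq K (by omega)
      rw [pow_succ]
      nlinarith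
    · obtain hi | rfl : i < K ∨ i = K := by omega
      · obtain ⟨r, rfl⟩ : ∃ r, K = i + 1 + r := ⟨K - i - 1, by omega⟩
        rw [← h i hi, pow_add, pow_succ, mul_assoc, mul_assoc,
          Nat.add_mul_div_left _ _ (by positivity), Nat.add_mul_mod_self_left]
      · rw [Nat.add_mul_div_left _ _ (by positivity), Nat.div_eq_of_lt hp, zero_add,
          Nat.mod_eq_of_lt (hq i (by omega))]

/-! ### The intervals -/

/-- The box `h` lies in the window of a root in the box `p` for a vertex at distance `d`. -/
def InWindow (d p h : ℕ) : Prop :=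
  (d = 0 → h = p) ∧ (0 < d → d < 3 → h ≤ p + 2 ∧ p ≤ h + 2) ∧ (d = 3 → h ≤ p + 3 ∧ p ≤ h + 3)

/-- The final part of the body of the inner loop of `intervals`. -/
def clip : Cmd :=
  .ifThen (.lt (.get .start (.reg .v) 0) (.reg .left)) (.write .start (.reg .v) 0 (.reg .left)) ;;
  .ifThen (.lt (.reg .right) (.get .finish (.reg .v) 0)) (.write .finish (.reg .v) 0 (.reg .right))

theorem ensures_clip (s : State) {v l r : ℕ} (hv : s.reg .v = v) (hl : s.reg .left = l)
    (hr : s.reg .right = r) :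
    Ensures clip s fun t => t.arr .start v 0 = max l (s.arr .start v 0) ∧
      t.arr .finish v 0 = min r (s.arr .finish v 0) ∧
      ∀ w ≠ v, t.arr .start w 0 = s.arr .start w 0 ∧ t.arr .finish w 0 = s.arr .finish w 0 := by
  simp only [clip, ensures_seq, ensures_ifThen, ensures_write]
  simp [hv, hl, hr]
  grind

/-- The body of the inner loop of `intervals`. -/
def window : Cmd :=
  .assign .left 0 ;; .assign .right (.sub (.reg .b) 1) ;;
  .ifThen (.eq (.get .dist (.reg .i) (.reg .v)) 0)
    (.assign .left (.get .pos (.reg .i) 0) ;; .assign .right (.get .pos (.reg .i) 0)) ;;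
  .ifThen (.and (.lt 0 (.get .dist (.reg .i) (.reg .v))) (.lt (.get .dist (.reg .i) (.reg .v)) 3))
    (.assign .left (.sub (.get .pos (.reg .i) 0) 2) ;;
      .assign .right (.succ (.succ (.get .pos (.reg .i) 0)))) ;;
  .ifThen (.eq (.get .dist (.reg .i) (.reg .v)) 3)
    (.assign .left (.sub (.get .pos (.reg .i) 0) 3) ;;
      .assign .right (.succ (.succ (.succ (.get .pos (.reg .i) 0))))) ;;
  clip

/-- The right end may exceed `B - 1`; the minimum with the earlier `finish` repairs this. The bound
`l < B` is recorded because `start` later serves as an index of a class even if the interval is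
empty. -/
theorem ensures_window (s : State) {B v i d p : ℕ} (hb : s.reg .b = B) (hv : s.reg .v = v)
    (hi : s.reg .i = i) (hd : s.arr .dist i v = d) (hp : s.arr .pos i 0 = p) (hpB : p < B) :
    Ensures window s fun t => ∃ l r, l < B ∧ (∀ h < B, l ≤ h ∧ h ≤ r ↔ InWindow d p h) ∧
      t.arr .start v 0 = max l (s.arr .start v 0) ∧
      t.arr .finish v 0 = min r (s.arr .finish v 0) ∧
      ∀ w ≠ v, t.arr .start w 0 = s.arr .start w 0 ∧ t.arr .finish w 0 = s.arr .finish w 0 := by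
  simp only [window, ensures_seq, ensures_ifThen, ensures_assign]
  obtain h | h | h | h : d = 0 ∨ (0 < d ∧ d < 3) ∨ d = 3 ∨ 3 < d := by omega
  · simp [hb, hv, hi, hd, hp, h]
    refine (ensures_clip (l := p) (r := p) _ (by simpa) (by simp) (by simp)).mono
      fun t ht => ⟨p, hpB, p, ?_, ht⟩
    simp [InWindow]
    omega
  · have e1 := h.1.ne'
    have e2 := h.2.ne
    simp [hb, hv, hi, hd, hp, h, e1, e2]
    refine (ensures_clip (l := p - 2) (r := p + 2) _ (by simpa) (by simp) (by simp)).mono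
      fun t ht => ⟨p - 2, by omega, p + 2, ?_, ht⟩
    simp [InWindow, h, e1, e2]
    omega
  · simp [hb, hv, hi, hd, hp, h]
    refine (ensures_clip (l := p - 3) (r := p + 3) _ (by simpa) (by simp) (by simp)).mono
      fun t ht => ⟨p - 3, by omega, p + 3, ?_, ht⟩
    simp [InWindow]
    omega
  · have e1 : d ≠ 0 := by omega
    simp [hb, hv, hi, hd, hp, h.ne', h.le, e1]
    refine (ensures_clip (l := 0) (r := B - 1) _ (by simpa) (by simp) (by simp)).mono
      fun t ht => ⟨0, by omega, B - 1, ?_, ht⟩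
    simp [InWindow, h.ne', e1]
    omega

theorem ensures_intervals (s : State) {N K B : ℕ} (hN : s.reg .n = N) (hK : s.reg .k = K)
    (hb : s.reg .b = B) (hB : 0 < B) (hp : ∀ i < K, s.arr .pos i 0 < B) :
    Ensures intervals s fun t => ∀ v < N, t.arr .start v 0 < B ∧ t.arr .finish v 0 < B ∧
      ∀ h < B, t.arr .start v 0 ≤ h ∧ h ≤ t.arr .finish v 0 ↔
        ∀ i < K, InWindow (s.arr .dist i v) (s.arr .pos i 0) h := by
  refine Ensures.loop (fun m t => ∀ v < m, t.arr .start v 0 < B ∧ t.arr .finish v 0 < B ∧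
      ∀ h < B, t.arr .start v 0 ≤ h ∧ h ≤ t.arr .finish v 0 ↔
        ∀ i < K, InWindow (s.arr .dist i v) (s.arr .pos i 0) h) (by simp)
    (fun m hm t hf ht => ?_) fun t hf ht => by simpa [hN] using ht
  have hb1 := hf.reg .b (by decide)
  have hk1 := hf.reg .k (by decide)
  have hd1 := hf.arr .dist (by decide)
  have hp1 := hf.arr .pos (by decide)
  simp only [ensures_seq, ensures_write]
  refine Ensures.loop (body := window) (fun m' u =>
      (∀ v < m, u.arr .start v 0 = t.arr .start v 0 ∧ u.arr .finish v 0 = t.arr .finish v 0) ∧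
      u.arr .start m 0 < B ∧ u.arr .finish m 0 < B ∧
      ∀ h < B, u.arr .start m 0 ≤ h ∧ h ≤ u.arr .finish m 0 ↔
        ∀ i < m', InWindow (s.arr .dist i m) (s.arr .pos i 0) h) ?_
    (fun m' hm' u hf' hu => ?_) fun u hf' hu v hv => ?_
  · simp [hb1, hb]
    grind
  · have hb2 := hf'.reg .b (by decide)
    have hv2 := hf'.reg .v (by decide)
    have hd2 := hf'.arr .dist (by decide)
    have hp2 := hf'.arr .pos (by decide)
    simp [hb1, hb, hd1, hp1] at hb2 hv2 hd2 hp2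
    have hpm := hp m' (by simpa [hk1, hK] using hm')
    refine (ensures_window _ (v := m) (i := m')
      (d := s.arr .dist m' m) (p := s.arr .pos m' 0) (by simpa using hb2) (by simpa using hv2)
      (by simp) (by simp [hd2]) (by simp [hp2]) hpm).mono ?_
    rintro w ⟨l, r, hl, hlr, h1, h2, h3⟩
    simp at h1 h2 h3
    refine ⟨fun v hv => ?_, ?_, ?_, fun h hh => ?_⟩
    · rw [(h3 v hv.ne).1, (h3 v hv.ne).2]
      exact hu.1 v hv
    · rw [h1]
      exact max_lt hl hu.2.1
    · rw [h2]
      exact (min_le_right _ _).trans_lt hu.2.2.1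
    -- Maximum of the left ends and minimum of the right ends: intervals are intersected, one root
    -- at a time.
    · rw [h1, h2, max_le_iff, le_min_iff, Nat.forall_lt_succ_right, ← hu.2.2.2 h hh, ← hlr h hh]
      tauto
  · obtain hv | rfl : v < m ∨ v = m := by omega
    · rw [(hu.1 v hv).1, (hu.1 v hv).2]
      exact ht v hv
    · simpa [hk1, hK] using hu.2

/-! ### Breadth-first search -/

/-- `D` behaves like the distance from `r`, as far as distances up to three are concerned. -/
structure IsDist (A : ℕ → ℕ → Prop) (N r : ℕ) (D : ℕ → ℕ) : Prop where
  zero : ∀ v < N, D v = 0 ↔ v = r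
  step : ∀ u < N, ∀ w < N, A u w → D u < 3 → D w ≤ D u + 1
  pred : ∀ w < N, 0 < D w → D w ≤ 3 → ∃ u < N, A u w ∧ D w = D u + 1

/-- The state of the search while the vertices at distance `j` are processed; `P u w` says that the
pair `u`, `w` has been treated. -/
structure Layer (A : ℕ → ℕ → Prop) (N r j : ℕ) (P : ℕ → ℕ → Prop) (D : ℕ → ℕ) : Prop where
  zero : ∀ v < N, D v = 0 ↔ v = r
  le : ∀ v < N, D v ≤ j + 1 ∨ D v = 4
  step : ∀ u < N, ∀ w < N, A u w → D u < j ∨ D u = j ∧ P u w → D w ≤ D u + 1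
  pred : ∀ w < N, 0 < D w → D w ≤ 3 → ∃ u < N, A u w ∧ D w = D u + 1

section
variable {A : ℕ → ℕ → Prop} {N r j : ℕ} {P P' : ℕ → ℕ → Prop} {D : ℕ → ℕ}

theorem Layer.congr {D' : ℕ → ℕ} (h : Layer A N r j P D) (hD : ∀ v < N, D' v = D v)
    (hP : ∀ u < N, ∀ w < N, D u = j → P' u w → P u w) : Layer A N r j P' D' := by
  obtain ⟨h1, h2, h3, h4⟩ := h
  exact ⟨by grind, by grind, by grind, by grind⟩

/-- A vertex that still has the value 4 has no treated neighbour and is the predecessor of no vertex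
with a value up to three, so lowering its value spoils no earlier claim. -/
theorem Layer.write (h : Layer A N r j P D) (hj : j < 3) {u w : ℕ} (hu : u < N)
    (hA : A u w) (hDu : D u = j) (hDw : D w = 4)
    (hP : ∀ u' < N, ∀ w' < N, P' u' w' → P u' w' ∨ u' = u ∧ w' = w) :
    Layer A N r j P' (Function.update D w (j + 1)) := by
  obtain ⟨h1, h2, h3, h4⟩ := h
  refine ⟨fun v hv => ?_, fun v hv => ?_, fun u' hu' w' hw' hA' hD' => ?_, fun w' hw' h0 h5 => ?_⟩
  · have := h1 v hv
    simp only [Function.update_apply]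
    grind
  · simp only [Function.update_apply]
    grind
  · have := h3 u' hu' w' hw' hA'
    have := hP u' hu' w' hw'
    simp only [Function.update_apply] at *
    grind
  · by_cases hw : w' = w
    · subst hw
      have : u ≠ w' := by rintro rfl; omega
      exact ⟨u, hu, hA, by simp [Function.update_of_ne this, hDu]⟩
    · simp only [Function.update_of_ne hw] at *
      obtain ⟨x, hx, hxA, hxD⟩ := h4 w' hw' h0 h5
      have : x ≠ w := by rintro rfl; omega
      exact ⟨x, hx, hxA, by rwa [Function.update_of_ne this]⟩

/-- By `le`, a value other than 4 is already at most `j + 1`. -/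
theorem Layer.skip (h : Layer A N r j P D) {u w : ℕ} (h' : ¬ (A u w ∧ D w = 4))
    (hP : ∀ u' < N, ∀ w' < N, P' u' w' → P u' w' ∨ u' = u ∧ w' = w) :
    Layer A N r j P' D := by
  obtain ⟨h1, h2, h3, h4⟩ := h
  exact ⟨by grind, by grind, by grind, by grind⟩

theorem Layer.succ (h : Layer A N r j P D) (hP : ∀ u < N, ∀ w < N, P u w) :
    Layer A N r (j + 1) (fun _ _ => False) D := by
  obtain ⟨h1, h2, h3, h4⟩ := h
  exact ⟨by grind, by grind, by grind, by grind⟩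

end

/-- Only local properties of distances are recorded. The upper bounds in `step` serve the
approximation ratio; the predecessors in `pred` lead back to the root and serve the existence of
layouts. -/
theorem ensures_search (s : State) {N K : ℕ} (hN : s.reg .n = N) (hK : s.reg .k = K) (ρ : ℕ → ℕ)
    (hρ : ∀ i < K, s.arr .root i 0 = ρ i) :
    Ensures search s fun t => ∀ i < K,
      IsDist (fun u w => s.arr .adj u w = 1) N (ρ i) (t.arr .dist i) := by
  refine Ensures.loop (fun m t => ∀ i < m,
      IsDist (fun u w => s.arr .adj u w = 1) N (ρ i) (t.arr .dist i)) (by simp)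
    (fun m hm t hf ht => ?_) fun t _ ht => by simpa [hK] using ht
  have hn1 := hf.reg .n (by decide)
  have ha1 := hf.arr .adj (by decide)
  have hr1 := hf.arr .root (by decide)
  simp [hK, hN] at hm hn1
  simp only [ensures_seq, ensures_write]
  refine Ensures.loop (fun m' u => (∀ i < m, u.arr .dist i = t.arr .dist i) ∧
    ∀ v < m', u.arr .dist m v = 4) (by simp) (fun m' hm' u hf' hu => ?_) fun u hf' hu => ?_
  · have hi := hf'.reg .i (by decide)
    simp at hi
    simp only [ensures_write]
    refine ⟨fun i him => ?_, fun v hv => ?_⟩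
    · funext v
      simp [hi, him.ne, hu.1 i him]
    · simp [hi]
      intro h
      exact hu.2 v (by omega)
  have hi2 := hf'.reg .i (by decide)
  have hn2 := hf'.reg .n (by decide)
  have ha2 := hf'.arr .adj (by decide)
  have hr2 := hf'.arr .root (by decide)
  simp [hn1, ha1, hr1] at hi2 hn2 ha2 hr2
  simp [hn1] at hu
  refine Ensures.loop (fun j w => (∀ i < m, w.arr .dist i = t.arr .dist i) ∧
    Layer (fun u w => s.arr .adj u w = 1) N (ρ m) j (fun _ _ => False) (w.arr .dist m))
    ⟨fun i him => ?_, ⟨fun v hv => ?_, fun v hv => ?_, fun v hv => ?_, fun v hv => ?_⟩⟩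
    (fun j hj w hf'' hw => ?_) fun w hf'' hw i hi => ?_
  · funext v
    simp [hi2, him.ne, hu.1 i him]
  · simp [hi2, hr2, hρ m hm, hu.2 v hv]
  · simp [hi2, hr2, hρ m hm, hu.2 v hv]
    split_ifs <;> omega
  · simp
  · simp [hi2, hr2, hρ m hm, hu.2 v hv]
    grind
  · simp at hj
    have hi3 := hf''.reg .i (by decide)
    have hn3 := hf''.reg .n (by decide)
    have ha3 := hf''.arr .adj (by decide)
    simp [hn2, ha2, hi2] at hi3 hn3 ha3
    refine Ensures.loop (fun v x => (∀ i < m, x.arr .dist i = t.arr .dist i) ∧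
      Layer (fun u w => s.arr .adj u w = 1) N (ρ m) j (fun u _ => u < v) (x.arr .dist m))
      ⟨hw.1, hw.2.congr (by simp) (by simp)⟩
      (fun v hv x hf3 hx => ?_) fun x hf3 hx => ⟨hx.1, hx.2.succ (by simp [hn3]; grind)⟩
    have hi4 := hf3.reg .i (by decide)
    have hj4 := hf3.reg .j (by decide)
    have hn4 := hf3.reg .n (by decide)
    have ha4 := hf3.arr .adj (by decide)
    simp [hn3, ha3, hi3] at hi4 hj4 hn4 ha4
    simp [hn3] at hv
    rw [ensures_ifThen]
    simp [hi4, hj4]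
    refine ⟨fun hd => ?_, fun hd => ⟨hx.1, hx.2.congr (fun _ _ => rfl) ?_⟩⟩
    -- The value at `v` stays `j` throughout the scan of its row, because only cells holding 4 are
    -- overwritten and `j < 3`.
    · refine Ensures.loop (fun w y => (∀ i < m, y.arr .dist i = t.arr .dist i) ∧
        y.arr .dist m v = j ∧
        Layer (fun u w => s.arr .adj u w = 1) N (ρ m) j (fun u w' => u < v ∨ u = v ∧ w' < w)
          (y.arr .dist m))
        ⟨hx.1, hd, hx.2.congr (fun _ _ => rfl) (by simp)⟩
        (fun w hw' y hf4 hy => ?_) fun y hf4 hy => ⟨hy.1, hy.2.2.congr (fun _ _ => rfl) ?_⟩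
      · have hi5 := hf4.reg .i (by decide)
        have hj5 := hf4.reg .j (by decide)
        have hv5 := hf4.reg .v (by decide)
        have ha5 := hf4.arr .adj (by decide)
        simp [hn4] at hw'
        simp [ha4, hi4, hj4] at hi5 hj5 hv5 ha5
        rw [ensures_ifThen, ensures_write]
        simp [hi5, hj5, hv5, ha5]
        refine ⟨fun hA h4 => ⟨fun i him => ?_, ?_, ?_⟩, fun h => ⟨hy.1, hy.2.1, hy.2.2.skip (u := v) (w := w) (by tauto) ?_⟩⟩
        · funext v'
          simp [him.ne, hy.1 i him]
        · have := hy.2.1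
          grind
        · convert hy.2.2.write (P' := fun u w' => u < v ∨ u = v ∧ w' ≤ w) hj hv hA hy.2.1 h4 ?_ using 1
          · funext v'
            simp [Function.update_apply]
          · grind
        · grind
      · simp [hn4]
        grind
    · grind
  · obtain hi | rfl : i < m ∨ i = m := by omega
    · rw [hw.1 i hi]
      exact ht i hi
    · obtain ⟨h1, h2, h3, h4⟩ := hw.2
      exact ⟨h1, fun u hu w hw hA hD => h3 u hu w hw hA (.inl hD), h4⟩

theorem ensures_chooseRoots (s : State) {N : ℕ} (hN : s.reg .n = N) (hN0 : 0 < N) :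
    Ensures chooseRoots s fun t => ∀ i < s.reg .k, t.arr .root i 0 < N := by
  refine Ensures.loop (fun m t => ∀ i < m, t.arr .root i 0 < N) (by simp)
    (fun m hm t hf ht => ?_) fun t _ ht => ht
  have hn := hf.reg .n (by decide)
  simp [hN] at hn
  rw [ensures_seq]
  refine ensures_rand fun a ha => ?_
  simp [hn] at ha
  simp
  grind

open Finset

/-! ### Flows -/

/-- `res` is the residual network of a flow from `0` to `1` in the network with the nodes `0`, …,
`N - 1` and the capacities `cap`.  The flow has the value `F` and, in addition, sends one unit from
`y` to `1`. -/
structure Residual (N : ℕ) (cap res : ℕ → ℕ → ℕ) (F y : ℕ) : Prop where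
  skew : ∀ u < N, ∀ v < N, res u v + res v u = cap u v + cap v u
  net : ∀ u < N, u ≠ 1 → ∑ v ∈ range N, ((cap u v : ℤ) - res u v) =
    (if u = 0 then (F : ℤ) else 0) + if u = y then 1 else 0

/-- Push one unit of flow from `x` to `y`. -/
def push (res : ℕ → ℕ → ℕ) (x y u v : ℕ) : ℕ :=
  if u = y ∧ v = x then res y x + 1 else if u = x ∧ v = y then res x y - 1 else res u v

section
variable {N : ℕ} {cap res : ℕ → ℕ → ℕ} {F : ℕ}

/-- An augmenting path is traced back from the sink. Meanwhile the units already pushed form a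
partial path from the current node to the sink, and a push along the edge `xy` moves its starting
point from `y` to `x`. -/
theorem Residual.push {x y : ℕ} (h : Residual N cap res F y) (hx : x < N) (hy : y < N)
    (hxy : x ≠ y) (hr : 0 < res x y) : Residual N cap (push res x y) F x := by
  refine ⟨fun u hu v hv => ?_, fun u hu hu1 => ?_⟩
  · have h1 := h.skew u hu v hv
    have h2 := h.skew x hx y hy
    unfold Algorithm2.push
    grind
  · have h1 := h.net u hu hu1
    by_cases hux : u = x
    · subst hux
      have : ∀ v, ((cap u v : ℤ) - Algorithm2.push res u y u v) =
          ((cap u v : ℤ) - res u v) + if v = y then 1 else 0 := by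
        intro v
        unfold Algorithm2.push
        split_ifs <;> grind
      simp only [this, sum_add_distrib, h1]
      simp [hy, hxy]
    · by_cases huy : u = y
      · subst huy
        have : ∀ v, ((cap u v : ℤ) - Algorithm2.push res x u u v) =
            ((cap u v : ℤ) - res u v) - if v = x then 1 else 0 := by
          intro v
          unfold Algorithm2.push
          split_ifs <;> grind
        simp only [this, sum_sub_distrib, h1]
        simp [hx, hux]
      · have : ∀ v, Algorithm2.push res x y u v = res u v := by
          intro v
          simp [Algorithm2.push, hux, huy]
        simp only [this, h1, hux, huy]

/-- Once the partial path starts at the source, its unit counts for the value. The index `1` stands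
for no pending unit, since `net` claims nothing about the sink. -/
theorem Residual.of_source (h : Residual N cap res F 0) : Residual N cap res (F + 1) 1 := by
  refine ⟨h.skew, fun u hu hu1 => ?_⟩
  rw [h.net u hu hu1]
  by_cases h0 : u = 0 <;> simp [h0, hu1]

/-- Without flow, the residual network is the network. -/
theorem residual_zero : Residual N cap cap 0 1 :=
  ⟨fun _ _ _ _ => rfl, fun u _ hu => by simp [hu]⟩

/-- The value of a flow is the flow across any cut. -/
theorem Residual.value_eq (h : Residual N cap res F 1) (hN : 0 < N) (S : ℕ → Prop)
    [DecidablePred S] (h0 : S 0) (h1 : ¬ S 1) :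
    (F : ℤ) = ∑ u ∈ range N with S u, ∑ v ∈ range N with ¬ S v, ((cap u v : ℤ) - res u v) := by
  have e1 : ∑ u ∈ range N with S u, ∑ v ∈ range N, ((cap u v : ℤ) - res u v) = F := by
    rw [sum_congr rfl (g := fun u => if u = 0 then (F : ℤ) else 0)]
    · simp [hN, h0]
    · intro u hu
      simp only [mem_filter, mem_range] at hu
      have : u ≠ 1 := by rintro rfl; exact h1 hu.2
      rw [h.net u hu.1 this]
      simp [this]
  -- The flow inside `S` cancels: by skew symmetry the double sum equals its own negative.
  have e2 : ∑ u ∈ range N with S u, ∑ v ∈ range N with S v, ((cap u v : ℤ) - res u v) = 0 := by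
    have : ∑ u ∈ range N with S u, ∑ v ∈ range N with S v, ((cap u v : ℤ) - res u v) =
        - ∑ u ∈ range N with S u, ∑ v ∈ range N with S v, ((cap u v : ℤ) - res u v) := by
      conv_lhs => rw [sum_comm]
      rw [← sum_neg_distrib]
      refine sum_congr rfl fun u hu => ?_
      rw [← sum_neg_distrib]
      refine sum_congr rfl fun v hv => ?_
      simp only [mem_filter, mem_range] at hu hv
      have := h.skew u hu.1 v hv.1
      zify at this
      linarith
    linarith
  rw [← e1, ← add_zero (∑ u ∈ range N with S u, ∑ v ∈ range N with ¬ S v, _), ← e2,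
    ← sum_add_distrib]
  refine sum_congr rfl fun u _ => ?_
  rw [add_comm, sum_filter_add_sum_filter_not]

end

/-! ### The search for an augmenting path -/

/-- The nodes `z` with `par z ≠ N` have been reached from `0` along edges of the residual network;
`rank` increases along the paths. -/
structure Tree (N : ℕ) (res : ℕ → ℕ → ℕ) (par rank : ℕ → ℕ) : Prop where
  src : par 0 = 0
  edge : ∀ y < N, par y ≠ N → y ≠ 0 →
    par y < N ∧ par (par y) ≠ N ∧ 0 < res (par y) y ∧ rank (par y) < rank y
  bound : ∀ y < N, par y ≠ N → rank y < #{z ∈ range N | par z ≠ N}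

theorem tree_init {N : ℕ} {res : ℕ → ℕ → ℕ} {par : ℕ → ℕ} (hN : 0 < N) (h0 : par 0 = 0)
    (h : ∀ y < N, y ≠ 0 → par y = N) : Tree N res par fun _ => 0 := by
  refine ⟨h0, fun y hy h1 h2 => absurd (h y hy h2) h1, fun y hy h1 => ?_⟩
  exact card_pos.2 ⟨0, by simp [hN, h0, hN.ne]⟩

theorem card_reached_update {N : ℕ} {par : ℕ → ℕ} {x y : ℕ} (hx : x < N) (hy : y < N)
    (hpy : par y = N) :
    #{z ∈ range N | Function.update par y x z ≠ N} = #{z ∈ range N | par z ≠ N} + 1 := by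
  rw [← card_insert_of_notMem (a := y) (by simp [hpy])]
  congr 1
  ext z
  by_cases h : z = y
  · subst h
    simp [hy, hx.ne]
  · simp [h]

/-- The new node is ranked by the number of nodes reached before it, which exceeds all earlier
ranks. So ranks stay below `N` and bound the lengths of the paths. -/
theorem Tree.extend {N : ℕ} {res : ℕ → ℕ → ℕ} {par rank : ℕ → ℕ} (h : Tree N res par rank)
    (hN : 0 < N) {x y : ℕ} (hx : x < N) (hy : y < N) (hpx : par x ≠ N) (hpy : par y = N)
    (hr : 0 < res x y) :
    Tree N res (Function.update par y x)
      (Function.update rank y #{z ∈ range N | par z ≠ N}) := by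
  have hy0 : y ≠ 0 := by
    rintro rfl
    rw [h.src] at hpy
    omega
  have hxy : x ≠ y := by
    rintro rfl
    exact hpx hpy
  refine ⟨by rw [Function.update_of_ne hy0.symm, h.src], fun z hz hpz hz0 => ?_,
    fun z hz hpz => ?_⟩
  · by_cases hzy : z = y
    · subst hzy
      simp only [Function.update_self, Function.update_of_ne hxy]
      exact ⟨hx, hpx, hr, h.bound x hx hpx⟩
    · rw [Function.update_of_ne hzy] at hpz
      obtain ⟨h1, h2, h3, h4⟩ := h.edge z hz hpz hz0
      have : par z ≠ y := fun e => h2 (e ▸ hpy)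
      simp only [Function.update_of_ne hzy, Function.update_of_ne this]
      exact ⟨h1, h2, h3, h4⟩
  · rw [card_reached_update hx hy hpy]
    by_cases hzy : z = y
    · subst hzy
      simp
    · rw [Function.update_of_ne hzy] at hpz ⊢
      have := h.bound z hz hpz
      omega

/-! ### The network of the algorithm -/

/-- `cap` is the network for `n` vertices and `b` boxes of size `β`, in which `κ v` is the node of
the class of `v`, and the boxes allowed for `v` are those from `lo v` to `hi v`. -/
structure IsNetwork (n b β N : ℕ) (lo hi κ : ℕ → ℕ) (cap : ℕ → ℕ → ℕ) : Prop where
  nodes : N = 2 + b + b * b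
  le_class : ∀ v < n, 2 + b ≤ κ v
  class_lt : ∀ v < n, κ v < N
  source : ∀ y < N, cap 0 y = #{v ∈ range n | κ v = y}
  middle : ∀ v < n, ∀ h < b, cap (κ v) (h + 2) = if lo v ≤ h ∧ h ≤ hi v then n + 1 else 0
  sink : ∀ h < b, cap (h + 2) 1 = β
  zero : ∀ x < N, ∀ y < N, cap x y ≠ 0 → x = 0 ∧ 2 + b ≤ y ∨
    2 + b ≤ x ∧ 2 ≤ y ∧ y < 2 + b ∨ 2 ≤ x ∧ x < 2 + b ∧ y = 1

section
variable {n b β N : ℕ} {lo hi κ : ℕ → ℕ} {cap res : ℕ → ℕ → ℕ} {F : ℕ}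

/-- A distribution of the vertices to the allowed boxes, at most `β` to each box. -/
structure IsPlacement (n b β : ℕ) (lo hi a : ℕ → ℕ) : Prop where
  lt : ∀ v < n, a v < b
  mem : ∀ v < n, lo v ≤ a v ∧ a v ≤ hi v
  card_le : ∀ h < b, #{v ∈ range n | a v = h} ≤ β

/-- If the sink cannot be reached in the residual network, all vertices are served. -/
theorem IsNetwork.le_value (hc : IsNetwork n b β N lo hi κ cap) (h : Residual N cap res F 1)
    {a : ℕ → ℕ} (ha : IsPlacement n b β lo hi a) (S : ℕ → Prop) [DecidablePred S] (h0 : S 0)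
    (h1 : ¬ S 1) (hS : ∀ x < N, ∀ y < N, S x → ¬ S y → res x y = 0) : n ≤ F := by
  have hN := hc.nodes
  -- No residual capacity crosses the cut, so the value of the flow is the capacity of the cut.
  have hF : F = ∑ u ∈ range N with S u, ∑ v ∈ range N with ¬ S v, cap u v := by
    have := h.value_eq (by omega) S h0 h1
    zify
    rw [this]
    refine sum_congr rfl fun u hu => sum_congr rfl fun v hv => ?_
    simp only [mem_filter, mem_range] at hu hv
    simp [hS u hu.1 v hv.1 hu.2 hv.2]
  by_contra! hlt
  -- An edge from a class to an allowed box has capacity `n + 1`, too much for a cut whose capacity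
  -- `F` is less than `n`.
  have hmid : ∀ v < n, S (κ v) → S (a v + 2) := by
    intro v hv hκ
    by_contra hbox
    have e1 := hc.middle v hv (a v) (ha.lt v hv)
    rw [if_pos (ha.mem v hv)] at e1
    have hlt1 := hc.class_lt v hv
    have hlt2 := ha.lt v hv
    have e2 := single_le_sum (f := fun y => cap (κ v) y) (s := {y ∈ range N | ¬ S y})
      (fun _ _ => Nat.zero_le _) (a := a v + 2) (by simp; exact ⟨by omega, hbox⟩)
    have e3 := single_le_sum (f := fun x => ∑ y ∈ range N with ¬ S y, cap x y)
      (s := {x ∈ range N | S x})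
      (fun _ _ => Nat.zero_le _) (a := κ v) (by simp [hlt1, hκ])
    omega
  -- Each vertex is charged to the cut: to the edge from the source into its class if the class is
  -- outside `S`, and otherwise to the edge from its box, which is then in `S`, to the sink.
  have key : n ≤ ∑ y ∈ range N with ¬ S y, cap 0 y + ∑ h ∈ range b with S (h + 2), β := by
    have e1 : #{v ∈ range n | ¬ S (κ v)} = ∑ y ∈ range N with ¬ S y, cap 0 y := by
      rw [card_eq_sum_card_fiberwise (f := κ) (t := {y ∈ range N | ¬ S y})]
      · refine sum_congr rfl fun y hy => ?_
        simp only [mem_filter, mem_range] at hy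
        rw [hc.source y hy.1, filter_filter]
        congr 1
        ext v
        simp only [mem_filter, mem_range]
        grind
      · intro v hv
        simp only [coe_filter, mem_range, Set.mem_ofPred_eq] at hv ⊢
        exact ⟨hc.class_lt v hv.1, hv.2⟩
    have e2 : #{v ∈ range n | S (κ v)} ≤ ∑ h ∈ range b with S (h + 2), β := by
      rw [card_eq_sum_card_fiberwise (f := a) (t := {h ∈ range b | S (h + 2)})]
      · refine sum_le_sum fun h hh => ?_
        simp only [mem_filter, mem_range] at hh
        refine (card_le_card ?_).trans (ha.card_le h hh.1)
        rw [filter_filter]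
        exact monotone_filter_right _ fun v _ hv => hv.2
      · intro v hv
        simp only [coe_filter, mem_range, Set.mem_ofPred_eq] at hv ⊢
        exact ⟨ha.lt v hv.1, hmid v hv.1 hv.2⟩
    have e3 := card_filter_add_card_filter_not (s := range n) (fun v => S (κ v))
    simp only [card_range] at e3
    omega
  have hcut : ∑ y ∈ range N with ¬ S y, cap 0 y + ∑ h ∈ range b with S (h + 2), β ≤ F := by
    rw [hF, ← add_sum_erase ({x ∈ range N | S x}) _ (a := 0) (by simp [h0]; omega)]
    refine Nat.add_le_add_left ?_ _
    calc ∑ h ∈ range b with S (h + 2), β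
        ≤ ∑ h ∈ range b with S (h + 2), ∑ y ∈ range N with ¬ S y, cap (h + 2) y := by
          refine sum_le_sum fun h hh => ?_
          simp only [mem_filter, mem_range] at hh
          rw [← hc.sink h hh.1]
          exact single_le_sum (f := fun y => cap (h + 2) y) (fun _ _ => Nat.zero_le _)
            (by simp [h1]; omega)
      _ = ∑ x ∈ ({h ∈ range b | S (h + 2)}).image (· + 2), ∑ y ∈ range N with ¬ S y, cap x y := by
          rw [sum_image]
          intro x _ y _ hxy
          simpa using hxy
      _ ≤ _ := by
          refine sum_le_sum_of_subset fun x hx => ?_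
          simp only [mem_image, mem_filter, mem_range, mem_erase] at hx ⊢
          obtain ⟨h, hh, rfl⟩ := hx
          exact ⟨by omega, by omega, hh.2⟩
  omega

theorem sum_range_split (f : ℕ → ℤ) (b c : ℕ) : ∑ y ∈ range (2 + b + c), f y =
    f 0 + f 1 + ∑ h ∈ range b, f (h + 2) + ∑ y ∈ Ico (2 + b) (2 + b + c), f y := by
  rw [← sum_range_add_sum_Ico f (show 2 + b ≤ 2 + b + c by omega), add_comm 2 b, sum_range_succ',
    sum_range_succ']
  simp only [zero_add]
  ring

/-- A flow of value `n` distributes each class to the boxes. -/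
theorem IsNetwork.sum_class (hc : IsNetwork n b β N lo hi κ cap) (h : Residual N cap res n 1)
    {y : ℕ} (hy : 2 + b ≤ y) (hyN : y < N) :
    ∑ h ∈ range b, res (h + 2) y = #{v ∈ range n | κ v = y} := by
  have hN := hc.nodes
  have hz : ∀ x < N, ∀ y < N, ¬ (x = 0 ∧ 2 + b ≤ y ∨
    2 + b ≤ x ∧ 2 ≤ y ∧ y < 2 + b ∨ 2 ≤ x ∧ x < 2 + b ∧ y = 1) → cap x y = 0 :=
    fun x hx y hy => not_imp_comm.1 (hc.zero x hx y hy)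
  -- The edges leaving the source have total capacity `n`, so a flow of value `n` saturates each of
  -- them.
  have hsat : res 0 y = 0 := by
    have e1 := h.net 0 (by omega) (by omega)
    simp only [sum_sub_distrib, if_pos] at e1
    have e2 : ∑ y ∈ range N, cap 0 y = n := by
      rw [sum_congr rfl fun y hy => hc.source y (mem_range.1 hy),
        ← card_eq_sum_card_fiberwise, card_range]
      intro v hv
      simp only [coe_range, Set.mem_Iio] at hv ⊢
      exact hc.class_lt v hv
    have e3 : ∑ y ∈ range N, res 0 y = 0 := by
      zify at e2 ⊢
      simp at e1
      linarith
    exact (sum_eq_zero_iff.1 e3) y (mem_range.2 hyN)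
  have e1 := h.net y hyN (by omega)
  rw [if_neg (by omega), if_neg (by omega), hN, sum_range_split] at e1
  have s0 := h.skew 0 (by omega) y hyN
  rw [hsat, hz y hyN 0 (by omega) (by omega)] at s0
  have s1 := h.skew 1 (by omega) y hyN
  rw [hz y hyN 1 (by omega) (by omega), hz 1 (by omega) y hyN (by omega)] at s1
  -- Edges from boxes to classes have capacity zero, so their residual capacity is the flow on the
  -- opposite edge.
  have s2 : ∑ h ∈ range b, ((cap y (h + 2) : ℤ) - res y (h + 2)) =
      ∑ h ∈ range b, (res (h + 2) y : ℤ) := by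
    refine sum_congr rfl fun i hi => ?_
    have hi := mem_range.1 hi
    have := h.skew y hyN (i + 2) (by omega)
    rw [hz (i + 2) (by omega) y hyN (by omega)] at this
    omega
  have s3 : ∑ x ∈ Ico (2 + b) (2 + b + b * b), ((cap y x : ℤ) - res y x) = 0 := by
    refine sum_eq_zero fun x hx => ?_
    have hx := mem_Ico.1 hx
    have := h.skew y hyN x (by omega)
    rw [hz x (by omega) y hyN (by omega), hz y hyN x (by omega) (by omega)] at this
    rw [hz y hyN x (by omega) (by omega)]
    omega
  rw [s2, s3, hz y hyN 0 (by omega) (by omega), hz y hyN 1 (by omega) (by omega)] at e1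
  rw [← hc.source y hyN]
  zify
  omega

/-- Conservation at a box: the flow that enters it, read off the reversed edges, leaves through the
edge of capacity `β` to the sink. -/
theorem IsNetwork.sum_box_le (hc : IsNetwork n b β N lo hi κ cap) (h : Residual N cap res F 1)
    {i : ℕ} (hi : i < b) : ∑ y ∈ Ico (2 + b) N, res (i + 2) y ≤ β := by
  have hN := hc.nodes
  have hz : ∀ x < N, ∀ y < N, ¬ (x = 0 ∧ 2 + b ≤ y ∨
    2 + b ≤ x ∧ 2 ≤ y ∧ y < 2 + b ∨ 2 ≤ x ∧ x < 2 + b ∧ y = 1) → cap x y = 0 :=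
    fun x hx y hy => not_imp_comm.1 (hc.zero x hx y hy)
  have hiN : i + 2 < N := by omega
  have e1 := h.net (i + 2) hiN (by omega)
  rw [if_neg (by omega), if_neg (by omega), hN, sum_range_split] at e1
  have s0 := h.skew 0 (by omega) (i + 2) hiN
  rw [hz _ hiN 0 (by omega) (by omega), hz 0 (by omega) _ hiN (by omega)] at s0
  have s2 : ∑ j ∈ range b, ((cap (i + 2) (j + 2) : ℤ) - res (i + 2) (j + 2)) = 0 := by
    refine sum_eq_zero fun j hj => ?_
    have hj := mem_range.1 hj
    have := h.skew (i + 2) hiN (j + 2) (by omega)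
    rw [hz _ hiN (j + 2) (by omega) (by omega), hz (j + 2) (by omega) _ hiN (by omega)] at this
    rw [hz _ hiN (j + 2) (by omega) (by omega)]
    omega
  have s3 : ∑ x ∈ Ico (2 + b) (2 + b + b * b), ((cap (i + 2) x : ℤ) - res (i + 2) x) =
      - ∑ x ∈ Ico (2 + b) (2 + b + b * b), (res (i + 2) x : ℤ) := by
    rw [← sum_neg_distrib]
    refine sum_congr rfl fun x hx => ?_
    have hx := mem_Ico.1 hx
    rw [hz _ hiN x (by omega) (by omega)]
    simp
  rw [s2, s3, hz _ hiN 0 (by omega) (by omega), hc.sink i hi] at e1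
  rw [hN]
  zify
  omega

/-- Between a class and a forbidden box both capacities vanish, hence so do both residual
capacities. -/
theorem IsNetwork.mem_of_pos (hc : IsNetwork n b β N lo hi κ cap) (h : Residual N cap res F 1)
    {v i : ℕ} (hv : v < n) (hi' : i < b) (hr : 0 < res (i + 2) (κ v)) :
    lo v ≤ i ∧ i ≤ hi v := by
  have hN := hc.nodes
  have h1 := hc.class_lt v hv
  have h2 := hc.le_class v hv
  by_contra hcon
  have h3 := hc.middle v hv i hi'
  rw [if_neg hcon] at h3
  have h4 := h.skew (κ v) h1 (i + 2) (by omega)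
  have h5 := not_imp_comm.1 (hc.zero (i + 2) (by omega) (κ v) h1) (by omega)
  omega

end

/-! ### The construction of the network -/

/-- The capacities after the classes with an index less than `Q` and the first `H` edges of the class
with the index `Q` have been treated; the class with the index `q` has `cl q` vertices. -/
def capacity (n B : ℕ) (cl : ℕ → ℕ) (P Q H x y : ℕ) : ℕ :=
  if x = 0 then if 2 + B ≤ y ∧ y < 2 + B + P then cl (y - (2 + B)) else 0
  else if 2 + B ≤ x ∧ (x < 2 + B + Q ∨ x = 2 + B + Q ∧ y < 2 + H) ∧ 2 ≤ y ∧ y < 2 + B ∧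
    (x - (2 + B)) / B ≤ y - 2 ∧ y - 2 ≤ (x - (2 + B)) % B then n + 1 else 0

section
variable {n B : ℕ} {cl : ℕ → ℕ} {Q H x y : ℕ}

theorem capacity_zero : capacity n B cl 0 0 0 x y = 0 := by
  simp only [capacity]
  grind

/-- `P` and `Q` are separate because the source edge of a class is written before its edges to the
boxes. This identity and the next two follow that write, one round over the boxes, and the passage
to the next class. -/
theorem capacity_source : capacity n B cl (Q + 1) Q 0 x y =
    if x = 0 ∧ y = 2 + B + Q then cl Q else capacity n B cl Q Q 0 x y := by
  simp only [capacity]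
  by_cases hx : x = 0
  · by_cases hy : y = 2 + B + Q
    · simp [hx, hy]
    · simp only [hx, hy]
      grind
  · simp [hx]

theorem capacity_middle (hH : H < B) : capacity n B cl (Q + 1) Q (H + 1) x y =
    if x = 2 + B + Q ∧ y = H + 2 ∧ Q / B ≤ H ∧ H ≤ Q % B then n + 1
    else capacity n B cl (Q + 1) Q H x y := by
  simp only [capacity]
  by_cases hxQ : x = 2 + B + Q
  · subst hxQ
    simp only [Nat.add_sub_cancel_left]
    grind
  · grind

theorem capacity_next : capacity n B cl (Q + 1) Q B x y =
    capacity n B cl (Q + 1) (Q + 1) 0 x y := by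
  simp only [capacity]
  grind

end

/-- Count the vertices of the classes. -/
def countClasses : Cmd :=
  .loop .i (.reg .b) (.loop .j (.reg .b) (.write .cls (.reg .i) (.reg .j) 0)) ;;
  .loop .v (.reg .n)
    (.write .cls (.get .start (.reg .v) 0) (.get .finish (.reg .v) 0)
      (.succ (.get .cls (.get .start (.reg .v) 0) (.get .finish (.reg .v) 0))))

theorem ensures_countClasses (s : State) {n B : ℕ} (hn : s.reg .n = n) (hb : s.reg .b = B) :
    Ensures countClasses s fun t => ∀ i < B, ∀ j < B,
      t.arr .cls i j = #{v ∈ range n | s.arr .start v 0 = i ∧ s.arr .finish v 0 = j} := by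
  rw [countClasses, ensures_seq]
  refine Ensures.loop (fun m t => ∀ i < m, ∀ j < B, t.arr .cls i j = 0) (by simp)
    (fun m hm t hf ht => ?_) fun t hf ht => ?_
  · have hb1 := hf.reg .b (by decide)
    simp [hb] at hb1
    refine Ensures.loop (fun m' t => (∀ i < m, ∀ j < B, t.arr .cls i j = 0) ∧
      ∀ j < m', t.arr .cls m j = 0) (by simpa using ht) (fun m' hm' u hf' hu => ?_)
      fun u hf' hu i hi => ?_
    · have hi1 := hf'.reg .i (by decide)
      simp at hi1
      simp [hi1]
      grind
    · simp [hb1] at hu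
      grind
  · have hn1 := hf.reg .n (by decide)
    have hs1 := hf.arr .start (by decide)
    have hf1 := hf.arr .finish (by decide)
    simp [hb] at ht
    simp [hn] at hn1
    refine Ensures.loop (fun m u => ∀ i < B, ∀ j < B,
      u.arr .cls i j = #{v ∈ range m | s.arr .start v 0 = i ∧ s.arr .finish v 0 = j})
      (by simpa using ht) (fun m hm u hf' hu => ?_) fun u hf' hu => by
        simpa [hn1] using hu
    have hs2 := hf'.arr .start (by decide)
    have hf2 := hf'.arr .finish (by decide)
    rw [hs1] at hs2
    rw [hf1] at hf2
    simp [hs2, hf2, range_add_one, filter_insert]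
    intro i hi j hj
    by_cases h : s.arr .start m 0 = i ∧ s.arr .finish m 0 = j
    · obtain ⟨rfl, rfl⟩ := h
      simp [hu _ hi _ hj]
    · rw [if_neg (by tauto), if_neg h, hu i hi j hj]

/-- Number the nodes of the network. -/
def numberNodes : Cmd :=
  .assign .nodes 2 ;;
  .loop .h (.reg .b) (.assign .nodes (.succ (.reg .nodes))) ;;
  .loop .i (.reg .b) (.loop .j (.reg .b)
    (.write .ident (.reg .i) (.reg .j) (.reg .nodes) ;; .assign .nodes (.succ (.reg .nodes))))

theorem ensures_numberNodes (s : State) {B : ℕ} (hb : s.reg .b = B) :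
    Ensures numberNodes s fun t => t.reg .nodes = 2 + B + B * B ∧ ∀ i < B, ∀ j < B,
      t.arr .ident i j = 2 + B + (i * B + j) := by
  simp only [numberNodes, ensures_seq, ensures_assign]
  refine Ensures.loop (fun m t => t.reg .nodes = 2 + m) (by simp)
    (fun m hm t hf ht => by simp [ht, add_assoc]) fun t hf ht => ?_
  have hb1 := hf.reg .b (by decide)
  simp [hb] at hb1 ht
  refine Ensures.loop (fun m t => t.reg .nodes = 2 + B + m * B ∧ ∀ i < m, ∀ j < B,
      t.arr .ident i j = 2 + B + (i * B + j)) (by simp [ht]) (fun m hm u hf' hu => ?_)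
    fun u hf' hu => by simpa [hb1] using hu
  have hb2 := hf'.reg .b (by decide)
  simp [hb1] at hb2
  refine Ensures.loop (fun m' t => t.reg .nodes = 2 + B + (m * B + m') ∧
      (∀ i < m, ∀ j < B, t.arr .ident i j = 2 + B + (i * B + j)) ∧
      ∀ j < m', t.arr .ident m j = 2 + B + (m * B + j))
    (by simpa using hu) (fun m' hm' w hf'' hw => ?_) fun w hf'' hw => ?_
  · have hi := hf''.reg .i (by decide)
    simp at hi
    simp [hi, hw.1]
    grind
  · simp [hb2] at hw
    refine ⟨by rw [hw.1]; ring, ?_⟩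
    grind

/-- Fill in the capacities of the edges from the source and to the boxes. -/
def fillClasses : Cmd :=
  .loop .x (.reg .nodes) (.loop .y (.reg .nodes) (.write .res (.reg .x) (.reg .y) 0)) ;;
  .loop .i (.reg .b)
    (.loop .j (.reg .b)
      (.write .res 0 (.get .ident (.reg .i) (.reg .j)) (.get .cls (.reg .i) (.reg .j)) ;;
       .loop .h (.reg .b)
         (.ifThen (.and (.lt (.reg .i) (.succ (.reg .h))) (.lt (.reg .h) (.succ (.reg .j))))
           (.write .res (.get .ident (.reg .i) (.reg .j)) (.succ (.succ (.reg .h)))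
             (.succ (.reg .n))))))

theorem ensures_fillClasses (s : State) {n B N : ℕ} (hn : s.reg .n = n) (hb : s.reg .b = B)
    (hN : s.reg .nodes = N) (hNB : N = 2 + B + B * B)
    (hid : ∀ i < B, ∀ j < B, s.arr .ident i j = 2 + B + (i * B + j)) :
    Ensures fillClasses s fun t => ∀ x < N, ∀ y < N,
      t.arr .res x y = capacity n B (fun q => s.arr .cls (q / B) (q % B)) (B * B) (B * B) 0 x y := by
  set cl : ℕ → ℕ := fun q => s.arr .cls (q / B) (q % B) with hcl
  rw [fillClasses, ensures_seq]
  refine Ensures.loop (fun m t => ∀ x < m, ∀ y < N, t.arr .res x y = 0) (by simp)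
    (fun m hm t hf ht => ?_) fun t hf ht => ?_
  · have hN1 := hf.reg .nodes (by decide)
    simp [hN] at hN1
    refine Ensures.loop (fun m' t => (∀ x < m, ∀ y < N, t.arr .res x y = 0) ∧
      ∀ y < m', t.arr .res m y = 0) (by simpa using ht) (fun m' hm' u hf' hu => ?_)
      fun u hf' hu i hi => ?_
    · have hi1 := hf'.reg .x (by decide)
      simp at hi1
      simp [hi1]
      grind
    · simp [hN1] at hu
      grind
  have hn1 := hf.reg .n (by decide)
  have hb1 := hf.reg .b (by decide)
  have hc1 := hf.arr .cls (by decide)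
  have hi1 := hf.arr .ident (by decide)
  simp [hN] at ht
  simp [hn, hb] at hn1 hb1
  refine Ensures.loop (fun m u => ∀ x < N, ∀ y < N,
    u.arr .res x y = capacity n B cl (m * B) (m * B) 0 x y) ?_
    (fun m hm u hf' hu => ?_) fun u hf' hu => by simpa [hb1] using hu
  · intro x hx y hy
    rw [zero_mul, capacity_zero]
    exact ht x hx y hy
  have hn2 := hf'.reg .n (by decide)
  have hb2 := hf'.reg .b (by decide)
  have hc2 := hf'.arr .cls (by decide)
  have hi2 := hf'.arr .ident (by decide)
  simp [hn1, hb1] at hn2 hb2 hm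
  rw [hc1] at hc2
  rw [hi1] at hi2
  refine Ensures.loop (fun m' u => ∀ x < N, ∀ y < N,
    u.arr .res x y = capacity n B cl (m * B + m') (m * B + m') 0 x y) (by simpa using hu)
    (fun m' hm' w hf'' hw => ?_) fun w hf'' hw => by
      simpa [hb2, Nat.succ_mul] using hw
  have hn3 := hf''.reg .n (by decide)
  have hb3 := hf''.reg .b (by decide)
  have hi3 := hf''.reg .i (by decide)
  have hc3 := hf''.arr .cls (by decide)
  have hid3 := hf''.arr .ident (by decide)
  simp [hn2, hb2, hc2, hi2] at hn3 hb3 hi3 hc3 hid3 hm'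
  rw [ensures_seq, ensures_write]
  -- The pair `(m, m')` is recovered from its index `m * B + m'` by quotient and remainder; from
  -- here on only the index is used.
  have hdiv : (m * B + m') / B = m := by
    rw [mul_comm, Nat.mul_add_div (by omega), Nat.div_eq_of_lt hm', add_zero]
  have hmod : (m * B + m') % B = m' := by
    rw [mul_comm, Nat.mul_add_mod, Nat.mod_eq_of_lt hm']
  have hQ : m * B + m' < B * B := by
    have := Nat.mul_le_mul_right B (show m + 1 ≤ B from hm)
    rw [Nat.succ_mul] at this
    omega
  have hclm : cl (m * B + m') = s.arr .cls m m' := by rw [hcl]; simp only [hdiv, hmod]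
  have hidm := hid m hm m' hm'
  clear_value cl
  generalize hQ' : m * B + m' = Q at *
  refine Ensures.loop (fun h u => ∀ x < N, ∀ y < N,
    u.arr .res x y = capacity n B cl (Q + 1) Q h x y) ?_
    (fun h hh x hf3 hx => ?_) fun x hf3 hx => ?_
  · intro x hx y hy
    rw [capacity_source, ← hw x hx y hy, hclm]
    simp [hi3, hid3, hc3, hidm]
  · have hn4 := hf3.reg .n (by decide)
    have hi4 := hf3.reg .i (by decide)
    have hj4 := hf3.reg .j (by decide)
    have hid4 := hf3.arr .ident (by decide)
    simp [hn3, hi3, hid3, hb3] at hn4 hi4 hj4 hid4 hh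
    rw [ensures_ifThen, ensures_write]
    simp only [capacity_middle hh, hdiv, hmod]
    simp [hn4, hi4, hj4, hid4, hidm]
    refine ⟨fun h1 h2 y hy z hz => ?_, fun hne y hy z hz => ?_⟩
    · rw [← hx y hy z hz]
      simp [h1, h2]
    · rw [hx y hy z hz, if_neg (by omega)]
  · intro y hy z hz
    simp [hb3] at hx
    rw [hx y hy z hz, ← add_assoc, hQ', capacity_next]

theorem ensures_network (s : State) {n B β : ℕ} (hn : s.reg .n = n) (hb : s.reg .b = B)
    (hβ : s.reg .box = β)
    (hI : ∀ v < n, s.arr .start v 0 < B ∧ s.arr .finish v 0 < B) :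
    Ensures network s fun t => t.reg .nodes = 2 + B + B * B ∧
      t.reg .size = max (s.reg .size) (2 + B + B * B) ∧
      IsNetwork n B β (2 + B + B * B) (fun v => s.arr .start v 0) (fun v => s.arr .finish v 0)
        (fun v => t.arr .ident (s.arr .start v 0) (s.arr .finish v 0)) (t.arr .res) := by
  -- The program grouped into phases; `ensures_seq` identifies the two bracketings at the end.
  have hprog : Ensures (countClasses ;; numberNodes ;;
      .ifThen (.lt (.reg .size) (.reg .nodes)) (.assign .size (.reg .nodes)) ;; fillClasses ;;
      .loop .h (.reg .b) (.write .res (.succ (.succ (.reg .h))) 1 (.reg .box))) s fun t =>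
        t.reg .nodes = 2 + B + B * B ∧ t.reg .size = max (s.reg .size) (2 + B + B * B) ∧
      IsNetwork n B β (2 + B + B * B) (fun v => s.arr .start v 0) (fun v => s.arr .finish v 0)
        (fun v => t.arr .ident (s.arr .start v 0) (s.arr .finish v 0)) (t.arr .res) := by
    simp only [ensures_seq]
    refine (ensures_countClasses s hn hb).framed fun t hf ht => ?_
    have hb1 := hf.reg .b (by decide)
    rw [hb] at hb1
    refine (ensures_numberNodes t hb1).framed fun u hf' hu => ?_
    obtain ⟨hu1, hu2⟩ := hu
    simp only [ensures_ifThen, ensures_assign]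
    have hsize : u.reg .size = s.reg .size := by
      rw [hf'.reg .size (by decide), hf.reg .size (by decide)]
    have hb2 := hf'.reg .b (by decide)
    have hβ2 := hf'.reg .box (by decide)
    have hn2 := hf'.reg .n (by decide)
    have hc2 := hf'.arr .cls (by decide)
    rw [hb1] at hb2
    rw [hf.reg .n (by decide), hn] at hn2
    rw [hf.reg .box (by decide), hβ] at hβ2
    set N := 2 + B + B * B with hN
    -- The rest of the program, stated once for both outcomes of the comparison with `size`.
    have main : ∀ w : State, w.reg .n = n → w.reg .b = B → w.reg .box = β → w.reg .nodes = N →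
        w.reg .size = max (s.reg .size) N → w.arr .cls = t.arr .cls →
        w.arr .ident = u.arr .ident →
        Ensures fillClasses w fun t => Ensures (.loop .h (.reg .b)
          (.write .res (.succ (.succ (.reg .h))) 1 (.reg .box))) t fun t => t.reg .nodes = N ∧
          t.reg .size = max (s.reg .size) N ∧
          IsNetwork n B β N (fun v => s.arr .start v 0) (fun v => s.arr .finish v 0)
          (fun v => t.arr .ident (s.arr .start v 0) (s.arr .finish v 0)) (t.arr .res) := by
      intro w hnw hbw hβw hNw hsw hcw hiw
      refine (ensures_fillClasses w hnw hbw hNw hN (by rwa [hiw])).framed fun x hfx hx => ?_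
      rw [hcw] at hx
      have hbx := hfx.reg .b (by decide)
      have hβx := hfx.reg .box (by decide)
      rw [hbw] at hbx
      rw [hβw] at hβx
      refine Ensures.loop (fun m y => ∀ u < N, ∀ v < N, y.arr .res u v =
        if v = 1 ∧ 2 ≤ u ∧ u < m + 2 then β else x.arr .res u v) (by simp; grind)
        (fun m hm y hfy hy => ?_) fun y hfy hy => ?_
      · have hβy := hfy.reg .box (by decide)
        simp [hβx] at hβy
        simp [hβy]
        intro u hu v hv
        rw [hy u hu v hv]
        grind
      · rw [hfy.reg .nodes (by decide), hfy.reg .size (by decide), hfx.reg .nodes (by decide),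
          hfx.reg .size (by decide)]
        refine ⟨hNw, hsw, ?_⟩
        rw [hfy.arr .ident (by decide), hfx.arr .ident (by decide), hiw]
        simp only [Expr.eval_reg, hbx] at hy
        -- The node of the class of `v` determines both ends of the interval of `v`, so different
        -- classes have different nodes.
        have hk : ∀ v < n, ∃ q < B * B, u.arr .ident (s.arr .start v 0) (s.arr .finish v 0) =
            2 + B + q ∧ q / B = s.arr .start v 0 ∧ q % B = s.arr .finish v 0 := by
          intro v hv
          obtain ⟨h1, h2⟩ := hI v hv
          refine ⟨_, ?_, hu2 _ h1 _ h2, ?_, ?_⟩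
          · have := Nat.mul_le_mul_right B (show s.arr .start v 0 + 1 ≤ B from h1)
            rw [Nat.succ_mul] at this
            omega
          · rw [mul_comm, Nat.mul_add_div (by omega), Nat.div_eq_of_lt h2, add_zero]
          · rw [mul_comm, Nat.mul_add_mod, Nat.mod_eq_of_lt h2]
        have hres : ∀ u < N, ∀ v < N, y.arr .res u v = if v = 1 ∧ 2 ≤ u ∧ u < B + 2 then β else
            capacity n B (fun q => t.arr .cls (q / B) (q % B)) (B * B) (B * B) 0 u v := by
          intro u hu v hv
          rw [hy u hu v hv, hx u hu v hv]
        refine ⟨hN, fun v hv => ?_, fun v hv => ?_, fun z hz => ?_, fun v hv h hh => ?_,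
          fun h hh => ?_, fun z hz z' hz' => ?_⟩
        · obtain ⟨q, hq, h1, -⟩ := hk v hv
          omega
        · obtain ⟨q, hq, h1, -⟩ := hk v hv
          omega
        · rw [hres 0 (by omega) z hz, if_neg (by omega), capacity, if_pos rfl]
          split_ifs with h
          · obtain ⟨q, rfl⟩ := Nat.exists_eq_add_of_le h.1
            have hq : q < B * B := by omega
            have hB : 0 < B := Nat.pos_of_ne_zero (by rintro rfl; simp at hq)
            rw [Nat.add_sub_cancel_left, ht _ (Nat.div_lt_of_lt_mul hq) _ (Nat.mod_lt _ hB)]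
            congr 1
            refine filter_congr fun v hv => ?_
            obtain ⟨q', hq', h1, h2, h3⟩ := hk v (mem_range.1 hv)
            rw [h1, ← h2, ← h3]
            constructor
            · rintro ⟨h4, h5⟩
              rw [← Nat.div_add_mod q' B, h4, h5, Nat.div_add_mod]
            · intro h4
              obtain rfl : q' = q := by omega
              exact ⟨rfl, rfl⟩
          · symm
            rw [card_eq_zero, filter_eq_empty_iff]
            intro v hv h4
            obtain ⟨q', hq', h1, -⟩ := hk v (mem_range.1 hv)
            omega
        · obtain ⟨q, hq, h1, h2, h3⟩ := hk v hv
          rw [hres _ (by omega) _ (by omega), if_neg (by omega), capacity, if_neg (by omega), h1,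
            Nat.add_sub_cancel_left, Nat.add_sub_cancel, h2, h3]
          congr 1
          rw [eq_iff_iff]
          omega
        · rw [hres _ (by omega) _ (by omega), if_pos (by omega)]
        · rw [hres _ hz _ hz']
          simp only [capacity]
          grind
    refine ⟨fun h => main _ hn2 hb2 hβ2 ?_ ?_ hc2 rfl, fun h => main _ hn2 hb2 hβ2 ?_ ?_ hc2 rfl⟩
    · simp [hu1]
    · simp [hu1, hsize] at h ⊢
      omega
    · simp [hu1]
    · simp [hu1, hsize] at h ⊢
      omega
  simpa only [network, countClasses, numberNodes, fillClasses, ensures_seq] using hprog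

/-! ### Augmenting paths in the program -/

/-- Search for the nodes that can be reached in the residual network. -/
def reach : Cmd :=
  .loop .x (.reg .nodes) (.write .par (.reg .x) 0 (.reg .nodes)) ;;
  .write .par 0 0 0 ;;
  .loop .r (.reg .nodes)
    (.loop .x (.reg .nodes)
      (.ifThen (.not (.eq (.get .par (.reg .x) 0) (.reg .nodes)))
        (.loop .y (.reg .nodes)
          (.ifThen (.and (.eq (.get .par (.reg .y) 0) (.reg .nodes))
              (.lt 0 (.get .res (.reg .x) (.reg .y))))
            (.write .par (.reg .y) 0 (.reg .x))))))

/-- A sweep examines all edges that leave the nodes reached at its start. If it finds no new node,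
the reached set is closed; otherwise the set grows, which can happen fewer than `N` times as the
source is in it from the start. -/
theorem ensures_reach (s : State) {N : ℕ} (hN : s.reg .nodes = N) (hN0 : 0 < N) :
    Ensures reach s fun t => (∃ rank, Tree N (s.arr .res) (fun z => t.arr .par z 0) rank) ∧
      ∀ x < N, ∀ y < N, t.arr .par x 0 ≠ N → t.arr .par y 0 = N → s.arr .res x y = 0 := by
  simp only [reach, ensures_seq, ensures_write]
  set res := s.arr .res with hres
  refine Ensures.loop (fun m t => ∀ x < m, t.arr .par x 0 = N) (by simp)
    (fun m hm t hf ht => ?_) fun t hf ht => ?_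
  · have hN1 := hf.reg .nodes (by decide)
    simp [hN] at hN1
    simp [hN1]
    grind
  have hN1 := hf.reg .nodes (by decide)
  have hr1 := hf.arr .res (by decide)
  simp [hN] at hN1 ht
  let closed (u : State) : Prop :=
    ∀ x < N, ∀ y < N, u.arr .par x 0 ≠ N → u.arr .par y 0 = N → res x y = 0
  -- after each round either nothing is left to do or another node has been reached
  refine Ensures.loop (fun m u => (∃ rank, Tree N res (fun z => u.arr .par z 0) rank) ∧
      (m < #{z ∈ range N | u.arr .par z 0 ≠ N} ∨ closed u))
    ⟨⟨_, tree_init hN0 (by simp) fun y hy hy0 => ?_⟩, .inl (card_pos.2 ⟨0, ?_⟩)⟩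
    (fun m hm u hf' hu => ?_) fun u hf' hu => ⟨hu.1, hu.2.resolve_left ?_⟩
  · simp [hy0, ht y hy]
  · simp [hN0, hN0.ne]
  · have hN2 := hf'.reg .nodes (by decide)
    have hr2 := hf'.arr .res (by decide)
    simp [hN1] at hN2
    simp [hr1] at hr2
    have hmono : ∀ p : ℕ → ℕ, (∀ z < N, u.arr .par z 0 ≠ N → p z ≠ N) →
        {z ∈ range N | u.arr .par z 0 ≠ N} ⊆ {z ∈ range N | p z ≠ N} := by
      intro p hp z hz
      simp only [mem_filter, mem_range] at hz ⊢
      exact ⟨hz.1, hp z hz.1 hz.2⟩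
    -- Compared with the state `u` at the start of the sweep: nodes stay reached, edges leaving the
    -- nodes of `u` are settled in turn, and a closed `u` does not change any more.
    refine Ensures.loop (fun m' w => (∃ rank, Tree N res (fun z => w.arr .par z 0) rank) ∧
      (∀ z < N, u.arr .par z 0 ≠ N → w.arr .par z 0 ≠ N) ∧
      (∀ x < m', ∀ y < N, u.arr .par x 0 ≠ N → w.arr .par y 0 = N → res x y = 0) ∧
      (closed u → ∀ z < N, u.arr .par z 0 = N → w.arr .par z 0 = N))
      ⟨hu.1, fun _ _ h => h, by simp, fun _ _ _ h => h⟩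
      (fun x hx w hf'' hw => ?_) fun w hf'' hw => ⟨hw.1, ?_⟩
    · have hN3 := hf''.reg .nodes (by decide)
      have hr3 := hf''.arr .res (by decide)
      simp [hN2] at hN3 hx
      simp [hr2] at hr3
      obtain ⟨h1, h2, h3, h4⟩ := hw
      rw [ensures_ifThen]
      simp [hN3]
      refine ⟨fun hpx => ?_, fun hpx => ⟨h1, h2, fun x' hx' y hy hpx' => ?_, h4⟩⟩
      · refine Ensures.loop (fun m' w => (∃ rank, Tree N res (fun z => w.arr .par z 0) rank) ∧
          w.arr .par x 0 ≠ N ∧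
          (∀ z < N, u.arr .par z 0 ≠ N → w.arr .par z 0 ≠ N) ∧
          (∀ x' < x, ∀ y < N, u.arr .par x' 0 ≠ N → w.arr .par y 0 = N → res x' y = 0) ∧
          (∀ y < m', w.arr .par y 0 = N → res x y = 0) ∧
          (closed u → ∀ z < N, u.arr .par z 0 = N → w.arr .par z 0 = N))
          ⟨h1, hpx, h2, h3, by simp, h4⟩
          (fun y hy v hf3 hv => ?_) fun v hf3 hv => ?_
        · have hN4 := hf3.reg .nodes (by decide)
          have hx4 := hf3.reg .x (by decide)
          have hr4 := hf3.arr .res (by decide)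
          simp [hN3] at hN4 hx4 hy
          simp [hr3] at hr4
          obtain ⟨⟨rank, hT⟩, i1, i2, i3, i4, i5⟩ := hv
          rw [ensures_ifThen, ensures_write]
          simp [hN4, hx4, hr4]
          refine ⟨fun hpy hr => ⟨?_, ?_, ?_, ?_, ?_, ?_⟩,
            fun hno => ⟨⟨rank, hT⟩, i1, i2, i3, ?_, i5⟩⟩
          · refine ⟨Function.update rank y #{z ∈ range N | v.arr .par z 0 ≠ N}, ?_⟩
            have := hT.extend hN0 hx hy i1 hpy hr
            convert this using 1
            funext z
            simp [Function.update_apply]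
          · grind
          · grind
          · grind
          · grind
          · intro hcl z hz hzN
            have := hcl x hx y hy (fun h => i1 (i5 hcl x hx h)) (by_contra fun h => i2 y hy h hpy)
            exact absurd this hr.ne'
          · grind
        · simp [hN3] at hv
          grind
      · grind
    · have hw' := hw
      simp [hN2] at hw'
      obtain ⟨h1, h2, h3, h4⟩ := hw'
      by_cases heq : ∀ z < N, u.arr .par z 0 = N → w.arr .par z 0 = N
      · exact .inr fun x hx y hy hpx hpy => h3 x hx y hy (fun h => hpx (heq x hx h)) hpy
      · left
        have hm' := hu.2.resolve_right fun h => heq (h4 h)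
        push Not at heq
        obtain ⟨z, hz, hz1, hz2⟩ := heq
        refine (Nat.succ_le_of_lt hm').trans_lt (card_lt_card ⟨hmono _ h2, fun h => ?_⟩)
        have := @h z (by simp [hz, hz2])
        simp [hz1] at this
  · simp only [Expr.eval_reg, State.tick_reg, State.setArr_reg, hN1]
    exact not_lt.2 ((card_filter_le _ _).trans (by simp))

/-- Push one unit of flow along the path that has been found. -/
def augment : Cmd :=
  .assign .y 1 ;;
  .loop .r (.reg .nodes)
    (.ifThen (.lt 0 (.reg .y))
      (.assign .x (.get .par (.reg .y) 0) ;;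
       .write .res (.reg .x) (.reg .y) (.sub (.get .res (.reg .x) (.reg .y)) 1) ;;
       .write .res (.reg .y) (.reg .x) (.succ (.get .res (.reg .y) (.reg .x))) ;;
       .assign .y (.reg .x)))

/-- Ranks strictly decrease towards the source, so the path has fewer than `N` edges and the loop
gets to its end. -/
theorem ensures_augment (s : State) {N F : ℕ} {cap : ℕ → ℕ → ℕ} {rank : ℕ → ℕ}
    (hN : s.reg .nodes = N) (hN1 : 1 < N) (hR : Residual N cap (s.arr .res) F 1)
    (hT : Tree N (s.arr .res) (fun z => s.arr .par z 0) rank) (hsink : s.arr .par 1 0 ≠ N) :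
    Ensures augment s fun t => Residual N cap (t.arr .res) (F + 1) 1 := by
  rw [augment, ensures_seq, ensures_assign]
  -- A push lowers only the residual capacity of the edge into `y`, and `y` outranks all that is
  -- still to come, so the remaining tree edges stay usable. The last clause is the budget that
  -- forces `y = 0` after `N` rounds.
  refine Ensures.loop (fun m t => t.reg .y < N ∧ s.arr .par (t.reg .y) 0 ≠ N ∧
    Residual N cap (t.arr .res) F (t.reg .y) ∧
    (∀ z < N, s.arr .par z 0 ≠ N → z ≠ 0 → rank z ≤ rank (t.reg .y) →
      0 < t.arr .res (s.arr .par z 0) z) ∧ (t.reg .y = 0 ∨ rank (t.reg .y) + m < N))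
    ⟨by simpa, by simpa, by simpa, fun z hz h1 h2 _ => (hT.edge z hz h1 h2).2.2.1, .inr ?_⟩
    (fun m hm t hf ht => ?_) fun t hf ht => ?_
  · exact (hT.bound 1 hN1 hsink).trans_le ((card_filter_le _ _).trans (by simp))
  · obtain ⟨h1, h2, h3, h4, h5⟩ := ht
    have hp := hf.arr .par (by decide)
    simp at hp
    simp only [ensures_ifThen, ensures_seq, ensures_assign, ensures_write]
    simp [hp]
    refine ⟨fun hy => ?_, fun hy => ⟨h1, h2, h3, h4, .inl hy⟩⟩
    generalize t.reg .y = y at *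
    obtain ⟨e1, e2, e3, e4⟩ := hT.edge y h1 h2 hy.ne'
    have hpos := h4 y h1 h2 hy.ne' le_rfl
    generalize s.arr .par y 0 = x at *
    have hxy : x ≠ y := by rintro rfl; omega
    -- The two successive writes do not interfere because `x ≠ y`.
    have hpush : ∀ u v, (if u = y ∧ v = x then (if y = x ∧ x = y then t.arr .res x y - 1 else
        t.arr .res y x) + 1 else if u = x ∧ v = y then t.arr .res x y - 1 else t.arr .res u v) =
        push (t.arr .res) x y u v := by
      intro u v
      simp [push, hxy]
    refine ⟨e1, e2, ?_, fun z hz hpz hz0 hrank => ?_, .inr ?_⟩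
    · convert h3.push e1 h1 hxy hpos using 1
      funext u v
      simp [hpush]
    · rw [hpush, push]
      have := h4 z hz hpz hz0 (hrank.trans e4.le)
      split_ifs with c1 c2
      · omega
      · rw [c2.2] at hrank
        omega
      · exact this
    · omega
  · obtain ⟨h1, h2, h3, h4, h5⟩ := ht
    obtain h5 | h5 := h5
    · rw [h5] at h3
      exact h3.of_source
    · simp [hN] at h5

/-- If a placement exists, every round must augment: a failed search in round `m < n` would give a
cut showing that the value `m` is at least `n`. So the value equals the number of rounds. -/
theorem ensures_maximumFlow (s : State) {n b β N : ℕ} {lo hi κ : ℕ → ℕ} {cap : ℕ → ℕ → ℕ}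
    (hn : s.reg .n = n) (hN : s.reg .nodes = N) (hres : s.arr .res = cap)
    (hc : IsNetwork n b β N lo hi κ cap) :
    Ensures maximumFlow s fun t => Residual N cap (t.arr .res) (t.reg .flow) 1 ∧
      ∀ a, IsPlacement n b β lo hi a → t.reg .flow = n := by
  have hN1 : 1 < N := by
    have := hc.nodes
    omega
  rw [maximumFlow, ensures_seq, ensures_assign]
  refine Ensures.loop (fun m t => Residual N cap (t.arr .res) (t.reg .flow) 1 ∧
      ∀ a, IsPlacement n b β lo hi a → t.reg .flow = m)
    ⟨by simpa [hres] using residual_zero, by simp⟩ (fun m hm t hf ht => ?_)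
    fun t hf ht => by simpa [hn] using ht
  have hN2 := hf.reg .nodes (by decide)
  simp [hN] at hN2
  simp [hn] at hm
  suffices h : Ensures (reach ;; .ifThen (.not (.eq (.get .par 1 0) (.reg .nodes)))
      (augment ;; .assign .flow (.succ (.reg .flow)))) ((t.setReg .it m).tick 1) fun t =>
      Residual N cap (t.arr .res) (t.reg .flow) 1 ∧
      ∀ a, IsPlacement n b β lo hi a → t.reg .flow = m + 1 by
    simpa only [reach, augment, ensures_seq, ensures_ifThen] using h
  rw [ensures_seq]
  refine (ensures_reach ((t.setReg .it m).tick 1) (by simpa) (by omega)).framed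
    fun u hf' hu => ?_
  have hflow := hf'.reg .flow (by decide)
  have hN3 := hf'.reg .nodes (by decide)
  have hr3 := hf'.arr .res (by decide)
  simp [hN2] at hflow hN3 hr3
  obtain ⟨⟨rank, hT⟩, hcl⟩ := hu
  rw [← hr3, ← hflow] at ht
  simp only [State.tick_arr, State.setReg_arr, ← hr3] at hT hcl
  simp only [ensures_ifThen, ensures_seq, ensures_assign]
  simp [hN3]
  refine ⟨fun hs => ?_, fun hs => ⟨ht.1, fun a ha => ?_⟩⟩
  · refine (ensures_augment _ (by simpa) hN1 (by simpa using ht.1)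
      (by simpa using hT) (by simpa)).framed fun v hf'' hv => ?_
    have hflow' := hf''.reg .flow (by decide)
    simp at hflow'
    rw [hflow']
    exact ⟨hv, fun a ha => by rw [ht.2 a ha]⟩
  · have := hc.le_value ht.1 ha (fun z => u.arr .par z 0 ≠ N) (by
        have := hT.src
        omega) (by simpa using hs) fun x hx y hy h1 h2 => hcl x hx y hy h1 (not_not.1 h2)
    have := ht.2 a ha
    omega

/-! ### The layout -/

/-- Place the vertices into the boxes. -/
def placeVertices : Cmd :=
  .loop .v (.reg .n)
    (.assign .done 0 ;;
     .loop .h (.reg .b)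
       (.ifThen (.and (.eq (.reg .done) 0)
           (.lt 0 (.get .res (.succ (.succ (.reg .h)))
             (.get .ident (.get .start (.reg .v) 0) (.get .finish (.reg .v) 0)))))
         (.write .place (.reg .v) 0 (.reg .h) ;;
          .write .res (.succ (.succ (.reg .h)))
            (.get .ident (.get .start (.reg .v) 0) (.get .finish (.reg .v) 0))
            (.sub (.get .res (.succ (.succ (.reg .h)))
              (.get .ident (.get .start (.reg .v) 0) (.get .finish (.reg .v) 0))) 1) ;;
          .assign .done 1)))

/-- What remains to be done when the vertices less than `m` have been placed. -/
structure Remaining (n b β N : ℕ) (lo hi κ : ℕ → ℕ) (m : ℕ) (res : ℕ → ℕ → ℕ) (a : ℕ → ℕ) :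
    Prop where
  sum_class : ∀ y, 2 + b ≤ y → y < N →
    ∑ h ∈ range b, res (h + 2) y = #{u ∈ range n | m ≤ u ∧ κ u = y}
  sum_box : ∀ h < b, #{u ∈ range m | a u = h} + ∑ y ∈ Ico (2 + b) N, res (h + 2) y ≤ β
  mem_of_pos : ∀ v < n, ∀ h < b, 0 < res (h + 2) (κ v) → lo v ≤ h ∧ h ≤ hi v
  placed : ∀ u < m, a u < b ∧ lo u ≤ a u ∧ a u ≤ hi u

/-- One unit of flow is exchanged for one placed vertex, so the supply of the class and the load of
the box remain balanced. -/
theorem Remaining.step {n b β N : ℕ} {lo hi κ : ℕ → ℕ} {m : ℕ} {res res' : ℕ → ℕ → ℕ}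
    {a a' : ℕ → ℕ} (h : Remaining n b β N lo hi κ m res a) (hm : m < n) (hκ : 2 + b ≤ κ m)
    (hκN : κ m < N) {i : ℕ} (hib : i < b) (hpos : 0 < res (i + 2) (κ m))
    (hres : ∀ x y, res x y = res' x y + if x = i + 2 ∧ y = κ m then 1 else 0)
    (ham : a' m = i) (ha : ∀ u < m, a' u = a u) :
    Remaining n b β N lo hi κ (m + 1) res' a' := by
  refine ⟨fun y hy hyN => ?_, fun j hj => ?_, fun v hv j hj hp => ?_, fun u hu => ?_⟩
  · have h1 := h.sum_class y hy hyN
    have h2 : #{u ∈ range n | m ≤ u ∧ κ u = y} =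
        #{u ∈ range n | m + 1 ≤ u ∧ κ u = y} + if y = κ m then 1 else 0 := by
      by_cases hym : y = κ m
      · subst hym
        rw [if_pos rfl, ← card_insert_of_notMem (a := m) (by simp)]
        congr 1
        ext u
        simp only [mem_insert, mem_filter, mem_range]
        grind
      · rw [if_neg hym, add_zero]
        congr 1
        refine filter_congr fun u _ => ?_
        grind
    simp only [hres, sum_add_distrib, Nat.add_right_cancel_iff] at h1
    rw [h2] at h1
    by_cases hym : y = κ m
    · simpa [hym, hib] using h1
    · simpa [hym] using h1
  · have h1 := h.sum_box j hj
    have h2 : #{u ∈ range (m + 1) | a' u = j} =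
        #{u ∈ range m | a u = j} + if j = i then 1 else 0 := by
      rw [range_add_one, filter_insert, ham, filter_congr (q := fun u => a u = j)
        fun u hu => by rw [ha u (mem_range.1 hu)]]
      by_cases hij : i = j
      · simp [hij]
      · simp [hij, Ne.symm hij]
    simp only [hres, sum_add_distrib, Nat.add_right_cancel_iff] at h1
    rw [h2]
    by_cases hij : j = i
    · simp [hij, hκ, hκN] at h1 ⊢
      omega
    · simpa [hij] using h1
  · refine h.mem_of_pos v hv j hj ?_
    rw [hres]
    omega
  · obtain hu | rfl : u < m ∨ u = m := by omega
    · rw [ha u hu]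
      exact h.placed u hu
    · rw [ham]
      exact ⟨hib, h.mem_of_pos u hm i hib hpos⟩

theorem ensures_placeVertices (s : State) {n b β N : ℕ} {lo hi κ : ℕ → ℕ} (hn : s.reg .n = n)
    (hb : s.reg .b = b) (hκ : ∀ v, s.arr .ident (s.arr .start v 0) (s.arr .finish v 0) = κ v)
    (hκb : ∀ v < n, 2 + b ≤ κ v ∧ κ v < N)
    (hR : Remaining n b β N lo hi κ 0 (s.arr .res) fun v => s.arr .place v 0) :
    Ensures placeVertices s fun t => IsPlacement n b β lo hi fun v => t.arr .place v 0 := by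
  refine Ensures.loop (fun m t => Remaining n b β N lo hi κ m (t.arr .res)
    fun v => t.arr .place v 0) hR (fun m hm t hf ht => ?_) fun t hf ht => ?_
  · have hb1 := hf.reg .b (by decide)
    have hid1 := hf.arr .ident (by decide)
    have hs1 := hf.arr .start (by decide)
    have hf1 := hf.arr .finish (by decide)
    simp [hb] at hb1
    simp [hn] at hm
    rw [ensures_seq, ensures_assign]
    refine Ensures.loop (fun h u => (∀ v < m, u.arr .place v 0 = t.arr .place v 0) ∧
      ((u.reg .done = 0 ∧ u.arr .res = t.arr .res ∧ ∀ i < h, t.arr .res (i + 2) (κ m) = 0) ∨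
      (u.reg .done = 1 ∧ u.arr .place m 0 < b ∧ 0 < t.arr .res (u.arr .place m 0 + 2) (κ m) ∧
        ∀ x y, t.arr .res x y =
          u.arr .res x y + if x = u.arr .place m 0 + 2 ∧ y = κ m then 1 else 0)))
      ⟨fun _ _ => rfl, .inl ⟨by simp, rfl, by simp⟩⟩ (fun h hh u hf' hu => ?_) fun u hf' hu => ?_
    · have hv2 := hf'.reg .v (by decide)
      have hid2 := hf'.arr .ident (by decide)
      have hs2 := hf'.arr .start (by decide)
      have hf2 := hf'.arr .finish (by decide)
      simp at hv2
      simp [hid1, hs1, hf1] at hid2 hs2 hf2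
      simp [hb1] at hh
      obtain ⟨h1, ⟨h2, h3, h4⟩ | ⟨h2, h3, h4, h5⟩⟩ := hu
      · simp only [ensures_ifThen, ensures_seq, ensures_assign, ensures_write]
        simp [h2, h3, hv2, hid2, hs2, hf2, hκ]
        refine ⟨fun hpos => ⟨by grind, hh, hpos, fun x y => ?_⟩,
          fun h0 => ⟨h1, fun i hi => ?_⟩⟩
        · split_ifs with hxy
          · rw [hxy.1, hxy.2]
            omega
          · rfl
        · obtain hi | rfl : i < h ∨ i = h := by omega
          exacts [h4 i hi, h0]
      · rw [ensures_ifThen]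
        simp [h2]
        exact ⟨h1, h3, h4, h5⟩
    · simp [hb1] at hu
      obtain ⟨h1, ⟨h2, h3, h4⟩ | ⟨h2, h3, h4, h5⟩⟩ := hu
      -- A box is always found: the class of `m` still contains the unplaced vertex `m`, so some
      -- flow from it is left.
      · have := ht.sum_class (κ m) (hκb m hm).1 (hκb m hm).2
        rw [sum_eq_zero fun i hi => h4 i (mem_range.1 hi), eq_comm, card_eq_zero,
          filter_eq_empty_iff] at this
        exact absurd ⟨le_rfl, rfl⟩ (this (mem_range.2 hm))
      · exact ht.step hm (hκb m hm).1 (hκb m hm).2 h3 h4 h5 rfl h1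
  · simp [hn] at ht
    exact ⟨fun v hv => (ht.placed v hv).1, fun v hv => (ht.placed v hv).2,
      fun h hh => (Nat.le_add_right _ _).trans (ht.sum_box h hh)⟩

/-! ### From boxes to labels -/

/-- The vertices before `v` if they are ordered box after box. -/
def before (n : ℕ) (a : ℕ → ℕ) (h v : ℕ) : Finset ℕ :=
  {u ∈ range n | a u < h ∨ a u = h ∧ u < v}

/-- Label the vertices box after box. -/
def labelVertices : Cmd :=
  .assign .count 0 ;;
  .loop .h (.reg .b)
    (.loop .v (.reg .n)
      (.ifThen (.eq (.get .place (.reg .v) 0) (.reg .h))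
        (.assign .count (.succ (.reg .count)) ;; .write .label (.reg .v) 0 (.reg .count))))

theorem card_before_succ {n : ℕ} {a : ℕ → ℕ} {h v : ℕ} (hv : v < n) :
    #(before n a h (v + 1)) = #(before n a h v) + if a v = h then 1 else 0 := by
  split_ifs with hav
  · rw [← card_insert_of_notMem (a := v) (by simp [before, hav])]
    congr 1
    ext u
    simp only [before, mem_insert, mem_filter, mem_range]
    grind
  · rw [add_zero]
    congr 1
    ext u
    simp only [before, mem_filter, mem_range]
    grind

theorem ensures_labelVertices (s : State) {n b : ℕ} {a : ℕ → ℕ} (hn : s.reg .n = n)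
    (hb : s.reg .b = b) (ha : ∀ v, s.arr .place v 0 = a v) (hab : ∀ v < n, a v < b) :
    Ensures labelVertices s fun t => ∀ v < n, t.arr .label v 0 = #(before n a (a v) v) + 1 := by
  rw [labelVertices, ensures_seq, ensures_assign]
  refine Ensures.loop (fun h t => t.reg .count = #(before n a h 0) ∧
    ∀ v < n, a v < h → t.arr .label v 0 = #(before n a (a v) v) + 1) (by simp [before])
    (fun h hh t hf ht => ?_) fun t hf ht v hv => ht.2 v hv (by simpa [hb] using hab v hv)
  have hn1 := hf.reg .n (by decide)
  have ha1 := hf.arr .place (by decide)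
  simp [hn] at hn1 ha1
  refine Ensures.loop (fun v t => t.reg .count = #(before n a h v) ∧
    ∀ u < n, a u < h ∨ a u = h ∧ u < v → t.arr .label u 0 = #(before n a (a u) u) + 1)
    (by simpa using ht) (fun v hv u hf' hu => ?_) fun u hf' hu => ?_
  · have hh2 := hf'.reg .h (by decide)
    have ha2 := hf'.arr .place (by decide)
    simp at hh2
    simp [hn1] at hv
    simp [ha1] at ha2
    simp only [ensures_ifThen, ensures_seq, ensures_assign, ensures_write]
    simp [hh2, ha2, ha, hu.1, card_before_succ hv]
    refine ⟨fun hav => ⟨by simp [hav], fun w hw hwv => ?_⟩, fun hav => ⟨hav, fun w hw hwv => ?_⟩⟩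
    · split_ifs with hwv'
      · rw [hwv', hav]
      · exact hu.2 w hw (by omega)
    · refine hu.2 w hw ?_
      obtain h1 | h1 := hwv
      · exact .inl h1
      · obtain h2 | rfl : w < v ∨ w = v := by omega
        · exact .inr ⟨h1.1, h2⟩
        · exact absurd h1.1 hav
  · simp [hn1] at hu
    refine ⟨?_, fun v hv hav => hu.2 v hv (by omega)⟩
    rw [hu.1]
    congr 1
    ext w
    simp only [before, mem_filter, mem_range]
    omega

theorem ensures_convert (s : State) {n b β N : ℕ} {lo hi κ : ℕ → ℕ} {cap : ℕ → ℕ → ℕ}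
    (hn : s.reg .n = n) (hb : s.reg .b = b)
    (hκ : ∀ v, s.arr .ident (s.arr .start v 0) (s.arr .finish v 0) = κ v)
    (hc : IsNetwork n b β N lo hi κ cap) (hR : Residual N cap (s.arr .res) n 1) :
    Ensures convert s fun t => ∃ a, IsPlacement n b β lo hi a ∧
      ∀ v < n, t.arr .label v 0 = #(before n a (a v) v) + 1 := by
  suffices h : Ensures (placeVertices ;; labelVertices) s fun t =>
      ∃ a, IsPlacement n b β lo hi a ∧ ∀ v < n, t.arr .label v 0 = #(before n a (a v) v) + 1 by
    simpa only [convert, placeVertices, labelVertices, ensures_seq] using h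
  rw [ensures_seq]
  refine (ensures_placeVertices s (β := β) (N := N) hn hb hκ
    (fun v hv => ⟨hc.le_class v hv, hc.class_lt v hv⟩)
    ⟨fun y hy hyN => ?_, fun h hh => ?_, fun v hv h hh hp => hc.mem_of_pos hR hv hh hp,
      by simp⟩).framed fun t hf ht => ?_
  · simpa using hc.sum_class hR hy hyN
  · simpa using hc.sum_box_le hR hh
  · refine (ensures_labelVertices t (a := fun v => t.arr .place v 0) ?_ ?_ (fun _ => rfl)
      ht.lt).mono fun u hu => ⟨_, ht, hu⟩
    · rw [hf.reg .n (by decide), hn]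
    · rw [hf.reg .b (by decide), hb]

/-! ### The test of a box size -/

/-- `q` places the roots and `a` places the vertices into `b` boxes of size `β`, as the distances
from the roots require. -/
structure IsLayout (n k β b : ℕ) (dist : ℕ → ℕ → ℕ) (q a : ℕ → ℕ) : Prop where
  root_lt : ∀ i < k, q i < b
  lt : ∀ v < n, a v < b
  window : ∀ v < n, ∀ i < k, InWindow (dist i v) (q i) (a v)
  card_le : ∀ h < b, #{v ∈ range n | a v = h} ≤ β

theorem IsLayout.congr {n k β b : ℕ} {dist : ℕ → ℕ → ℕ} {q q' a : ℕ → ℕ}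
    (h : IsLayout n k β b dist q a) (hq : ∀ i < k, q' i = q i) :
    IsLayout n k β b dist q' a :=
  ⟨fun i hi => by rw [hq i hi]; exact h.root_lt i hi, h.lt,
    fun v hv i hi => by rw [hq i hi]; exact h.window v hv i hi, h.card_le⟩

/-- The part of `testBoxSize` that treats one placement of the roots. -/
def testPlacement : Cmd :=
  intervals ;; network ;; maximumFlow ;;
  .ifThen (.eq (.reg .flow) (.reg .n)) (convert ;; .assign .found 1)

/-- A failed test leaves `label` untouched. The binary search relies on this: the labeling in memory
always belongs to the last accepted size. -/
theorem ensures_testPlacement (s : State) {n k β b : ℕ} (hn : s.reg .n = n) (hk : s.reg .k = k)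
    (hβ : s.reg .box = β) (hb : s.reg .b = b) (hb0 : 0 < b)
    (hp : ∀ i < k, s.arr .pos i 0 < b) (hfound : s.reg .found = 0) :
    Ensures testPlacement s fun t =>
      (t.reg .found = 0 ∧ t.arr .label = s.arr .label ∧
        ∀ a, ¬ IsLayout n k β b (s.arr .dist) (fun i => s.arr .pos i 0) a) ∨
      (t.reg .found = 1 ∧ ∃ a, IsLayout n k β b (s.arr .dist) (fun i => s.arr .pos i 0) a ∧
        ∀ v < n, t.arr .label v 0 = #(before n a (a v) v) + 1) := by
  simp only [testPlacement, ensures_seq]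
  refine (ensures_intervals s hn hk hb hb0 hp).framed fun t hf ht => ?_
  have hn1 := hf.reg .n (by decide)
  have hb1 := hf.reg .b (by decide)
  have hβ1 := hf.reg .box (by decide)
  have hfound1 := hf.reg .found (by decide)
  have hl1 := hf.arr .label (by decide)
  rw [hn] at hn1
  rw [hb] at hb1
  rw [hβ] at hβ1
  rw [hfound] at hfound1
  refine (ensures_network t hn1 hb1 hβ1 fun v hv => ⟨(ht v hv).1, (ht v hv).2.1⟩).framed
    fun u hf' ⟨hu1, _, hu2⟩ => ?_
  have hn2 := hf'.reg .n (by decide)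
  have hb2 := hf'.reg .b (by decide)
  have hfound2 := hf'.reg .found (by decide)
  have hl2 := hf'.arr .label (by decide)
  have hs2 := hf'.arr .start (by decide)
  have hf2 := hf'.arr .finish (by decide)
  rw [hn1] at hn2
  rw [hb1] at hb2
  rw [hfound1] at hfound2
  rw [hl1] at hl2
  refine (ensures_maximumFlow u hn2 hu1 rfl hu2).framed fun w hf3 ⟨hR, hw⟩ => ?_
  have hn3 := hf3.reg .n (by decide)
  have hb3 := hf3.reg .b (by decide)
  have hfound3 := hf3.reg .found (by decide)
  have hl3 := hf3.arr .label (by decide)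
  have hs3 := hf3.arr .start (by decide)
  have hff3 := hf3.arr .finish (by decide)
  have hid3 := hf3.arr .ident (by decide)
  rw [hn2] at hn3
  rw [hb2] at hb3
  rw [hfound2] at hfound3
  rw [hl2] at hl3
  -- For fixed boxes of the roots, lying in the computed interval is the same as obeying all
  -- windows.
  have hiff : ∀ a, IsPlacement n b β (fun v => t.arr .start v 0) (fun v => t.arr .finish v 0) a ↔
      IsLayout n k β b (s.arr .dist) (fun i => s.arr .pos i 0) a := by
    refine fun a => ⟨fun ha => ⟨hp, ha.lt, fun v hv => ?_, ha.card_le⟩,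
      fun ha => ⟨ha.lt, fun v hv => ?_, ha.card_le⟩⟩
    · exact ((ht v hv).2.2 _ (ha.lt v hv)).1 (ha.mem v hv)
    · exact ((ht v hv).2.2 _ (ha.lt v hv)).2 (ha.window v hv)
  simp only [ensures_ifThen, ensures_seq, ensures_assign]
  simp [hn3]
  refine ⟨fun hflow => ?_, fun hflow => .inl ⟨hfound3, hl3, fun a ha =>
    hflow (hw a ((hiff a).2 ha))⟩⟩
  rw [hflow] at hR
  refine (ensures_convert _ (by simpa) (by simpa) (fun v => ?_) hu2 (by simpa using hR)).framed
    fun x hf4 ⟨a, ha, hx⟩ => ⟨a, (hiff a).1 ha, hx⟩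
  simp [hid3, hs3, hff3, hs2, hf2]

theorem ensures_testBoxSize (s : State) {n k β : ℕ} (hn : s.reg .n = n) (hn0 : 0 < n)
    (hk : s.reg .k = k) (hβ : s.reg .box = β) (hβ0 : 0 < β) :
    Ensures testBoxSize s fun t =>
      (t.reg .found = 0 ∧ t.arr .label = s.arr .label ∧
        ∃ b, n ≤ b * β ∧ (∀ d, n ≤ d * β → b ≤ d) ∧ ∀ q a, ¬ IsLayout n k β b (s.arr .dist) q a) ∨
      (t.reg .found = 1 ∧ ∃ b q a, IsLayout n k β b (s.arr .dist) q a ∧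
        ∀ v < n, t.arr .label v 0 = #(before n a (a v) v) + 1) := by
  simp only [testBoxSize, ensures_seq, ensures_assign]
  refine (ensures_prepareBoxes s hn hk hβ).framed fun t hf ⟨ht1, ht2, ht3, ht4, _⟩ => ?_
  obtain ⟨b, hb⟩ : ∃ b, t.reg .b = b := ⟨_, rfl⟩
  rw [hb] at ht1 ht2 ht3
  have hnb := ht2 hβ0
  have hb0 : 0 < b := Nat.pos_of_ne_zero (by rintro rfl; omega)
  have hn1 := hf.reg .n (by decide)
  have hk1 := hf.reg .k (by decide)
  have hβ1 := hf.reg .box (by decide)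
  have hl1 := hf.arr .label (by decide)
  have hd1 := hf.arr .dist (by decide)
  rw [hn] at hn1
  rw [hk] at hk1
  rw [hβ] at hβ1
  -- The counter `pos` runs on after a success, so its value is known in every round; a successful
  -- labeling is no longer touched.
  refine Ensures.loop (fun p u => (∀ i < k, u.arr .pos i 0 = p / b ^ i % b) ∧
    ((u.reg .found = 0 ∧ u.arr .label = s.arr .label ∧
        ∀ p' < p, ∀ a, ¬ IsLayout n k β b (s.arr .dist) (fun i => p' / b ^ i % b) a) ∨
      (u.reg .found = 1 ∧ ∃ b q a, IsLayout n k β b (s.arr .dist) q a ∧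
        ∀ v < n, u.arr .label v 0 = #(before n a (a v) v) + 1)))
    ⟨by simpa using ht4, .inl ⟨by simp, hl1, by simp⟩⟩ (fun p hp u hf' ⟨hu1, hu2⟩ => ?_)
    fun u hf' ⟨hu1, hu2⟩ => ?_
  · have hn2 := hf'.reg .n (by decide)
    have hk2 := hf'.reg .k (by decide)
    have hβ2 := hf'.reg .box (by decide)
    have hb2 := hf'.reg .b (by decide)
    have hd2 := hf'.arr .dist (by decide)
    simp [hn1, hk1, hβ1, hb] at hn2 hk2 hβ2 hb2
    simp only [State.tick_arr, State.setReg_arr, hd1] at hd2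
    rw [ensures_seq]
    suffices h : Ensures (.ifThen (.eq (.reg .found) 0) testPlacement) ((u.setReg .p p).tick 1)
        fun w => (w.reg .found = 0 ∧ w.arr .label = s.arr .label ∧
          ∀ p' < p + 1, ∀ a, ¬ IsLayout n k β b (s.arr .dist) (fun i => p' / b ^ i % b) a) ∨
        (w.reg .found = 1 ∧ ∃ b q a, IsLayout n k β b (s.arr .dist) q a ∧
          ∀ v < n, w.arr .label v 0 = #(before n a (a v) v) + 1) by
      refine Ensures.framed h fun w hf3 hw => ?_
      have hk3 := hf3.reg .k (by decide)
      have hb3 := hf3.reg .b (by decide)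
      have hp3 := hf3.arr .pos (by decide)
      simp [hk2, hb2] at hk3 hb3
      simp at hp3
      refine (ensures_nextPlacement w hk3 hb3 hb0 (p := p) fun i hi => ?_).framed
        fun x hf4 hx => ⟨hx, ?_⟩
      · rw [hp3, hu1 i hi]
      · rw [hf4.reg .found (by decide), hf4.arr .label (by decide)]
        exact hw
    rw [ensures_ifThen]
    simp
    obtain ⟨hu2, hu3, hu4⟩ | ⟨hu2, hu3⟩ := hu2
    · simp only [hu2, true_implies, not_true_eq_false, false_implies, and_true]
      refine (ensures_testPlacement _ (n := n) (k := k) (β := β) (b := b) (by simpa) (by simpa)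
        (by simpa) (by simpa) hb0 (fun i hi => ?_) (by simpa)).mono fun w hw => ?_
      · simp [hu1 i hi, Nat.mod_lt _ hb0]
      · simp only [State.tick_arr, State.setReg_arr, hd2, hu3] at hw
        refine hw.imp (fun ⟨h1, h2, h3⟩ => ⟨h1, h2, fun p' hp' a ha => ?_⟩)
          fun ⟨h1, a, h2, h3⟩ => ⟨h1, b, _, a, h2, h3⟩
        obtain hp' | rfl : p' < p ∨ p' = p := by omega
        · exact hu4 p' hp' a ha
        · exact h3 a (ha.congr hu1)
    · simp only [hu2, one_ne_zero, false_implies, true_and, not_false_eq_true, true_implies]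
      exact .inr hu3
  · simp [ht3] at hu2
    refine hu2.imp (fun ⟨h1, h2, h3⟩ => ⟨h1, h2, b, hnb, ht1, fun q a ha => ?_⟩) fun h => h
    obtain ⟨p, hp, hpq⟩ := exists_placement q k ha.root_lt
    exact h3 p hp a (ha.congr hpq)

/-! ### The binary search -/

/-- Acceptance need not be monotone; it is only known that every size from `τ` on is accepted. A
rejected size is therefore below `τ`, which keeps `lo ≤ τ`. -/
theorem ensures_binarySearch (s : State) {n k μ τ : ℕ} (hn : s.reg .n = n) (hn0 : 0 < n)
    (hk : s.reg .k = k) (hlg : s.reg .lg = Nat.log 2 n) (hμ : s.reg .mindeg = μ) (hμ0 : 0 < μ)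
    (hμτ : μ ≤ τ) (hτ : τ ≤ max μ (n - n / 2))
    (hacc : ∀ β, τ ≤ β → ∀ b, n ≤ b * β → (∀ d, n ≤ d * β → b ≤ d) →
      ∃ q a, IsLayout n k β b (s.arr .dist) q a) :
    Ensures binarySearch s fun t => ∃ β ≤ τ, ∃ b q a, IsLayout n k β b (s.arr .dist) q a ∧
      ∀ v < n, t.arr .label v 0 = #(before n a (a v) v) + 1 := by
  simp only [binarySearch, ensures_seq, ensures_assign]
  suffices h : ∀ t, t.reg .lo = μ → t.reg .hi = max μ (n - n / 2) →
      t.reg .n = n → t.reg .k = k → t.reg .lg = Nat.log 2 n → t.arr .dist = s.arr .dist →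
      Ensures (.assign .hi (.succ (.reg .hi))) t fun t =>
      Ensures (.loop .t (.succ (.succ (.reg .lg)))
        (.ifThen (.lt (.reg .lo) (.reg .hi))
          (.assign .gap (.half (.sub (.reg .hi) (.reg .lo))) ;; .assign .box (.reg .lo) ;;
           .loop .i (.reg .gap) (.assign .box (.succ (.reg .box))) ;;
           testBoxSize ;;
           .ifElse (.eq (.reg .found) 1) (.assign .hi (.reg .box))
            (.assign .lo (.succ (.reg .box)))))) t fun t =>
        ∃ β ≤ τ, ∃ b q a, IsLayout n k β b (s.arr .dist) q a ∧
          ∀ v < n, t.arr .label v 0 = #(before n a (a v) v) + 1 by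
    simp only [ensures_ifThen, ensures_assign] at h ⊢
    refine ⟨fun h' => h _ ?_ ?_ ?_ ?_ ?_ ?_, fun h' => h _ ?_ ?_ ?_ ?_ ?_ ?_⟩ <;>
      simp [hn, hk, hlg, hμ] at h' ⊢ <;> omega
  intro t htlo hthi htn htk htlg htd
  rw [ensures_assign]
  -- The gap is halved in every round, so that `log n + 2` rounds exhaust it. The upper end is
  -- either its initial value or an accepted size whose labeling is in memory.
  refine Ensures.loop (fun m u => μ ≤ u.reg .lo ∧ u.reg .lo ≤ τ ∧
    (u.reg .hi - u.reg .lo) * 2 ^ m < 2 ^ (Nat.log 2 n + 2) ∧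
    (u.reg .hi = max μ (n - n / 2) + 1 ∨
      ∃ b q a, IsLayout n k (u.reg .hi) b (s.arr .dist) q a ∧
        ∀ v < n, u.arr .label v 0 = #(before n a (a v) v) + 1))
    ⟨by simp [htlo], by simp [htlo, hμτ], ?_, .inl (by simp [hthi])⟩
    (fun m hm u hf hu => ?_) fun u hf hu => ?_
  · have := Nat.lt_pow_succ_log_self one_lt_two n
    simp [htlo, hthi]
    rw [pow_succ]
    omega
  · have hn1 := hf.reg .n (by decide)
    have hk1 := hf.reg .k (by decide)
    have hd1 := hf.arr .dist (by decide)
    simp [htn, htk] at hn1 hk1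
    simp only [State.tick_arr, State.setReg_arr, htd] at hd1
    obtain ⟨h1, h2, h3, h4⟩ := hu
    rw [ensures_ifThen]
    simp only [ensures_seq, ensures_assign]
    simp
    refine ⟨fun hlt => ?_, fun hle => ⟨h1, h2, ?_, h4⟩⟩
    · refine Ensures.loop (fun m v => v.reg .box = u.reg .lo + m) (by simp)
        (fun m _ v _ hv => by simp [hv, add_assoc]) fun v hf' hv => ?_
      have hn2 := hf'.reg .n (by decide)
      have hk2 := hf'.reg .k (by decide)
      have hlo2 := hf'.reg .lo (by decide)
      have hhi2 := hf'.reg .hi (by decide)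
      have hd2 := hf'.arr .dist (by decide)
      have hl2 := hf'.arr .label (by decide)
      simp [hn1, hk1] at hv hn2 hk2 hlo2 hhi2
      simp only [State.tick_arr, State.setReg_arr, hd1] at hd2 hl2
      refine (ensures_testBoxSize v hn2 hn0 hk2 hv (by omega)).framed fun w hf3 hw => ?_
      have hlo3 := hf3.reg .lo (by decide)
      have hhi3 := hf3.reg .hi (by decide)
      have hbox3 := hf3.reg .box (by decide)
      rw [hlo2] at hlo3
      rw [hhi2] at hhi3
      rw [hv] at hbox3
      rw [hd2, hl2] at hw
      have hhalf : (u.reg .hi - u.reg .lo) / 2 * 2 ^ (m + 1) < 2 ^ (Nat.log 2 n + 2) := by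
        refine lt_of_le_of_lt ?_ h3
        rw [pow_succ', ← mul_assoc]
        exact Nat.mul_le_mul_right _ (Nat.div_mul_le_self _ _)
      obtain ⟨hw1, hw2, b, hw3, hw4, hw5⟩ | ⟨hw1, hw2⟩ := hw
      · simp [hw1, hlo3, hhi3, hbox3, hw2]
        refine ⟨by omega, ?_, ?_, h4⟩
        · by_contra! hcon
          obtain ⟨q, a, ha⟩ := hacc _ (show τ ≤ u.reg .lo + (u.reg .hi - u.reg .lo) / 2 by omega)
            b hw3 hw4
          exact hw5 q a ha
        · refine lt_of_le_of_lt (Nat.mul_le_mul_right _ ?_) hhalf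
          omega
      · simp [hw1, hlo3, hbox3]
        exact ⟨h1, h2, hhalf, .inr hw2⟩
    · rw [Nat.sub_eq_zero_of_le hle]
      simp
  · obtain ⟨h1, h2, h3, h4⟩ := hu
    simp [htlg] at h3
    have hle : u.reg .hi ≤ u.reg .lo := by
      by_contra! h
      have := Nat.mul_le_mul_right (2 ^ (Nat.log 2 n + 1 + 1)) (Nat.sub_pos_of_lt h)
      omega
    -- The initial upper end exceeds `τ`, whereas now `hi ≤ lo ≤ τ`; so some size has been accepted.
    obtain ⟨b, q, a, h⟩ := h4.resolve_left (by omega)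
    exact ⟨_, hle.trans h2, b, q, a, h⟩

/-! ### The resources -/

/-- The constant is generous: here and in the following cost bounds, the difference of the two sides
expands to a polynomial in the registers with nonnegative coefficients, which `positivity`
recognizes. -/
theorem cost_search (s : State) :
    search.cost s ≤ 1000 * ((s.reg .n + 1) ^ 2 * (s.reg .k + 1)) := by
  simp only [search, Cmd.ifThen, Cmd.cost, Expr.cost, Cond.cost, Expr.eval_reg, Expr.eval_three]
  zify
  rw [← sub_nonneg]
  ring_nf
  positivity

theorem cost_minimumDegree (s : State) :
    minimumDegree.cost s ≤ 1000 * (s.reg .n + 1) ^ 2 := by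
  simp only [minimumDegree, Cmd.ifThen, Cmd.cost, Expr.cost, Cond.cost, Expr.eval_reg]
  zify
  rw [← sub_nonneg]
  ring_nf
  positivity

theorem cost_chooseRoots (s : State) : chooseRoots.cost s ≤ 1000 * (s.reg .k + 1) := by
  simp only [chooseRoots, Cmd.cost, Expr.cost, Expr.eval_reg]
  zify
  rw [← sub_nonneg]
  ring_nf
  positivity

theorem cost_intervals (s : State) :
    intervals.cost s ≤ 1000 * ((s.reg .n + 1) * (s.reg .k + 1)) := by
  simp only [intervals, Cmd.ifThen, Cmd.cost, Expr.cost, Cond.cost, Expr.eval_reg]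
  zify
  rw [← sub_nonneg]
  ring_nf
  positivity

theorem cost_countClasses (s : State) :
    countClasses.cost s ≤ 1000 * ((s.reg .n + 1) * (s.reg .b + 1) ^ 2) := by
  simp only [countClasses, Cmd.cost, Expr.cost, Expr.eval_reg]
  zify
  rw [← sub_nonneg]
  ring_nf
  positivity

theorem cost_numberNodes (s : State) :
    numberNodes.cost s ≤ 1000 * (s.reg .b + 1) ^ 2 := by
  simp only [numberNodes, Cmd.cost, Expr.cost, Expr.eval_reg]
  zify
  rw [← sub_nonneg]
  ring_nf
  positivity

theorem cost_fillClasses (s : State) :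
    fillClasses.cost s ≤ 1000 * ((s.reg .nodes + 1) ^ 3 + (s.reg .b + 1) ^ 3) := by
  simp only [fillClasses, Cmd.ifThen, Cmd.cost, Expr.cost, Cond.cost, Expr.eval_reg]
  zify
  rw [← sub_nonneg]
  ring_nf
  positivity

theorem cost_maximumFlow (s : State) :
    maximumFlow.cost s ≤ 1000 * ((s.reg .n + 1) * (s.reg .nodes + 1) ^ 3) := by
  simp only [maximumFlow, Cmd.ifThen, Cmd.cost, Expr.cost, Cond.cost, Expr.eval_reg]
  zify
  rw [← sub_nonneg]
  ring_nf
  positivity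

theorem cost_convert (s : State) :
    convert.cost s ≤ 1000 * ((s.reg .n + 1) * (s.reg .b + 1)) := by
  simp only [convert, Cmd.ifThen, Cmd.cost, Expr.cost, Cond.cost, Expr.eval_reg]
  zify
  rw [← sub_nonneg]
  ring_nf
  positivity

theorem cost_nextPlacement (s : State) : nextPlacement.cost s ≤ 1000 * (s.reg .k + 1) := by
  simp only [nextPlacement, Cmd.ifThen, Cmd.cost, Expr.cost, Cond.cost, Expr.eval_reg]
  zify
  rw [← sub_nonneg]
  ring_nf
  positivity

/-- The later loops run `lg` and `ll + 1` times, numbers computed on the way, so the cost bound is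
applied phase by phase, with `ll ≤ lg ≤ n`. -/
theorem ensures_sampleSize_time (s : State) : Ensures sampleSize s fun t =>
    t.time ≤ s.time + 100 * ((s.reg .n + 1) * (s.reg .c + 1)) := by
  simp only [sampleSize, ensures_seq, ensures_assign]
  refine ((ensures_log .lg _ _ (by decide) (by decide) (by simp) (by simp)).and
    (ensures_time _ _ (by decide))).framed fun t hf ⟨ht, ht'⟩ => ?_
  refine ((ensures_log .ll _ _ (by decide) (by decide) (by simp) (by simp)).and
    (ensures_time _ _ (by decide))).framed fun u hf' ⟨hu, hu'⟩ => ?_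
  refine (ensures_time _ _ (by decide)).framed fun v hf'' hv => ?_
  have h1 : u.reg .c = s.reg .c := by
    rw [hf'.reg .c (by decide)]
    simp [hf.reg .c (by decide)]
  simp at ht hu
  simp [Cmd.ifThen, Cmd.cost, Expr.cost, Cond.cost] at ht' hu' hv
  have h2 := Nat.log_le_self 2 (s.reg .n)
  have h3 := Nat.log_le_self 2 (t.reg .lg)
  rw [← ht] at h2
  rw [← hu] at h3
  rw [h1] at hv
  have h4 : (u.reg .ll + 1) * (2 + s.reg .c * 4 + 1) ≤
      (s.reg .n + 1) * (4 * (s.reg .c + 1)) :=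
    Nat.mul_le_mul (by omega) (by omega)
  have h5 : s.reg .n + 1 ≤ (s.reg .n + 1) * (s.reg .c + 1) := Nat.le_mul_of_pos_right _ (by omega)
  rw [mul_left_comm] at h4
  omega

/-- Bounds for the resources in terms of the number `d` of boxes. -/
theorem ensures_network_resources (s : State) {n b d : ℕ} (hn : s.reg .n = n) (hb : s.reg .b = b)
    (hbd : b ≤ d) :
    Ensures network s fun t => t.reg .nodes = 2 + b + b * b ∧
      t.reg .size ≤ max (s.reg .size) (d ^ 2 + d + 2) ∧
      t.time ≤ s.time + 5000 * ((n + 1) * (d ^ 2 + d + 3) ^ 3) := by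
  suffices h : Ensures (countClasses ;; numberNodes ;;
      .ifThen (.lt (.reg .size) (.reg .nodes)) (.assign .size (.reg .nodes)) ;; fillClasses ;;
      .loop .h (.reg .b) (.write .res (.succ (.succ (.reg .h))) 1 (.reg .box))) s fun t =>
        t.reg .nodes = 2 + b + b * b ∧ t.reg .size ≤ max (s.reg .size) (d ^ 2 + d + 2) ∧
      t.time ≤ s.time + 5000 * ((n + 1) * (d ^ 2 + d + 3) ^ 3) by
    simpa only [network, countClasses, numberNodes, fillClasses, ensures_seq] using h
  simp only [ensures_seq]
  refine (ensures_time countClasses s (by decide)).framed fun t hf ht => ?_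
  have hb1 := hf.reg .b (by decide)
  rw [hb] at hb1
  refine ((ensures_numberNodes t hb1).and (ensures_time numberNodes t (by decide))).framed
    fun u hf' ⟨⟨hu1, _⟩, hu2⟩ => ?_
  have hb2 := hf'.reg .b (by decide)
  rw [hb1] at hb2
  have hsz : u.reg .size = s.reg .size := by
    rw [hf'.reg .size (by decide), hf.reg .size (by decide)]
  have hc1 := cost_countClasses s
  have hc2 := cost_numberNodes t
  rw [hn, hb] at hc1
  rw [hb1] at hc2
  have hbd2 : b * b ≤ d ^ 2 := by
    rw [sq]
    exact Nat.mul_le_mul hbd hbd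
  have hSle : b + 1 ≤ d ^ 2 + d + 3 := by omega
  have hNle : 2 + b + b * b + 1 ≤ d ^ 2 + d + 3 := by omega
  have main : ∀ w : State, w.reg .b = b → w.reg .nodes = 2 + b + b * b →
      w.reg .size ≤ max (s.reg .size) (d ^ 2 + d + 2) → w.time ≤ u.time + 10 →
      Ensures fillClasses w fun t => Ensures (.loop .h (.reg .b)
          (.write .res (.succ (.succ (.reg .h))) 1 (.reg .box))) t fun t =>
        t.reg .nodes = 2 + b + b * b ∧ t.reg .size ≤ max (s.reg .size) (d ^ 2 + d + 2) ∧
        t.time ≤ s.time + 5000 * ((n + 1) * (d ^ 2 + d + 3) ^ 3) := by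
    intro w hbw hNw hsw htw
    refine (ensures_time fillClasses w (by decide)).framed fun x hfx hx => ?_
    refine (ensures_time _ _ (by decide)).framed fun y hfy hy => ?_
    rw [hfy.reg .nodes (by decide), hfy.reg .size (by decide), hfx.reg .nodes (by decide),
      hfx.reg .size (by decide)]
    refine ⟨hNw, hsw, ?_⟩
    have hbx := hfx.reg .b (by decide)
    rw [hbw] at hbx
    simp [Cmd.cost, Expr.cost, hbx] at hy
    have hc3 := cost_fillClasses w
    rw [hNw, hbw] at hc3
    generalize d ^ 2 + d + 3 = S at *
    have hS : 3 ≤ S := by omega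
    have e1 : (n + 1) * (b + 1) ^ 2 ≤ (n + 1) * S ^ 3 :=
      Nat.mul_le_mul_left _ ((Nat.pow_le_pow_left hSle 2).trans
        (Nat.pow_le_pow_right (by omega) (by omega)))
    have e0 : S ^ 3 ≤ (n + 1) * S ^ 3 := Nat.le_mul_of_pos_left _ (by omega)
    have e2 : (b + 1) ^ 2 ≤ S ^ 3 := (Nat.pow_le_pow_left hSle 2).trans
        (Nat.pow_le_pow_right (by omega) (by omega))
    have e3 : (b + 1) ^ 3 ≤ S ^ 3 := Nat.pow_le_pow_left hSle 3
    have e4 : (2 + b + b * b + 1) ^ 3 ≤ S ^ 3 := Nat.pow_le_pow_left hNle 3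
    have e5 : S ≤ S ^ 3 := Nat.le_self_pow (by omega) _
    omega
  simp only [ensures_ifThen, ensures_assign]
  refine ⟨fun h => main _ hb2 hu1 ?_ ?_, fun h => main _ hb2 hu1 ?_ ?_⟩
  · simp [hu1]
    omega
  · simp [Cond.cost, Expr.cost]
  · simp [hsz]
  · simp [Cond.cost, Expr.cost]

theorem ensures_testPlacement_resources (s : State) {n k b d : ℕ} (hn : s.reg .n = n)
    (hk : s.reg .k = k) (hb : s.reg .b = b) (hbd : b ≤ d) :
    Ensures testPlacement s fun t => t.reg .size ≤ max (s.reg .size) (d ^ 2 + d + 2) ∧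
      t.time ≤ s.time + 9000 * ((n + 1) * (k + 1) * (d ^ 2 + d + 3) ^ 3) := by
  simp only [testPlacement, ensures_seq]
  refine (ensures_time intervals s (by decide)).framed fun t hf ht => ?_
  have hn1 := hf.reg .n (by decide)
  have hb1 := hf.reg .b (by decide)
  rw [hn] at hn1
  rw [hb] at hb1
  refine (ensures_network_resources t hn1 hb1 hbd).framed fun u hf' ⟨hu1, hu2, hu3⟩ => ?_
  have hn2 := hf'.reg .n (by decide)
  have hb2 := hf'.reg .b (by decide)
  rw [hn1] at hn2
  rw [hb1] at hb2
  refine (ensures_time maximumFlow u (by decide)).framed fun w hf3 hw => ?_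
  have hn3 := hf3.reg .n (by decide)
  have hb3 := hf3.reg .b (by decide)
  rw [hn2] at hn3
  rw [hb2] at hb3
  have hsize : w.reg .size ≤ max (s.reg .size) (d ^ 2 + d + 2) := by
    rw [hf3.reg .size (by decide)]
    rwa [hf.reg .size (by decide)] at hu2
  have hc1 := cost_intervals s
  have hc2 := cost_maximumFlow u
  rw [hn, hk] at hc1
  rw [hn2, hu1] at hc2
  have hbd2 : b * b ≤ d ^ 2 := by
    rw [sq]
    exact Nat.mul_le_mul hbd hbd
  have hSle : b + 1 ≤ d ^ 2 + d + 3 := by omega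
  have hNle : 2 + b + b * b + 1 ≤ d ^ 2 + d + 3 := by omega
  generalize d ^ 2 + d + 3 = S at *
  have hS : 3 ≤ S := by omega
  have e1 : (n + 1) * (2 + b + b * b + 1) ^ 3 ≤ (n + 1) * S ^ 3 :=
    Nat.mul_le_mul_left _ (Nat.pow_le_pow_left hNle 3)
  have e2 : (n + 1) * S ^ 3 ≤ (n + 1) * (k + 1) * S ^ 3 :=
    Nat.mul_le_mul_right _ (Nat.le_mul_of_pos_right _ (by omega))
  have e3 : (n + 1) * (k + 1) ≤ (n + 1) * (k + 1) * S ^ 3 :=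
    Nat.le_mul_of_pos_right _ (by positivity)
  have e4 : (n + 1) * (b + 1) ≤ (n + 1) * S ^ 3 :=
    Nat.mul_le_mul_left _ (hSle.trans (Nat.le_self_pow (by omega) _))
  have e5 : 1 ≤ (n + 1) * (k + 1) * S ^ 3 := Nat.one_le_iff_ne_zero.2 (by positivity)
  simp only [ensures_ifThen, ensures_seq, ensures_assign]
  refine ⟨fun _ => (ensures_time convert _ (by decide)).framed fun x hf4 hx => ⟨?_, ?_⟩,
    fun _ => ⟨hsize, ?_⟩⟩
  · simpa [hf4.reg .size (by decide)] using hsize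
  · have hc3 := cost_convert (w.tick (Cond.cost (.eq (.reg .flow) (.reg .n)) + 1))
    simp only [State.tick_reg, hn3, hb3] at hc3
    simp [Cond.cost, Expr.cost] at hx hc3 ⊢
    omega
  · simp [Cond.cost, Expr.cost]
    omega

/-- There are `b ^ k` placements and `b ≤ d`. The base `d + 1` also covers the computation of `b ^
k` by counting. -/
theorem ensures_testBoxSize_resources (s : State) {n k β d : ℕ} (hn : s.reg .n = n)
    (hk : s.reg .k = k) (hβ : s.reg .box = β) (hd : n ≤ d * β) :
    Ensures testBoxSize s fun t => t.reg .size ≤ max (s.reg .size) (d ^ 2 + d + 2) ∧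
      t.time ≤ s.time +
        20000 * ((n + 1) * (k + 1) * (d ^ 2 + d + 3) ^ 3 * (d + 1) ^ k) := by
  simp only [testBoxSize, ensures_seq, ensures_assign]
  refine (ensures_prepareBoxes s hn hk hβ).framed fun t hf ⟨ht1, _, ht3, _, ht5⟩ => ?_
  obtain ⟨b, hb⟩ : ∃ b, t.reg .b = b := ⟨_, rfl⟩
  rw [hb] at ht1 ht3 ht5
  have hbd := ht1 d hd
  have hn1 := hf.reg .n (by decide)
  have hk1 := hf.reg .k (by decide)
  rw [hn] at hn1
  rw [hk] at hk1
  have hsize := hf.reg .size (by decide)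
  refine Ensures.loop (fun p u => u.reg .size ≤ max (s.reg .size) (d ^ 2 + d + 2) ∧
    u.time ≤ t.time + 4 + p * (10010 * ((n + 1) * (k + 1) * (d ^ 2 + d + 3) ^ 3)))
    ⟨by simp [hsize], by simp [Expr.cost]⟩ (fun p hp u hf' ⟨hu1, hu2⟩ => ?_)
    fun u hf' ⟨hu1, hu2⟩ => ⟨hu1, ?_⟩
  · have hn2 := hf'.reg .n (by decide)
    have hk2 := hf'.reg .k (by decide)
    have hb2 := hf'.reg .b (by decide)
    simp [hn1, hk1, hb] at hn2 hk2 hb2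
    rw [ensures_seq]
    have e0 : k + 1 ≤ (n + 1) * (k + 1) * (d ^ 2 + d + 3) ^ 3 := by
      rw [mul_assoc, mul_left_comm]
      exact Nat.le_mul_of_pos_right _ (by positivity)
    have h : Ensures (.ifThen (.eq (.reg .found) 0) testPlacement) ((u.setReg .p p).tick 1)
        fun w => w.reg .size ≤ max (s.reg .size) (d ^ 2 + d + 2) ∧
          w.time ≤ u.time + 5 + 9000 * ((n + 1) * (k + 1) * (d ^ 2 + d + 3) ^ 3) := by
      rw [ensures_ifThen]
      refine ⟨fun _ => (ensures_testPlacement_resources _ (n := n) (k := k) (b := b) (by simpa)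
        (by simpa) (by simpa) hbd).mono fun w ⟨hw1, hw2⟩ => ⟨?_, ?_⟩, fun _ => ⟨hu1, ?_⟩⟩
      · simp only [State.tick_reg, State.setReg_reg, Function.update_of_ne, ne_eq, reduceCtorEq,
          not_false_eq_true] at hw1
        omega
      · simp [Cond.cost, Expr.cost] at hw2
        omega
      · simp [Cond.cost, Expr.cost]
    refine Ensures.framed h fun w hf3 ⟨hw1, hw2⟩ => ?_
    have hk3 := hf3.reg .k (by decide)
    simp [hk2] at hk3
    refine (ensures_time nextPlacement w (by decide)).framed fun x hf4 hx => ⟨?_, ?_⟩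
    · rwa [hf4.reg .size (by decide)]
    · have := cost_nextPlacement w
      rw [hk3] at this
      rw [Nat.succ_mul]
      omega
  · simp [ht3] at hu2
    set W := (n + 1) * (k + 1) * (d ^ 2 + d + 3) ^ 3 with hW
    have e1 : b ^ k ≤ (d + 1) ^ k := Nat.pow_le_pow_left (by omega) k
    have e2 : (b + 1) ^ k ≤ (d + 1) ^ k := Nat.pow_le_pow_left (by omega) k
    have e3 : b ^ k * (10010 * W) ≤ (d + 1) ^ k * (10010 * W) := Nat.mul_le_mul_right _ e1
    have e4 : 1 ≤ (d + 1) ^ k := Nat.one_le_pow _ _ (by omega)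
    have e5 : W ≤ W * (d + 1) ^ k := Nat.le_mul_of_pos_right _ e4
    have e6 : n + 1 ≤ W := by
      rw [hW, mul_assoc]
      exact Nat.le_mul_of_pos_right _ (by positivity)
    have e7 : k * (d + 1) ≤ W := by
      have h1 : d + 1 ≤ (d ^ 2 + d + 3) ^ 3 :=
        (show d + 1 ≤ d ^ 2 + d + 3 by omega).trans (Nat.le_self_pow (by omega) _)
      calc k * (d + 1) ≤ (k + 1) * (d ^ 2 + d + 3) ^ 3 := Nat.mul_le_mul (by omega) h1
        _ ≤ (n + 1) * ((k + 1) * (d ^ 2 + d + 3) ^ 3) := Nat.le_mul_of_pos_left _ (by omega)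
        _ = W := by rw [hW]; ring
    have e8 : k * (20 + (b + 1) ^ k * (4 * b + 4)) ≤ 24 * (W * (d + 1) ^ k) := by
      calc k * (20 + (b + 1) ^ k * (4 * b + 4))
          ≤ k * (20 * ((d + 1) * (d + 1) ^ k) + (d + 1) ^ k * (4 * (d + 1))) := by
            refine Nat.mul_le_mul_left _ (Nat.add_le_add ?_ (Nat.mul_le_mul e2 (by omega)))
            have : 1 ≤ (d + 1) * (d + 1) ^ k := Nat.one_le_iff_ne_zero.2 (by positivity)
            omega
        _ = 24 * (k * (d + 1) * (d + 1) ^ k) := by ring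
        _ ≤ _ := Nat.mul_le_mul_left _ (Nat.mul_le_mul_right _ e7)
    have e9 : (d + 1) ^ k * (10010 * W) = 10010 * (W * (d + 1) ^ k) := by ring
    have e10 : 1 ≤ W := by omega
    omega

/-- Since `lo` never drops below `μ`, the same `d` bounds the number of boxes for all tested sizes;
`hi ≤ n + 1` bounds the counting from `lo` to the midpoint. -/
theorem ensures_binarySearch_resources (s : State) {n k μ d : ℕ} (hn : s.reg .n = n)
    (hk : s.reg .k = k) (hμ : s.reg .mindeg = μ) (hμn : μ ≤ n) (hd : n ≤ d * μ) :
    Ensures binarySearch s fun t => t.reg .size ≤ max (s.reg .size) (d ^ 2 + d + 2) ∧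
      t.time ≤ s.time + 30000 * ((s.reg .lg + 3) *
        ((n + 1) * (k + 1) * (d ^ 2 + d + 3) ^ 3 * (d + 1) ^ k)) := by
  simp only [binarySearch, ensures_seq, ensures_assign]
  set W := (n + 1) * (k + 1) * (d ^ 2 + d + 3) ^ 3 * (d + 1) ^ k with hW
  have hWn : n + 1 ≤ W := by
    rw [hW, mul_assoc, mul_assoc]
    exact Nat.le_mul_of_pos_right _ (by positivity)
  suffices h : ∀ t, t.reg .lo = μ → t.reg .hi ≤ n →
      t.reg .n = n → t.reg .k = k → t.reg .lg = s.reg .lg → t.reg .size = s.reg .size →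
      t.time ≤ s.time + 20 →
      Ensures (.assign .hi (.succ (.reg .hi))) t fun t =>
      Ensures (.loop .t (.succ (.succ (.reg .lg)))
        (.ifThen (.lt (.reg .lo) (.reg .hi))
          (.assign .gap (.half (.sub (.reg .hi) (.reg .lo))) ;; .assign .box (.reg .lo) ;;
           .loop .i (.reg .gap) (.assign .box (.succ (.reg .box))) ;;
           testBoxSize ;;
           .ifElse (.eq (.reg .found) 1) (.assign .hi (.reg .box))
            (.assign .lo (.succ (.reg .box)))))) t fun t =>
        t.reg .size ≤ max (s.reg .size) (d ^ 2 + d + 2) ∧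
        t.time ≤ s.time + 30000 * ((s.reg .lg + 3) * W) by
    simp only [ensures_ifThen, ensures_assign] at h ⊢
    refine ⟨fun h' => h _ ?_ ?_ ?_ ?_ ?_ ?_ ?_, fun h' => h _ ?_ ?_ ?_ ?_ ?_ ?_ ?_⟩ <;>
      simp [hn, hk, hμ, Expr.cost, Cond.cost] at h' ⊢ <;> omega
  intro t htlo hthi htn htk htlg hts htt
  rw [ensures_assign]
  refine Ensures.loop (fun m u => μ ≤ u.reg .lo ∧ u.reg .hi ≤ n + 1 ∧
    u.reg .size ≤ max (s.reg .size) (d ^ 2 + d + 2) ∧ u.time ≤ s.time + 30 + m * (25000 * W))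
    ⟨by simp [htlo], by simpa, by simp [hts], by simp [Expr.cost]; omega⟩
    (fun m hm u hf hu => ?_) fun u hf ⟨_, _, h3, h4⟩ => ⟨h3, ?_⟩
  · have hn1 := hf.reg .n (by decide)
    have hk1 := hf.reg .k (by decide)
    simp [htn, htk] at hn1 hk1
    obtain ⟨h1, h2, h3, h4⟩ := hu
    rw [ensures_ifThen]
    simp only [ensures_seq, ensures_assign]
    have hstep : (m + 1) * (25000 * W) = m * (25000 * W) + 25000 * W := Nat.succ_mul _ _
    refine ⟨fun hlt => ?_, fun hle => ⟨h1, h2, h3, ?_⟩⟩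
    · refine Ensures.loop (fun m v => v.reg .box = u.reg .lo + m ∧
        v.time ≤ u.time + 20 + 4 * m) (by simp [Expr.cost, Cond.cost])
        (fun m _ v _ hv => by simp [hv.1, add_assoc, Expr.cost]; omega) fun v hf' hv => ?_
      simp at hlt
      have hn2 := hf'.reg .n (by decide)
      have hk2 := hf'.reg .k (by decide)
      have hlo2 := hf'.reg .lo (by decide)
      have hhi2 := hf'.reg .hi (by decide)
      have hs2 := hf'.reg .size (by decide)
      simp [hn1, hk1] at hv hn2 hk2 hlo2 hhi2 hs2
      refine (ensures_testBoxSize_resources v hn2 hk2 hv.1 (d := d)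
        (hd.trans (Nat.mul_le_mul_left _ (by omega)))).framed fun w hf3 ⟨hw1, hw2⟩ => ?_
      have hlo3 := hf3.reg .lo (by decide)
      have hhi3 := hf3.reg .hi (by decide)
      have hbox3 := hf3.reg .box (by decide)
      rw [hlo2] at hlo3
      rw [hhi2] at hhi3
      rw [hv.1] at hbox3
      rw [hs2] at hw1
      have hw3 : w.reg .size ≤ max (s.reg .size) (d ^ 2 + d + 2) := by omega
      rw [← hW] at hw2
      obtain ⟨hv1, hv2⟩ := hv
      simp only [ensures_ifElse', ensures_assign]
      simp [hlo3, hhi3, hbox3, hw3, h1, h2, Expr.cost, Cond.cost]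
      exact ⟨fun _ => ⟨by omega, by omega⟩, fun _ => ⟨by omega, by omega⟩⟩
    · simp [Expr.cost, Cond.cost]
      omega
  · simp [htlg] at h4
    have : (s.reg .lg + 3) * W = (s.reg .lg + 1 + 1) * W + W := by ring
    have : (s.reg .lg + 1 + 1) * (25000 * W) = 25000 * ((s.reg .lg + 1 + 1) * W) := by ring
    omega

/-! ### Layouts and labelings -/

section
variable {n k β b : ℕ} {dist : ℕ → ℕ → ℕ} {q a : ℕ → ℕ}

theorem card_before_lt {v : ℕ} (hv : v < n) : #(before n a (a v) v) < n := by
  conv_rhs => rw [← card_range n]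
  refine card_lt_card ⟨filter_subset _ _, fun h => ?_⟩
  have := h (mem_range.2 hv)
  simp [before] at this

theorem card_before_lt_card_before {u v : ℕ} (hu : u < n) (h : a u < a v ∨ a u = a v ∧ u < v) :
    #(before n a (a u) u) < #(before n a (a v) v) := by
  refine card_lt_card ⟨fun w hw => ?_, fun h' => ?_⟩
  · simp only [before, mem_filter, mem_range] at hw ⊢
    omega
  · have : u ∈ before n a (a v) v := by simp [before, hu, h]
    have := h' this
    simp [before] at this

/-- The order by box and then by number is total, so the ranks are distinct; an injection into `n`
values is onto. -/
theorem isLabeling_before {f : Fin n → ℕ} (hf : ∀ v : Fin n, f v = #(before n a (a v) v) + 1) :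
    Bandwidth.IsLabeling f := by
  have hinj : Function.Injective f := by
    intro u v huv
    rw [hf, hf] at huv
    by_contra hne
    have hne' : (u : ℕ) ≠ v := fun h => hne (Fin.ext h)
    obtain h | h : (a u < a v ∨ a u = a v ∧ (u : ℕ) < v) ∨
        (a v < a u ∨ a v = a u ∧ (v : ℕ) < u) := by omega
    · have := card_before_lt_card_before u.2 h
      omega
    · have := card_before_lt_card_before v.2 h
      omega
  have hmaps : Set.MapsTo f (univ : Finset (Fin n)) (Finset.Icc 1 n) := by
    intro v _
    have := card_before_lt (a := a) v.2
    simp only [coe_Icc, Set.mem_Icc, hf]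
    omega
  have hsurj := surjOn_of_injOn_of_card_le f hmaps hinj.injOn (by simp)
  unfold Bandwidth.IsLabeling
  rw [Fintype.card_fin]
  simpa using Set.BijOn.mk hmaps hinj.injOn hsurj

/-- The source of the factor six: a vertex that comes before `v` but not before `u` lies in one of
the six boxes from `a u` to `a u + 5`. -/
theorem IsLayout.card_before_le (h : IsLayout n k β b dist q a) {u v : ℕ}
    (huv : a v ≤ a u + 5) : #(before n a (a v) v) ≤ #(before n a (a u) u) + 6 * β := by
  have h1 : before n a (a v) v ⊆
      before n a (a u) u ∪ {w ∈ range n | a w ∈ Icc (a u) (a u + 5)} := by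
    intro w hw
    simp only [before, mem_union, mem_filter, mem_range, mem_Icc] at hw ⊢
    omega
  have h2 : #{w ∈ range n | a w ∈ Icc (a u) (a u + 5)} ≤ 6 * β := by
    rw [card_eq_sum_card_fiberwise (f := a) (t := Icc (a u) (a u + 5))
      fun w hw => by simpa using (mem_filter.1 hw).2]
    refine (sum_le_card_nsmul _ _ β fun i hi => ?_).trans
      (by simp [show a u + 5 + 1 - a u = 6 by omega])
    rw [filter_filter]
    by_cases hib : i < b
    · exact (card_le_card (monotone_filter_right _ fun _ _ h => h.2)).trans (h.card_le i hib)
    · rw [filter_false_of_mem, card_empty]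
      · exact Nat.zero_le _
      · rintro w hw ⟨-, rfl⟩
        exact hib (h.lt w (mem_range.1 hw))
  exact (card_le_card h1).trans ((card_union_le _ _).trans (by omega))

theorem IsLayout.near (h : IsLayout n k β b dist q a) {i u v : ℕ} (hi : i < k) (hu : u < n)
    (hv : v < n) (hdu : dist i u ≤ 2) (hdv : dist i v ≤ 3) : a v ≤ a u + 5 ∧ a u ≤ a v + 5 := by
  obtain ⟨h1, h2, h3⟩ := h.window u hu i hi
  obtain ⟨h4, h5, h6⟩ := h.window v hv i hi
  omega

/-- Follow the predecessors back to the root: every edge changes the box by at most one. -/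
theorem IsDist.abs_le {A : ℕ → ℕ → Prop} {r : ℕ} {D : ℕ → ℕ} (h : IsDist A n r D)
    (ha : ∀ u < n, ∀ w < n, A u w → a u ≤ a w + 1 ∧ a w ≤ a u + 1) (d : ℕ) :
    d ≤ 3 → ∀ v < n, D v = d → a v ≤ a r + d ∧ a r ≤ a v + d := by
  induction d with
  | zero =>
    intro _ v hv hD
    rw [(h.zero v hv).1 hD]
    simp
  | succ d ih =>
    intro hd v hv hD
    obtain ⟨u, hu, hA, hDu⟩ := h.pred v hv (by omega) (by omega)
    have := ih (by omega) u hu (by omega)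
    have := ha u hu v hv hA
    omega

theorem IsDist.inWindow {A : ℕ → ℕ → Prop} {r : ℕ} {D : ℕ → ℕ} (h : IsDist A n r D)
    (ha : ∀ u < n, ∀ w < n, A u w → a u ≤ a w + 1 ∧ a w ≤ a u + 1) {v : ℕ} (hv : v < n) :
    InWindow (D v) (a r) (a v) := by
  have h0 := h.abs_le ha 0 (by omega) v hv
  have h1 := h.abs_le ha 1 (by omega) v hv
  have h2 := h.abs_le ha 2 (by omega) v hv
  have h3 := h.abs_le ha 3 (by omega) v hv
  refine ⟨by omega, fun _ _ => ?_, by omega⟩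
  obtain h | h : D v = 1 ∨ D v = 2 := by omega
  · have := h1 h
    omega
  · have := h2 h
    omega

end

section
variable {n : ℕ} (G : SimpleGraph (Fin n)) [DecidableRel G.Adj]

theorem le_width {f : Fin n → ℕ} {u v : Fin n} (h : G.Adj u v) :
    f u ≤ f v + Bandwidth.width G f := by
  have := le_sup (f := fun p : Fin n × Fin n => ((f p.1 : ℤ) - (f p.2 : ℤ)).natAbs)
    (s := univ.filter fun p : Fin n × Fin n => G.Adj p.1 p.2) (b := (u, v)) (by simpa)
  change _ ≤ Bandwidth.width G f at this
  simp only at this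
  omega

theorem width_le {f : Fin n → ℕ} {B : ℕ} (h : ∀ u v, G.Adj u v → f u ≤ f v + B) :
    Bandwidth.width G f ≤ B := by
  refine Finset.sup_le fun p hp => ?_
  simp only [mem_filter, mem_univ, true_and] at hp
  have := h _ _ hp
  have := h _ _ hp.symm
  omega

theorem exists_width_eq_bandwidth :
    ∃ f : Fin n → ℕ, Bandwidth.IsLabeling f ∧ Bandwidth.width G f = Bandwidth.bandwidth G := by
  -- A labeling exists, for instance the one obtained from a single box, so the infimum is attained.
  refine Nat.sInf_mem (s := {B | ∃ f : Fin n → ℕ, Bandwidth.IsLabeling f ∧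
    Bandwidth.width G f = B}) ⟨_, _, isLabeling_before (a := fun _ => 0) fun _ => rfl, rfl⟩

/-- In an optimal labeling, the neighbours of the vertex labeled 1 have distinct labels between 2
and `B(G) + 1`. -/
theorem le_bandwidth (hn : 0 < n) {μ : ℕ} (hμ : ∀ v, μ ≤ G.degree v) :
    μ ≤ Bandwidth.bandwidth G := by
  obtain ⟨f, hf, hw⟩ := exists_width_eq_bandwidth G
  obtain ⟨v, -, hv⟩ := hf.surjOn (show 1 ∈ Set.Icc 1 (Fintype.card (Fin n)) by simp; omega)
  refine (hμ v).trans ?_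
  rw [← G.card_neighborFinset_eq_degree]
  calc #(G.neighborFinset v) ≤ #(Icc 2 (Bandwidth.bandwidth G + 1)) := by
        refine card_le_card_of_injOn f (fun u hu => ?_) (hf.injOn.mono (Set.subset_univ _))
        rw [mem_coe, SimpleGraph.mem_neighborFinset] at hu
        have h1 := le_width G (f := f) hu.symm
        have h2 := hf.mapsTo (Set.mem_univ u)
        have h3 : f u ≠ f v := fun h => hu.ne' (hf.injOn (Set.mem_univ _) (Set.mem_univ _) h)
        simp only [coe_Icc, Set.mem_Icc] at h2 ⊢
        omega
    _ = _ := by simp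

/-- An optimal labeling is cut into blocks of `β` labels. Neighbours are at most one block apart,
either because `β` is at least the bandwidth or because there are only two blocks. The second case
is why sizes beyond `⌈n / 2⌉` need not be tried. -/
theorem exists_layout {k β b : ℕ} {dist : ℕ → ℕ → ℕ} {A : ℕ → ℕ → Prop}
    (hA : ∀ u v : Fin n, A u v → G.Adj u v) {ρ : ℕ → ℕ} (hρ : ∀ i < k, ρ i < n)
    (hdist : ∀ i < k, IsDist A n (ρ i) (dist i)) (hβ0 : 0 < β) (hb : n ≤ b * β)
    (h : Bandwidth.bandwidth G ≤ β ∨ b ≤ 2) : ∃ q a, IsLayout n k β b dist q a := by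
  obtain ⟨f, hf, hw⟩ := exists_width_eq_bandwidth G
  -- Labels start at 1 and boxes at 0, hence the shift.
  set F : ℕ → ℕ := fun v => if h : v < n then f ⟨v, h⟩ - 1 else 0 with hF
  set a : ℕ → ℕ := fun v => F v / β with ha
  have hrange : ∀ v : Fin n, 1 ≤ f v ∧ f v ≤ n := by
    intro v
    simpa using hf.mapsTo (Set.mem_univ v)
  have hFv : ∀ v : Fin n, F v = f v - 1 := by
    intro v
    simp [hF]
  have hlt : ∀ v < n, a v < b := by
    intro v hv
    refine Nat.div_lt_of_lt_mul ?_
    have := hrange ⟨v, hv⟩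
    have := hFv ⟨v, hv⟩
    simp only at this
    rw [mul_comm]
    omega
  have hstep : ∀ u v : Fin n, G.Adj u v → a u ≤ a v + 1 := by
    intro u v huv
    obtain h | h := h
    · have h1 := le_width G (f := f) huv
      rw [ha]
      simp only [hFv]
      rw [← Nat.add_div_right _ hβ0]
      refine Nat.div_le_div_right ?_
      have := hrange v
      omega
    · have := hlt u u.2
      omega
  refine ⟨fun i => a (ρ i), a, fun i hi => hlt _ (hρ i hi), hlt, fun v hv i hi =>
    (hdist i hi).inWindow (fun u hu w hw hAuw => ?_) hv, fun i hi => ?_⟩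
  · have := hA ⟨u, hu⟩ ⟨w, hw⟩ hAuw
    exact ⟨hstep _ _ this, hstep _ _ this.symm⟩
  · calc #{v ∈ range n | a v = i} ≤ #(Ico (β * i) (β * i + β)) := by
          refine card_le_card_of_injOn F (fun v hv => ?_) fun u hu v hv huv => ?_
          · simp only [coe_filter, mem_range, Set.mem_ofPred_eq] at hv
            simp only [coe_Ico, Set.mem_Ico, ← hv.2, ha]
            have := Nat.div_add_mod (F v) β
            have := Nat.mod_lt (F v) hβ0
            omega
          · simp only [coe_filter, mem_range, Set.mem_ofPred_eq] at hu hv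
            have h1 := hFv ⟨u, hu.1⟩
            have h2 := hFv ⟨v, hv.1⟩
            have h3 := hrange ⟨u, hu.1⟩
            have h4 := hrange ⟨v, hv.1⟩
            simp only at h1 h2
            have := hf.injOn (Set.mem_univ (⟨u, hu.1⟩ : Fin n))
              (Set.mem_univ (⟨v, hv.1⟩ : Fin n)) (by omega)
            simpa using this
      _ = β := by simp

/-! ### Dominating sets -/

/-- Greedy choice: counting the edges at the set `U` of undominated vertices from both sides, some
vertex is adjacent to at least `δ * #U` of them. Adding it to `D` shrinks `U` by the factor `1 - δ`.
-/
theorem exists_almost_dominating {δ : ℝ} (hδ : δ ≤ 1) (hn : 0 < n)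
    (hG : ∀ v, δ * n ≤ G.degree v) (m : ℕ) :
    ∃ D : Finset (Fin n), #D ≤ m ∧
      (#{v | ∀ d ∈ D, ¬ G.Adj v d} : ℝ) ≤ (1 - δ) ^ m * n := by
  induction m with
  | zero => exact ⟨∅, by simp, by simp⟩
  | succ m ih =>
    obtain ⟨D, hD, hU⟩ := ih
    set U : Finset (Fin n) := {v | ∀ d ∈ D, ¬ G.Adj v d} with hUdef
    obtain ⟨w, hw⟩ : ∃ w, δ * #U ≤ #{v ∈ U | G.Adj v w} := by
      have h1 : ∑ w : Fin n, #{v ∈ U | G.Adj v w} = ∑ v ∈ U, G.degree v := by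
        refine (sum_card_bipartiteAbove_eq_sum_card_bipartiteBelow (s := U) (t := univ)
          G.Adj).symm.trans ?_
        refine sum_congr rfl fun v _ => ?_
        rw [← G.card_neighborFinset_eq_degree]
        congr 1
        ext
        simp [bipartiteAbove]
      have h2 : ∑ w : Fin n, δ * #U ≤ ∑ w : Fin n, (#{v ∈ U | G.Adj v w} : ℝ) := by
        rw [← Nat.cast_sum, h1, Nat.cast_sum]
        calc ∑ w : Fin n, δ * #U = ∑ v ∈ U, δ * n := by
              simp
              ring
          _ ≤ _ := sum_le_sum fun v _ => hG v
      have : Nonempty (Fin n) := ⟨⟨0, hn⟩⟩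
      obtain ⟨w, _, hw⟩ := exists_le_of_sum_le univ_nonempty h2
      exact ⟨w, hw⟩
    refine ⟨insert w D, (card_insert_le _ _).trans (by omega), ?_⟩
    have h3 : ({v | ∀ d ∈ insert w D, ¬ G.Adj v d} : Finset (Fin n)) = {v ∈ U | ¬ G.Adj v w} := by
      ext v
      simp [hUdef]
      tauto
    have h4 := card_filter_add_card_filter_not (s := U) (fun v => G.Adj v w)
    rw [h3, pow_succ]
    have h5 : (#{v ∈ U | G.Adj v w} : ℝ) + #{v ∈ U | ¬ G.Adj v w} = #U := by exact_mod_cast h4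
    nlinarith

/-- Every `M` greedy steps halve the bound on the undominated vertices; after `log n + 1` such
rounds fewer than one is left. -/
theorem exists_dominating {δ : ℝ} (hδ : δ ≤ 1) (hn : 0 < n)
    (hG : ∀ v, δ * n ≤ G.degree v) {M : ℕ} (hM : (1 - δ) ^ M ≤ 1 / 2) :
    ∃ D : Finset (Fin n), #D ≤ M * (Nat.log 2 n + 1) ∧ ∀ v, ∃ d ∈ D, G.Adj v d := by
  obtain ⟨D, hD, hU⟩ := exists_almost_dominating G hδ hn hG (M * (Nat.log 2 n + 1))
  refine ⟨D, hD, fun v => ?_⟩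
  by_contra! hv
  have h1 : (1 : ℝ) ≤ #{v | ∀ d ∈ D, ¬ G.Adj v d} := by
    exact_mod_cast card_pos.2 ⟨v, by simpa using hv⟩
  have h2 : (1 - δ) ^ (M * (Nat.log 2 n + 1)) ≤ (1 / 2) ^ (Nat.log 2 n + 1) := by
    rw [pow_mul]
    exact pow_le_pow_left₀ (pow_nonneg (by linarith) _) hM _
  have h3 : (n : ℝ) < 2 ^ (Nat.log 2 n + 1) := by
    exact_mod_cast Nat.lt_pow_succ_log_self one_lt_two n
  have h4 : (1 - δ) ^ (M * (Nat.log 2 n + 1)) * n ≤ (1 / 2) ^ (Nat.log 2 n + 1) * n :=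
    mul_le_mul_of_nonneg_right h2 (by positivity)
  have h5 : ((1 : ℝ) / 2) ^ (Nat.log 2 n + 1) * n < 1 := by
    rw [one_div, inv_pow, inv_mul_lt_one₀ (by positivity)]
    exact h3
  linarith

end

end Algorithm2

namespace RAM

/-! ### Probabilities -/

section
variable {α β : Type*} {p : PMF α} {g : α → PMF β} {S : Set α} {T : Set β}

/-- The multiplicative step for repeated draws: to end in `T` one must pass through `S`, and from
there `T` has probability at most `q`. -/
theorem toOuterMeasure_bind_le {q : ENNReal}
    (h : ∀ a ∈ p.support, a ∈ S → (g a).toOuterMeasure T ≤ q)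
    (h' : ∀ a ∈ p.support, a ∉ S → (g a).toOuterMeasure T = 0) :
    (p.bind g).toOuterMeasure T ≤ p.toOuterMeasure S * q := by
  classical
  rw [PMF.toOuterMeasure_bind_apply, PMF.toOuterMeasure_apply, ← ENNReal.tsum_mul_right]
  refine ENNReal.tsum_le_tsum fun a => ?_
  by_cases ha : a ∈ p.support
  · by_cases haS : a ∈ S
    · simpa [haS] using mul_le_mul_right (h a ha haS) (p a)
    · simp [haS, h' a ha haS]
  · simp [(PMF.apply_eq_zero_iff p a).2 ha]

theorem toOuterMeasure_le_bind (h : ∀ a ∈ p.support, a ∈ S → ∀ b ∈ (g a).support, b ∈ T) :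
    p.toOuterMeasure S ≤ (p.bind g).toOuterMeasure T := by
  classical
  rw [PMF.toOuterMeasure_bind_apply, PMF.toOuterMeasure_apply]
  refine ENNReal.tsum_le_tsum fun a => ?_
  by_cases haS : a ∈ S
  · by_cases ha : a ∈ p.support
    · rw [(PMF.toOuterMeasure_apply_eq_one_iff _ _).2 (h a ha haS)]
      simp [haS]
    · simp [(PMF.apply_eq_zero_iff p a).2 ha]
  · simp [haS]

theorem one_sub_le_toOuterMeasure {q : ENNReal} (h : p.toOuterMeasure Sᶜ ≤ q) :
    1 - q ≤ p.toOuterMeasure S := by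
  rw [tsub_le_iff_right]
  calc (1 : ENNReal) = p.toOuterMeasure Set.univ :=
        ((PMF.toOuterMeasure_apply_eq_one_iff _ _).2 (Set.subset_univ _)).symm
    _ ≤ p.toOuterMeasure S + p.toOuterMeasure Sᶜ := by
        rw [← Set.union_compl_self S]
        exact MeasureTheory.measure_union_le _ _
    _ ≤ _ := by gcongr

end

theorem uniform_avoid_le {N : ℕ} (hN : 0 < N) {δ : ℝ} (A : Finset (Fin N))
    (hA : δ * N ≤ A.card) :
    (uniform N).toOuterMeasure {a | ∀ v ∈ A, (v : ℕ) ≠ a} ≤ ENNReal.ofReal (1 - δ) := by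
  obtain _ | N := N
  · exact absurd hN (lt_irrefl 0)
  rw [uniform_succ, PMF.toOuterMeasure_map_apply]
  have h : (fun a : Fin (N + 1) => (a : ℕ)) ⁻¹' {a | ∀ v ∈ A, (v : ℕ) ≠ a} =
      ((Aᶜ : Finset (Fin (N + 1))) : Set (Fin (N + 1))) := by
    ext a
    simp only [Set.mem_preimage, Set.mem_ofPred_eq, Finset.coe_compl, Set.mem_compl_iff,
      Finset.mem_coe]
    exact ⟨fun h ha => h a ha rfl, fun h v hv e => h (Fin.ext e ▸ hv)⟩
  rw [h, PMF.toOuterMeasure_uniformOfFintype_apply]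
  simp only [Finset.coe_sort_coe, Fintype.card_coe, Fintype.card_fin]
  have h1 : (Aᶜ.card : ℝ) ≤ (1 - δ) * (N + 1 : ℕ) := by
    have : (A.card : ℝ) + Aᶜ.card = (N + 1 : ℕ) := by
      exact_mod_cast (Finset.card_add_card_compl A).trans (Fintype.card_fin _)
    linarith
  refine ENNReal.div_le_of_le_mul ?_
  rw [← ENNReal.ofReal_natCast, ← ENNReal.ofReal_natCast, ← ENNReal.ofReal_mul' (by positivity)]
  exact ENNReal.ofReal_le_ofReal h1

end RAM

namespace Algorithm2

open RAM Finset

/-- Independence enters through `bind`: whatever the earlier roots are, the next one misses `A` with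
probability at most `1 - δ`. The first part ensures that every draw is from `N` vertices. -/
theorem iterate_avoid_le {N : ℕ} (hN : 0 < N) {δ : ℝ} (A : Finset (Fin N))
    (hA : δ * N ≤ #A) (s : State) (hs : s.reg .n = N) (m : ℕ) :
    (∀ t ∈ (iterate (fun m t => exec (.seq (.rand .x (.reg .n)) (.write .root (.reg .i) 0 (.reg .x)))
      ((t.setReg .i m).tick 1)) m s).support, t.reg .n = N) ∧
    (iterate (fun m t => exec (.seq (.rand .x (.reg .n)) (.write .root (.reg .i) 0 (.reg .x)))
      ((t.setReg .i m).tick 1)) m s).toOuterMeasure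
        {t | ∀ i < m, ∀ v ∈ A, (v : ℕ) ≠ t.arr .root i 0} ≤ ENNReal.ofReal (1 - δ) ^ m := by
  induction m with
  | zero =>
    refine ⟨fun t ht => ?_, ?_⟩
    · simp only [iterate, PMF.support_pure, Set.mem_singleton_iff] at ht
      rw [ht, hs]
    · rw [pow_zero]
      refine (MeasureTheory.measure_mono (Set.subset_univ _)).trans_eq ?_
      exact (PMF.toOuterMeasure_apply_eq_one_iff _ _).2 (Set.subset_univ _)
  | succ m ih =>
    obtain ⟨ih1, ih2⟩ := ih
    have hstep : ∀ t : State, exec (.seq (.rand .x (.reg .n)) (.write .root (.reg .i) 0 (.reg .x)))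
        ((t.setReg .i m).tick 1) = (uniform (t.reg .n)).map fun a =>
          (((((t.setReg .i m).tick 1).setReg .x a).tick 2).setArr .root m 0 a).tick 4 := by
      intro t
      rw [exec, exec, PMF.bind_map, ← PMF.bind_pure_comp]
      congr 1
    refine ⟨fun t ht => ?_, ?_⟩
    · rw [iterate, PMF.mem_support_bind_iff] at ht
      obtain ⟨u, hu, ht⟩ := ht
      rw [hstep, PMF.mem_support_map_iff] at ht
      obtain ⟨a, -, rfl⟩ := ht
      simpa using ih1 u hu
    · rw [iterate, pow_succ]
      refine (toOuterMeasure_bind_le (fun t ht _ => ?_) fun t ht hts => ?_).trans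
        (mul_le_mul_left ih2 _)
      · rw [hstep, PMF.toOuterMeasure_map_apply, ih1 t ht]
        refine (MeasureTheory.measure_mono fun a ha v hv => ?_).trans (uniform_avoid_le hN A hA)
        simpa using ha m (Nat.lt_succ_self m) v hv
      · rw [hstep, PMF.toOuterMeasure_map_apply, PMF.toOuterMeasure_apply_eq_zero_iff,
          Set.disjoint_right]
        refine fun a ha _ => hts fun i hi v hv => ?_
        simpa [hi.ne] using ha i (hi.trans (Nat.lt_succ_self m)) v hv

theorem chooseRoots_avoid_le {N : ℕ} (hN : 0 < N) {δ : ℝ} (A : Finset (Fin N))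
    (hA : δ * N ≤ #A) (s : State) (hs : s.reg .n = N) :
    (exec chooseRoots s).toOuterMeasure
      {t | ∀ i < s.reg .k, ∀ v ∈ A, (v : ℕ) ≠ t.arr .root i 0} ≤
        ENNReal.ofReal (1 - δ) ^ s.reg .k :=
  -- Evaluating the bound of the loop takes the two steps.
  (iterate_avoid_le hN A hA (s.tick 2) hs (s.reg .k)).2

/-- Every vertex is within distance two of a root. -/
def Covered {n : ℕ} (G : SimpleGraph (Fin n)) (k : ℕ) (s : State) : Prop :=
  ∀ v, ∃ d, G.Adj v d ∧ ∃ i < k, ∃ w, G.Adj d w ∧ s.arr .root i 0 = w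

/-- If `v` is not covered, then a neighbour of `v` in `D` has no root among its at least `δ n`
neighbours. The union bound thus runs over `D` only. -/
theorem chooseRoots_not_covered_le {n : ℕ} (G : SimpleGraph (Fin n)) [DecidableRel G.Adj]
    (hn : 0 < n) {δ : ℝ} (hG : ∀ v, δ * n ≤ G.degree v) (D : Finset (Fin n))
    (hD : ∀ v, ∃ d ∈ D, G.Adj v d) (s : State) (hs : s.reg .n = n) :
    (exec chooseRoots s).toOuterMeasure {t | Covered G (s.reg .k) t}ᶜ ≤
      #D * ENNReal.ofReal (1 - δ) ^ s.reg .k := by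
  rw [← nsmul_eq_mul]
  refine le_trans ?_ (sum_le_card_nsmul D (fun d => (exec chooseRoots s).toOuterMeasure
      {t | ∀ i < s.reg .k, ∀ v ∈ G.neighborFinset d, (v : ℕ) ≠ t.arr .root i 0}) _
    fun d _ => chooseRoots_avoid_le hn _
      ((hG d).trans_eq (by rw [G.card_neighborFinset_eq_degree])) s hs)
  refine (MeasureTheory.measure_mono fun t ht => ?_).trans
    (MeasureTheory.measure_biUnion_finset_le D _)
  simp only [Covered, Set.mem_compl_iff, Set.mem_ofPred_eq] at ht
  push Not at ht
  obtain ⟨v, hv⟩ := ht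
  obtain ⟨d, hd, hvd⟩ := hD v
  simp only [Set.mem_iUnion]
  exact ⟨d, hd, fun i hi w hw h => hv d hvd i hi w (by simpa using hw) h.symm⟩

/-! ### The whole algorithm -/

section
variable {n : ℕ} (G : SimpleGraph (Fin n))

/-- The memory holds the graph `G` and the sample size `k`. -/
structure Loaded (k : ℕ) (s : State) : Prop where
  reg_n : s.reg .n = n
  reg_k : s.reg .k = k
  reg_lg : s.reg .lg = Nat.log 2 n
  reg_size : s.reg .size = 0
  adj : ∀ u v, s.arr .adj u v = 1 ↔ ∃ (hu : u < n) (hv : v < n), G.Adj ⟨u, hu⟩ ⟨v, hv⟩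

/-- The part of the program that follows the choice of the roots. -/
def afterRoots : Cmd := search ;; minimumDegree ;; binarySearch

variable {G}

theorem Loaded.adj_iff {k : ℕ} {s : State} (h : Loaded G k s) (u v : Fin n) :
    s.arr .adj u v = 1 ↔ G.Adj u v := by
  simp [h.adj]

theorem Loaded.after_chooseRoots {k : ℕ} {s : State} (h : Loaded G k s) :
    Ensures chooseRoots s fun t => Loaded G k t ∧ t.time ≤ s.time + 1000 * (k + 1) := by
  refine (ensures_time chooseRoots s (by decide)).framed fun t hf ht =>
    ⟨⟨?_, ?_, ?_, ?_, ?_⟩, ?_⟩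
  · rw [hf.reg .n (by decide), h.reg_n]
  · rw [hf.reg .k (by decide), h.reg_k]
  · rw [hf.reg .lg (by decide), h.reg_lg]
  · rw [hf.reg .size (by decide), h.reg_size]
  · rw [hf.arr .adj (by decide)]
    exact h.adj
  · have := cost_chooseRoots s
    rw [h.reg_k] at this
    omega

variable [DecidableRel G.Adj]

theorem Loaded.card_filter {k : ℕ} {s : State} (h : Loaded G k s) (v : Fin n) :
    #{w ∈ range n | s.arr .adj v w = 1} = G.degree v := by
  rw [← G.card_neighborFinset_eq_degree, ← card_map Fin.valEmbedding]
  congr 1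
  ext w
  simp only [mem_filter, mem_range, h.adj, mem_map, SimpleGraph.mem_neighborFinset,
    Fin.valEmbedding_apply]
  exact ⟨fun ⟨_, _, hw, ha⟩ => ⟨⟨w, hw⟩, ha, rfl⟩, fun ⟨u, hu, e⟩ => e ▸ ⟨u.2, v.2, u.2, hu⟩⟩

theorem Loaded.afterRoots_correct {k : ℕ} {s : State} (h : Loaded G k s) (hn : 0 < n)
    (hG : ∀ v, 0 < G.degree v) (hroot : ∀ i < k, s.arr .root i 0 < n) :
    Ensures afterRoots s fun t => Bandwidth.IsLabeling (output t : Fin n → ℕ) ∧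
      (Covered G k s →
        Bandwidth.width G (output t : Fin n → ℕ) ≤ 6 * Bandwidth.bandwidth G) := by
  simp only [afterRoots, ensures_seq]
  refine (ensures_search s h.reg_n h.reg_k (fun i => s.arr .root i 0) fun _ _ => rfl).framed
    fun t hf hdist => ?_
  have htn := (hf.reg .n (by decide)).trans h.reg_n
  have htk := (hf.reg .k (by decide)).trans h.reg_k
  have htlg := (hf.reg .lg (by decide)).trans h.reg_lg
  have htadj := hf.arr .adj (by decide)
  refine (ensures_minimumDegree t htn _ fun v => rfl).framed fun u hf' ⟨hμ1, hμ2⟩ => ?_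
  have hun := (hf'.reg .n (by decide)).trans htn
  have huk := (hf'.reg .k (by decide)).trans htk
  have hulg := (hf'.reg .lg (by decide)).trans htlg
  have hud := hf'.arr .dist (by decide)
  rw [htadj] at hμ1 hμ2
  set μ := u.reg .mindeg with hμ
  have hμG : ∀ v, μ ≤ G.degree v := fun v => (hμ1 v v.2).trans_eq (h.card_filter v)
  have hμ0 : 0 < μ := by
    obtain e | ⟨v, hv, e⟩ := hμ2
    · omega
    · rw [e]
      exact (hG ⟨v, hv⟩).trans_eq (h.card_filter ⟨v, hv⟩).symm
  have hμB := le_bandwidth G hn hμG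
  -- The threshold is capped at the largest size that is tried. Above the cap two boxes suffice for
  -- all vertices, so those sizes are accepted as well.
  refine (ensures_binarySearch u (τ := min (Bandwidth.bandwidth G) (max μ (n - n / 2))) hun hn huk
    hulg hμ.symm hμ0 (by omega) (min_le_right _ _) fun β hβ b hb hb' => ?_).mono fun w hw => ?_
  · refine exists_layout G (fun x y hxy => (h.adj_iff x y).1 hxy) hroot
      (by rwa [hud]) (by omega) hb ?_
    obtain hβ | hβ := min_le_iff.1 hβ
    · exact .inl hβ
    · exact .inr (hb' 2 (by omega))
  · obtain ⟨β, hβ, b, q, a, hL, hw⟩ := hw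
    have hw' : ∀ v : Fin n, output w v = #(before n a (a v) v) + 1 := fun v => hw v v.2
    refine ⟨isLabeling_before hw', fun hC => ?_⟩
    refine (width_le G fun x y hxy => ?_).trans
      (Nat.mul_le_mul_left 6 (hβ.trans (min_le_left _ _)))
    rw [hw', hw']
    obtain ⟨d, hxd, i, hi, r, hdr, hr⟩ := hC x
    have hD := hdist i hi
    rw [← hud] at hD
    -- Along the walk from the root `r` over `d` and `x` to `y`, the distances from `r` are at most
    -- 0, 1, 2 and 3.
    have h0 := (hD.zero r r.2).2 hr.symm
    have h1 := hD.step r r.2 d d.2 ((h.adj_iff r d).2 hdr.symm) (by omega)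
    have h2 := hD.step d d.2 x x.2 ((h.adj_iff d x).2 hxd.symm) (by omega)
    have h3 := hD.step x x.2 y y.2 ((h.adj_iff x y).2 hxy) (by omega)
    have := hL.card_before_le (hL.near hi x.2 y.2 (by omega) (by omega)).2
    omega

theorem Loaded.afterRoots_resources {k d : ℕ} {s : State} (h : Loaded G k s)
    (hd : n ≤ d * n) (hG : ∀ v, n ≤ d * G.degree v) :
    Ensures afterRoots s fun t => t.reg .size ≤ d ^ 2 + d + 2 ∧
      t.time ≤ s.time + 1000 * ((n + 1) ^ 2 * (k + 1)) + 1000 * (n + 1) ^ 2 +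
        30000 * ((Nat.log 2 n + 3) *
          ((n + 1) * (k + 1) * (d ^ 2 + d + 3) ^ 3 * (d + 1) ^ k)) := by
  simp only [afterRoots, ensures_seq]
  refine (ensures_time search s (by decide)).framed fun t hf ht => ?_
  have htn := (hf.reg .n (by decide)).trans h.reg_n
  have htk := (hf.reg .k (by decide)).trans h.reg_k
  have htlg := (hf.reg .lg (by decide)).trans h.reg_lg
  have hts := (hf.reg .size (by decide)).trans h.reg_size
  have htadj := hf.arr .adj (by decide)
  refine ((ensures_minimumDegree t htn _ fun v => rfl).and
    (ensures_time minimumDegree t (by decide))).framed fun u hf' ⟨⟨hμ1, hμ2⟩, ht'⟩ => ?_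
  have hun := (hf'.reg .n (by decide)).trans htn
  have huk := (hf'.reg .k (by decide)).trans htk
  have hulg := (hf'.reg .lg (by decide)).trans htlg
  have hus := (hf'.reg .size (by decide)).trans hts
  rw [htadj] at hμ1 hμ2
  have hc := cost_search s
  have hc' := cost_minimumDegree t
  rw [h.reg_n, h.reg_k] at hc
  rw [htn] at hc'
  set μ := u.reg .mindeg with hμ
  have hμn : μ ≤ n := by
    obtain e | ⟨v, hv, e⟩ := hμ2
    · exact e.le
    · rw [e]
      exact (card_filter_le _ _).trans_eq (card_range n)
  have hμd : n ≤ d * μ := by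
    obtain e | ⟨v, hv, e⟩ := hμ2
    · rwa [e]
    · rw [e]
      exact (hG ⟨v, hv⟩).trans_eq (by rw [h.card_filter ⟨v, hv⟩])
  refine (ensures_binarySearch_resources u hun huk hμ.symm hμn hμd).mono fun w ⟨hw1, hw2⟩ => ?_
  rw [hus] at hw1
  rw [hulg] at hw2
  exact ⟨by omega, by omega⟩

theorem ensures_sampleSize_input (c : ℕ) : Ensures sampleSize (input c G) fun t =>
    Loaded G (c * (Nat.log 2 (Nat.log 2 n) + 1)) t ∧ t.time ≤ 100 * ((n + 1) * (c + 1)) := by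
  have hn : (input c G).reg .n = n := rfl
  have hc : (input c G).reg .c = c := rfl
  refine ((ensures_sampleSize (input c G)).and (ensures_sampleSize_time (input c G))).framed
    fun t hf ⟨⟨h1, h2, h3⟩, h4⟩ => ⟨⟨hf.reg .n (by decide), ?_, ?_, hf.reg .size (by decide),
      fun u v => ?_⟩, ?_⟩
  · rw [h3, hn, hc]
  · rw [h1, hn]
  · rw [hf.arr .adj (by decide)]
    simp [input]
  · simpa [hn, hc, input] using h4

theorem run_resources {c d k : ℕ} (hk : k = c * (Nat.log 2 (Nat.log 2 n) + 1))
    (hd : n ≤ d * n) (hG : ∀ v, n ≤ d * G.degree v) :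
    ∀ s ∈ (run c G).support, s.reg .size ≤ d ^ 2 + d + 2 ∧
      s.time ≤ 100 * ((n + 1) * (c + 1)) + 1000 * (k + 1) + 1000 * ((n + 1) ^ 2 * (k + 1)) +
        1000 * (n + 1) ^ 2 + 30000 * ((Nat.log 2 n + 3) *
          ((n + 1) * (k + 1) * (d ^ 2 + d + 3) ^ 3 * (d + 1) ^ k)) := by
  change Ensures (sampleSize ;; chooseRoots ;; afterRoots) _ _
  simp only [ensures_seq]
  refine (ensures_sampleSize_input c).mono fun t ⟨ht, ht'⟩ => ?_
  rw [← hk] at ht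
  refine ht.after_chooseRoots.mono fun u ⟨hu, hu'⟩ => ?_
  exact (hu.afterRoots_resources hd hG).mono fun w ⟨hw, hw'⟩ => ⟨hw, by omega⟩

theorem isLabeling_output {c : ℕ} (hn : 0 < n) (hG : ∀ v, 0 < G.degree v) :
    ∀ s ∈ (run c G).support, Bandwidth.IsLabeling (output s : Fin n → ℕ) := by
  change Ensures (sampleSize ;; chooseRoots ;; afterRoots) _ _
  simp only [ensures_seq]
  refine (ensures_sampleSize_input c).mono fun t ⟨ht, _⟩ => ?_
  refine (ht.after_chooseRoots.and (ensures_chooseRoots t ht.reg_n hn)).mono fun u ⟨⟨hu, _⟩, hu'⟩ => ?_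
  rw [ht.reg_k] at hu'
  exact (hu.afterRoots_correct hn hG hu').mono fun w hw => hw.1

/-- The bound holds from every state that the first phase can leave behind, hence on average. The
later phases can turn a covering choice of roots only into a good labeling. -/
theorem one_sub_le_run {c k : ℕ} (hk : k = c * (Nat.log 2 (Nat.log 2 n) + 1)) (hn : 0 < n)
    {δ : ℝ} (hG0 : ∀ v, 0 < G.degree v) (hG : ∀ v, δ * n ≤ G.degree v)
    (D : Finset (Fin n)) (hD : ∀ v, ∃ d ∈ D, G.Adj v d) :
    1 - #D * ENNReal.ofReal (1 - δ) ^ k ≤ (run c G).toOuterMeasure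
      {s | Bandwidth.width G (output s) ≤ 6 * Bandwidth.bandwidth G} := by
  change _ ≤ ((exec sampleSize (input c G)).bind
    (exec (chooseRoots ;; afterRoots))).toOuterMeasure _
  have key : ∀ t ∈ (exec sampleSize (input c G)).support, 1 - #D * ENNReal.ofReal (1 - δ) ^ k ≤
      (exec (chooseRoots ;; afterRoots) t).toOuterMeasure
        {s | Bandwidth.width G (output s) ≤ 6 * Bandwidth.bandwidth G} := by
    intro t ht
    obtain ⟨ht, -⟩ := ensures_sampleSize_input c t ht
    rw [← hk] at ht
    have h1 := chooseRoots_not_covered_le G hn hG D hD t ht.reg_n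
    rw [ht.reg_k] at h1
    refine (one_sub_le_toOuterMeasure h1).trans
      (toOuterMeasure_le_bind fun u hu hC w hw => ?_)
    have h2 := ensures_chooseRoots t ht.reg_n hn u hu
    rw [ht.reg_k] at h2
    exact ((ht.after_chooseRoots u hu).1.afterRoots_correct hn hG0 h2 w hw).2 hC
  rw [PMF.toOuterMeasure_bind_apply]
  calc _ = ∑' t, (exec sampleSize (input c G)) t * (1 - #D * ENNReal.ofReal (1 - δ) ^ k) := by
        rw [ENNReal.tsum_mul_right, PMF.tsum_coe, one_mul]
    _ ≤ _ := ENNReal.tsum_le_tsum fun t => ?_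
  by_cases ht : t ∈ (exec sampleSize (input c G)).support
  · exact mul_le_mul_right (key t ht) _
  · simp [(PMF.apply_eq_zero_iff _ t).2 ht]

end

/-! ### Estimates -/

/-- Changing from base two to natural logarithms costs a factor two and an additive constant. Since
`e < 3`, `log log n` is at least `y₀ = log log 3 > 0`, and the constant is absorbed by the
coefficient `2 / y₀`. -/
theorem log_log_add_one_le : ∃ C : ℕ, ∀ n : ℕ, 3 ≤ n →
    (Nat.log 2 (Nat.log 2 n) + 1 : ℝ) ≤ C * Real.log (Real.log n) := by
  have h3 : (1 : ℝ) < Real.log 3 := by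
    rw [Real.lt_log_iff_exp_lt (by norm_num)]
    exact Real.exp_one_lt_d9.trans (by norm_num)
  have hy₀ : 0 < Real.log (Real.log 3) := Real.log_pos h3
  set y₀ := Real.log (Real.log 3)
  refine ⟨⌈2 / y₀ + 2⌉₊, fun n hn => ?_⟩
  have hn' : (3 : ℝ) ≤ n := by exact_mod_cast hn
  have hlog : 1 < Real.log n := h3.trans_le (Real.log_le_log (by norm_num) hn')
  have hy : y₀ ≤ Real.log (Real.log n) :=
    Real.log_le_log (by linarith) (Real.log_le_log (by norm_num) hn')
  have hl2 := Real.log_two_gt_d9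
  have hlg0 : 0 < Nat.log 2 n := Nat.log_pos one_lt_two (by omega)
  have h1 : (Nat.log 2 n : ℝ) * Real.log 2 ≤ Real.log n := by
    rw [← Real.log_pow]
    exact Real.log_le_log (by positivity) (by exact_mod_cast Nat.pow_log_le_self 2 (by omega))
  have h2 : (Nat.log 2 (Nat.log 2 n) : ℝ) * Real.log 2 ≤ Real.log (Nat.log 2 n) := by
    rw [← Real.log_pow]
    exact Real.log_le_log (by positivity)
      (by exact_mod_cast Nat.pow_log_le_self 2 hlg0.ne')
  have h4 : Real.log (Nat.log 2 n) ≤ Real.log 2 + Real.log (Real.log n) := by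
    rw [← Real.log_mul (by norm_num) (by linarith)]
    refine Real.log_le_log (by exact_mod_cast hlg0) ?_
    nlinarith
  have h5 : (Nat.log 2 (Nat.log 2 n) : ℝ) ≤ 1 + 2 * Real.log (Real.log n) := by
    nlinarith
  calc (Nat.log 2 (Nat.log 2 n) + 1 : ℝ) ≤ 2 + 2 * Real.log (Real.log n) := by linarith
    _ ≤ (2 / y₀ + 2) * Real.log (Real.log n) := by
        rw [add_mul, div_mul_eq_mul_div]
        gcongr
        rw [le_div_iff₀ hy₀]
        linarith
    _ ≤ _ := mul_le_mul_of_nonneg_right (Nat.le_ceil _) (hy₀.le.trans hy)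

theorem exists_pow_le_mul_two_pow (m : ℕ) : ∃ C : ℕ, ∀ x : ℕ, x ^ m ≤ C * 2 ^ x := by
  obtain ⟨B, hB⟩ := (tendsto_pow_const_div_const_pow_of_one_lt m
    (one_lt_two (α := ℝ))).bddAbove_range
  refine ⟨⌈B⌉₊, fun x => ?_⟩
  have h := (hB ⟨x, rfl⟩).trans (Nat.le_ceil B)
  simp only at h
  rw [div_le_iff₀ (by positivity)] at h
  exact_mod_cast h

/-- With `l = log n`, a constant to the power `log l + 1` is at most a power of `2 * l`, so the left
side is polynomial in `l`, whereas `n ≥ 2 ^ l`. -/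
theorem exists_log_mul_pow_le (c d : ℕ) : ∃ C : ℕ, ∀ n : ℕ, 3 ≤ n →
    (Nat.log 2 n + 3) * (d + 1) ^ (c * (Nat.log 2 (Nat.log 2 n) + 1)) ≤ C * n := by
  set a := (d + 1) ^ c with ha
  obtain ⟨C, hC⟩ := exists_pow_le_mul_two_pow (a + 1)
  refine ⟨4 * 2 ^ a * C, fun n hn => ?_⟩
  have hlg0 : 0 < Nat.log 2 n := Nat.log_pos one_lt_two (by omega)
  have h1 := Nat.pow_log_le_self 2 (show n ≠ 0 by omega)
  have h2 := Nat.pow_log_le_self 2 hlg0.ne'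
  set l := Nat.log 2 n
  calc (l + 3) * (d + 1) ^ (c * (Nat.log 2 l + 1))
      ≤ (4 * l) * (2 * l) ^ a := by
        refine Nat.mul_le_mul (by omega) ?_
        rw [pow_mul, ← ha]
        calc a ^ (Nat.log 2 l + 1) ≤ (2 ^ a) ^ (Nat.log 2 l + 1) :=
              Nat.pow_le_pow_left Nat.lt_two_pow_self.le _
          _ = (2 * 2 ^ Nat.log 2 l) ^ a := by rw [← pow_mul, mul_comm, pow_mul, pow_succ']
          _ ≤ _ := Nat.pow_le_pow_left (Nat.mul_le_mul_left 2 h2) _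
    _ = 4 * 2 ^ a * l ^ (a + 1) := by ring
    _ ≤ 4 * 2 ^ a * (C * n) :=
        Nat.mul_le_mul_left _ ((hC l).trans (Nat.mul_le_mul_left _ h1))
    _ = _ := by ring

theorem exists_time_le (c d : ℕ) : ∃ C : ℝ, ∀ n k t : ℕ, 3 ≤ n →
    k = c * (Nat.log 2 (Nat.log 2 n) + 1) →
    t ≤ 100 * ((n + 1) * (c + 1)) + 1000 * (k + 1) + 1000 * ((n + 1) ^ 2 * (k + 1)) +
      1000 * (n + 1) ^ 2 + 30000 * ((Nat.log 2 n + 3) *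
        ((n + 1) * (k + 1) * (d ^ 2 + d + 3) ^ 3 * (d + 1) ^ k)) →
    (t : ℝ) ≤ C * ((n : ℝ) ^ 2 * Real.log (Real.log (n : ℝ))) := by
  obtain ⟨C₁, hC₁⟩ := exists_log_mul_pow_le c d
  obtain ⟨C₂, hC₂⟩ := log_log_add_one_le
  -- All summands are compared with the cost `(n + 1) ^ 2 * (k + 1)` of the breadth-first searches.
  set E := 100 * (c + 1) + 3000 + 30000 * ((d ^ 2 + d + 3) ^ 3 * C₁) with hE
  refine ⟨(E * 4 * (c + 1) * C₂ : ℕ), fun n k t hn hk ht => ?_⟩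
  have h1 := hC₁ n hn
  rw [← hk] at h1
  have h2 : t ≤ E * ((n + 1) ^ 2 * (k + 1)) := by
    have e1 : (n + 1) * (c + 1) ≤ (c + 1) * ((n + 1) ^ 2 * (k + 1)) := by
      calc (n + 1) * (c + 1) = (c + 1) * ((n + 1) * 1 * 1) := by ring
        _ ≤ (c + 1) * ((n + 1) * (n + 1) * (k + 1)) := by gcongr <;> omega
        _ = _ := by ring
    have e2 : k + 1 ≤ (n + 1) ^ 2 * (k + 1) := Nat.le_mul_of_pos_left _ (by positivity)
    have e3 : (n + 1) ^ 2 ≤ (n + 1) ^ 2 * (k + 1) := Nat.le_mul_of_pos_right _ (by positivity)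
    have e4 : (Nat.log 2 n + 3) * ((n + 1) * (k + 1) * (d ^ 2 + d + 3) ^ 3 * (d + 1) ^ k) ≤
        (d ^ 2 + d + 3) ^ 3 * C₁ * ((n + 1) ^ 2 * (k + 1)) := by
      calc _ = (d ^ 2 + d + 3) ^ 3 * ((n + 1) * (k + 1)) *
            ((Nat.log 2 n + 3) * (d + 1) ^ k) := by ring
        _ ≤ (d ^ 2 + d + 3) ^ 3 * ((n + 1) * (k + 1)) * (C₁ * (n + 1)) := by
            refine Nat.mul_le_mul_left _ ?_
            exact h1.trans (Nat.mul_le_mul_left _ (Nat.le_succ n))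
        _ = _ := by ring
    rw [hE]
    nlinarith
  have h3 : k + 1 ≤ (c + 1) * (Nat.log 2 (Nat.log 2 n) + 1) := by
    rw [hk, Nat.succ_mul]
    omega
  have h4 : (n + 1) ^ 2 ≤ 4 * n ^ 2 := by nlinarith
  have h5 : t ≤ E * 4 * (c + 1) * (n ^ 2 * (Nat.log 2 (Nat.log 2 n) + 1)) := by
    calc t ≤ E * ((n + 1) ^ 2 * (k + 1)) := h2
      _ ≤ E * (4 * n ^ 2 * ((c + 1) * (Nat.log 2 (Nat.log 2 n) + 1))) := by gcongr
      _ = _ := by ring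
  calc (t : ℝ) ≤ (E * 4 * (c + 1) : ℕ) * ((n : ℝ) ^ 2 * (Nat.log 2 (Nat.log 2 n) + 1)) := by
        exact_mod_cast h5
    _ ≤ (E * 4 * (c + 1) : ℕ) * ((n : ℝ) ^ 2 * (C₂ * Real.log (Real.log n))) := by
        gcongr
        exact hC₂ n hn
    _ = _ := by
        push_cast
        ring

/-- Here `l` is `log n`. Choose `c` with `(1 - δ) ^ c ≤ ε / 2`: raised to the power `log l + 1`, the
factor `1 / 2` compensates for `l + 1`, and `ε = α / (M + 1)` for the rest. -/
theorem exists_sample_constant {δ α : ℝ} (hδ₀ : 0 < δ) (hδ₁ : δ < 1) (hα₀ : 0 < α)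
    (hα₁ : α < 1) (M : ℕ) : ∃ c₀ : ℕ, ∀ c : ℕ, c₀ ≤ c → ∀ l : ℕ,
      (M * (l + 1) : ℝ) * (1 - δ) ^ (c * (Nat.log 2 l + 1)) ≤ α := by
  set ε := α / (M + 1) with hε
  have hM : (0 : ℝ) < M + 1 := by positivity
  have hε0 : 0 < ε := by positivity
  have hε1 : ε ≤ 1 := by
    rw [hε, div_le_one hM]
    linarith [(Nat.cast_nonneg M : (0 : ℝ) ≤ M)]
  obtain ⟨c₀, hc₀⟩ := exists_pow_lt_of_lt_one (show 0 < ε / 2 by positivity)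
    (show 1 - δ < 1 by linarith)
  refine ⟨c₀, fun c hc l => ?_⟩
  have h1 : (1 - δ) ^ c ≤ ε / 2 :=
    (pow_le_pow_of_le_one (by linarith) (by linarith) hc).trans hc₀.le
  have h2 : ((l + 1 : ℕ) : ℝ) ≤ 2 ^ (Nat.log 2 l + 1) := by
    exact_mod_cast Nat.lt_pow_succ_log_self one_lt_two l
  have h3 : (1 - δ) ^ (c * (Nat.log 2 l + 1)) ≤ ε / 2 ^ (Nat.log 2 l + 1) := by
    rw [pow_mul]
    refine (pow_le_pow_left₀ (pow_nonneg (by linarith) _) h1 _).trans ?_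
    rw [div_pow]
    gcongr
    exact pow_le_of_le_one hε0.le hε1 (Nat.succ_ne_zero _)
  calc (M * (l + 1) : ℝ) * (1 - δ) ^ (c * (Nat.log 2 l + 1))
      ≤ ((M + 1) * 2 ^ (Nat.log 2 l + 1)) * (ε / 2 ^ (Nat.log 2 l + 1)) := by
        push_cast at h2
        gcongr
        linarith
    _ = α := by
        rw [hε]
        field_simp

end Algorithm2

/-! ### The main theorem -/

theorem theorem2 (δ α : ℝ) (hδ₀ : 0 < δ) (hδ₁ : δ < 1) (hα₀ : 0 < α) (hα₁ : α < 1) :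
    ∃ c₀ : ℕ, ∀ c : ℕ, c₀ ≤ c → ∃ C : ℝ,
      ∀ (n : ℕ) (G : SimpleGraph (Fin n)) [DecidableRel G.Adj], Bandwidth.IsDense δ G →
        (∀ s ∈ (Algorithm2.run c G).support,
          Bandwidth.IsLabeling (Algorithm2.output s : Fin n → ℕ) ∧
          s.reg RAM.Reg.size ≤ ⌈1 / δ⌉₊ ^ 2 + ⌈1 / δ⌉₊ + 2 ∧
          (3 ≤ n → (s.time : ℝ) ≤ C * ((n : ℝ) ^ 2 * Real.log (Real.log (n : ℝ))))) ∧
        ENNReal.ofReal ((1 - α) ^ 2) ≤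
          (Algorithm2.run c G).toOuterMeasure
            {s | Bandwidth.width G (Algorithm2.output s) ≤ 6 * Bandwidth.bandwidth G} := by
  obtain ⟨M, hM⟩ := exists_pow_lt_of_lt_one (show (0 : ℝ) < 1 / 2 by norm_num)
    (show 1 - δ < 1 by linarith)
  obtain ⟨c₀, hc₀⟩ := Algorithm2.exists_sample_constant hδ₀ hδ₁ hα₀ hα₁ M
  refine ⟨c₀, fun c hc => ?_⟩
  obtain ⟨C, hC⟩ := Algorithm2.exists_time_le c ⌈1 / δ⌉₊
  refine ⟨C, fun n G _ hG => ?_⟩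
  have hdeg : ∀ v, δ * n ≤ G.degree v := by
    intro v
    refine (le_of_eq_of_le (by rw [Fintype.card_fin]) hG).trans ?_
    exact_mod_cast G.minDegree_le_degree v
  have hceil : ∀ x y : ℕ, δ * x ≤ y → x ≤ ⌈1 / δ⌉₊ * y := by
    intro x y h
    have h1 : (x : ℝ) ≤ 1 / δ * y := by
      rw [one_div, ← div_eq_inv_mul, le_div_iff₀ hδ₀]
      linarith
    exact_mod_cast h1.trans (mul_le_mul_of_nonneg_right (Nat.le_ceil _) (Nat.cast_nonneg y))
  have hres := Algorithm2.run_resources (G := G) (c := c) rfl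
    (hceil n n (mul_le_of_le_one_left (Nat.cast_nonneg n) hδ₁.le)) fun v => hceil _ _ (hdeg v)
  -- Without vertices there is no root to draw, but every function is a labeling and the width is
  -- zero.
  obtain rfl | hn := Nat.eq_zero_or_pos n
  · refine ⟨fun s hs => ⟨?_, (hres s hs).1, by omega⟩, ?_⟩
    · have : IsEmpty (Fin 0) := inferInstance
      simp [Bandwidth.IsLabeling, Set.univ_eq_empty_iff.2 this]
    · refine (ENNReal.ofReal_le_one.2 (pow_le_one₀ (by linarith) (by linarith))).trans_eq
        ((PMF.toOuterMeasure_apply_eq_one_iff _ _).2 fun s _ => ?_).symm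
      simp [Bandwidth.width]
  have hdeg0 : ∀ v, 0 < G.degree v := by
    intro v
    have := (mul_pos hδ₀ (Nat.cast_pos.2 hn)).trans_le (hdeg v)
    exact_mod_cast this
  refine ⟨fun s hs => ⟨Algorithm2.isLabeling_output hn hdeg0 s hs, (hres s hs).1,
    fun hn3 => hC n _ _ hn3 rfl (hres s hs).2⟩, ?_⟩
  obtain ⟨D, hD, hdom⟩ := Algorithm2.exists_dominating G hδ₁.le hn hdeg hM.le
  refine le_trans ?_ (Algorithm2.one_sub_le_run rfl hn hdeg0 hdeg D hdom)
  have h1 := hc₀ c hc (Nat.log 2 n)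
  set k := c * (Nat.log 2 (Nat.log 2 n) + 1)
  have h2 : (D.card : ℝ) * (1 - δ) ^ k ≤ α := by
    refine (mul_le_mul_of_nonneg_right ?_ (pow_nonneg (by linarith) _)).trans h1
    exact_mod_cast hD
  -- Success has probability at least `1 - α`, which is at least `(1 - α) ^ 2`.
  calc ENNReal.ofReal ((1 - α) ^ 2) ≤ ENNReal.ofReal (1 - α) :=
        ENNReal.ofReal_le_ofReal (pow_le_of_le_one (by linarith) (by linarith) two_ne_zero)
    _ = 1 - ENNReal.ofReal α := by rw [ENNReal.ofReal_sub _ hα₀.le, ENNReal.ofReal_one]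
    _ ≤ _ := by
        refine tsub_le_tsub_left ?_ _
        rw [← ENNReal.ofReal_pow (by linarith), ← ENNReal.ofReal_natCast,
          ← ENNReal.ofReal_mul (by positivity)]
        exact ENNReal.ofReal_le_ofReal h2
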